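/- **Setting.** Let $D\subseteq(0,\infty)\times\mathbb R$ be open, such that for each $\rho$ the slice $\{\varepsilon:(\rho,\varepsilon)\in D\}$ is connected. Consider smooth fields $\rho$ (mass density), $\mathbf v$ (velocity), $\varepsilon$ (specific internal energy) of $(t,\mathbf x)\in\mathbb R\times\mathbb R^3$, put $\mathbf L=\operatorname{sym}\nabla\mathbf v$, and let the state variables be $z=(\rho,\varepsilon,\nabla\rho,\mathbf L,\nabla\varepsilon,\nabla\nabla\rho)$ with $(\rho,\varepsilon)\in D$. Let $p,\alpha_1,\dots,\alpha_6,q_1,q_2,s_0,\dots,s_5$ be smooth functions of $(\rho,\varepsilon)\in D$, and let $$\mathbf T=(-p+\alpha_1\Delta\rho+\alpha_2|\nabla\rho|^2)\mathbf I+\alpha_3\nabla\rho\otimes\nabla\rho+\alpha_4\nabla\nabla\rho+\alpha_5(\nabla\cdot\mathbf v)\mathbf I+\alpha_6\mathbf L,\qquad \mathbf q=q_1\nabla\varepsilon+q_2\nabla\rho,$$ $$s=s_0+s_1|\nabla\rho|^2+s_2\nabla\rho\cdot\nabla\varepsilon+s_3|\nabla\varepsilon|^2+s_4\nabla\cdot\mathbf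 v+s_5\Delta\rho .$$ Let the entropy flux $\mathbf J=\mathbf J(z)$ be a smooth vector-valued function of the state variables, isotropic with respect to the full orthogonal group $O(3)$. Assume that $\partial s_0/\partial\varepsilon\neq0$ on $D$ and that $\alpha_1+\alpha_4$ does not vanish identically on any nonempty open subset of $D$. Write $$\mathcal E^{(1)}=\partial_t\rho+\nabla\cdot(\rho\mathbf v),\quad \mathcal E^{(2)}=\rho(\partial_t\mathbf v+(\mathbf v\cdot\nabla)\mathbf v)-\nabla\cdot\mathbf T,\quad \mathcal E^{(3)}=\rho(\partial_t\varepsilon+\mathbf v\cdot\nabla\varepsilon)-\mathbf T\cdot\nabla\mathbf v+\nabla\cdot\mathbf q .$$ **Hypothesis (extended Liu entropy inequality).** There are functions $\lambda^{(1)},\boldsymbol\lambda^{(2)},\lambda^{(3)},\boldsymbol\Lambda^{(1)},\boldsymbol\Lambda^{(2)},\boldsymbol\Lambda^{(3)},\boldsymbol\Theta^{(1)}$ of the state variables (scalars, vectors and second-order tensors as the contractions require) such that, for all smooth fields $\rho,\mathbf v,\varepsilon$ on $\mathbb R\times\mathbb R^3$ (not required to satisfy any field equation) and at every point $(t,\mathbf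 x)$ where $(\rho,\varepsilon)\in D$, $$\rho(\partial_ts+\mathbf v\cdot\nabla s)+\nabla\cdot\mathbf J-\lambda^{(1)}\mathcal E^{(1)}-\boldsymbol\lambda^{(2)}\cdot\mathcal E^{(2)}-\lambda^{(3)}\mathcal E^{(3)}-\boldsymbol\Lambda^{(1)}\cdot\nabla\mathcal E^{(1)}-\boldsymbol\Lambda^{(2)}\cdot\nabla\mathcal E^{(2)}-\boldsymbol\Lambda^{(3)}\cdot\nabla\mathcal E^{(3)}-\boldsymbol\Theta^{(1)}\cdot\nabla\nabla\mathcal E^{(1)}\ \ge\ 0 .$$ **Conclusion.** On $D$ one has $s_2=s_3=s_4=s_5=0$, and $s_1$ is a smooth function of $\rho$ alone, so that $s=s_0(\rho,\varepsilon)+s_1(\rho)|\nabla\rho|^2$. Moreover $$\mathbf J=\mathbf q\,\frac{\partial s_0}{\partial\varepsilon}+2\rho^2s_1(\rho)(\nabla\cdot\mathbf v)\nabla\rho,$$ $$p=-\rho^2\frac{\partial s_0}{\partial\rho}\Big(\frac{\partial s_0}{\partial\varepsilon}\Big)^{-1},\quad \alpha_1=-2\rho^2s_1\Big(\frac{\partial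 s_0}{\partial\varepsilon}\Big)^{-1},\quad \alpha_2=-\rho\,(\rho s_1'+2s_1)\Big(\frac{\partial s_0}{\partial\varepsilon}\Big)^{-1},\quad \alpha_3=2\rho s_1\Big(\frac{\partial s_0}{\partial\varepsilon}\Big)^{-1},\quad \alpha_4=0 .$$ -/

import Mathlib

open scoped ContDiff

namespace Korteweg

/-- Vectors of the three-dimensional Euclidean space, in Cartesian components. -/
abbrev V : Type := Fin 3 → ℝ

/-- Second order tensors, in Cartesian components. -/
abbrev T2 : Type := Fin 3 → Fin 3 → ℝ

/-- Time and position `(t, x)`. -/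
abbrev SpaceTime : Type := ℝ × V

/-- The state variables `(ρ, ε, ∇ρ, L, ∇ε, ∇∇ρ)`. -/
abbrev State : Type := ℝ × ℝ × V × T2 × V × T2

namespace State

def rho (z : State) : ℝ := z.1
def eps (z : State) : ℝ := z.2.1
def gradRho (z : State) : V := z.2.2.1
/-- The symmetric part of the velocity gradient. -/
def L (z : State) : T2 := z.2.2.2.1
def gradEps (z : State) : V := z.2.2.2.2.1
def hessRho (z : State) : T2 := z.2.2.2.2.2

/-- The states with `(ρ, ε) ∈ D`; the tensor slots are not restricted here. -/
def region (D : Set (ℝ × ℝ)) : Set State := {z | (z.rho, z.eps) ∈ D}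

/-- The states with `(ρ, ε) ∈ D`, with `L` and `∇∇ρ` symmetric. -/
def Admissible (D : Set (ℝ × ℝ)) (z : State) : Prop :=
  (z.rho, z.eps) ∈ D ∧ (∀ i j, z.L i j = z.L j i) ∧ (∀ i j, z.hessRho i j = z.hessRho j i)

end State

/-- The scalar product of vectors. -/
def dot (a b : V) : ℝ := ∑ i, a i * b i

/-- The full contraction of second order tensors. -/
def ddot (A B : T2) : ℝ := ∑ i, ∑ j, A i j * B i j

/-- The trace. -/
def tr (A : T2) : ℝ := ∑ i, A i i

/-- The Kronecker delta. -/
def delta (i j : Fin 3) : ℝ := if i = j then 1 else 0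

/-- The action of an orthogonal matrix on vectors. -/
def actV (Q : Matrix (Fin 3) (Fin 3) ℝ) (a : V) : V := fun i => ∑ j, Q i j * a j

/-- The action `A ↦ Q A Qᵀ` of an orthogonal matrix on second order tensors. -/
def actT (Q : Matrix (Fin 3) (Fin 3) ℝ) (A : T2) : T2 :=
  fun i j => ∑ a, ∑ b, Q i a * Q j b * A a b

/-- The action of an orthogonal matrix on states. -/
def actState (Q : Matrix (Fin 3) (Fin 3) ℝ) (z : State) : State :=
  (z.rho, z.eps, actV Q z.gradRho, actT Q z.L, actV Q z.gradEps, actT Q z.hessRho)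

/-- A vector valued constitutive function is isotropic (with respect to the full orthogonal
group) on the admissible states over `D`. -/
def IsotropicVector (D : Set (ℝ × ℝ)) (J : State → V) : Prop :=
  ∀ Q ∈ Matrix.orthogonalGroup (Fin 3) ℝ, ∀ z : State, z.Admissible D →
    J (actState Q z) = actV Q (J z)

/-- The material functions of `(ρ, ε)`: the pressure and the coefficients of the stress
tensor, of the heat flux, and of the expansion of the specific entropy. -/
structure MaterialFunctions where
  p : ℝ → ℝ → ℝ
  α1 : ℝ → ℝ → ℝ
  α2 : ℝ → ℝ → ℝ
  α3 : ℝ → ℝ → ℝ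
  α4 : ℝ → ℝ → ℝ
  α5 : ℝ → ℝ → ℝ
  α6 : ℝ → ℝ → ℝ
  q1 : ℝ → ℝ → ℝ
  q2 : ℝ → ℝ → ℝ
  s0 : ℝ → ℝ → ℝ
  s1 : ℝ → ℝ → ℝ
  s2 : ℝ → ℝ → ℝ
  s3 : ℝ → ℝ → ℝ
  s4 : ℝ → ℝ → ℝ
  s5 : ℝ → ℝ → ℝ

/-- `f` is a smooth function of `(ρ, ε)` on `D`. -/
def Smooth2 (D : Set (ℝ × ℝ)) (f : ℝ → ℝ → ℝ) : Prop :=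
  ContDiffOn ℝ ∞ (fun z : ℝ × ℝ => f z.1 z.2) D

/-- `∂f/∂ρ`. -/
noncomputable def dRho (f : ℝ → ℝ → ℝ) (ρ ε : ℝ) : ℝ := deriv (fun r => f r ε) ρ

/-- `∂f/∂ε`. -/
noncomputable def dEps (f : ℝ → ℝ → ℝ) (ρ ε : ℝ) : ℝ := deriv (fun e => f ρ e) ε

namespace MaterialFunctions

/-- All material functions are smooth on `D`. -/
structure SmoothOn (m : MaterialFunctions) (D : Set (ℝ × ℝ)) : Prop where
  p : Smooth2 D m.p
  α1 : Smooth2 D m.α1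
  α2 : Smooth2 D m.α2
  α3 : Smooth2 D m.α3
  α4 : Smooth2 D m.α4
  α5 : Smooth2 D m.α5
  α6 : Smooth2 D m.α6
  q1 : Smooth2 D m.q1
  q2 : Smooth2 D m.q2
  s0 : Smooth2 D m.s0
  s1 : Smooth2 D m.s1
  s2 : Smooth2 D m.s2
  s3 : Smooth2 D m.s3
  s4 : Smooth2 D m.s4
  s5 : Smooth2 D m.s5

/-- The Cauchy stress tensor
`(-p + α₁ Δρ + α₂ |∇ρ|²) I + α₃ ∇ρ ⊗ ∇ρ + α₄ ∇∇ρ + α₅ (∇·v) I + α₆ L`. -/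
def stress (m : MaterialFunctions) (z : State) : T2 := fun i j =>
  (-m.p z.rho z.eps + m.α1 z.rho z.eps * tr z.hessRho
      + m.α2 z.rho z.eps * dot z.gradRho z.gradRho) * delta i j
    + m.α3 z.rho z.eps * (z.gradRho i * z.gradRho j)
    + m.α4 z.rho z.eps * z.hessRho i j
    + m.α5 z.rho z.eps * tr z.L * delta i j
    + m.α6 z.rho z.eps * z.L i j

/-- The heat flux `q₁ ∇ε + q₂ ∇ρ`. -/
def heatFlux (m : MaterialFunctions) (z : State) : V := fun i =>
  m.q1 z.rho z.eps * z.gradEps i + m.q2 z.rho z.eps * z.gradRho i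

/-- The specific entropy
`s₀ + s₁ |∇ρ|² + s₂ ∇ρ·∇ε + s₃ |∇ε|² + s₄ ∇·v + s₅ Δρ`. -/
def entropy (m : MaterialFunctions) (z : State) : ℝ :=
  m.s0 z.rho z.eps
    + m.s1 z.rho z.eps * dot z.gradRho z.gradRho
    + m.s2 z.rho z.eps * dot z.gradRho z.gradEps
    + m.s3 z.rho z.eps * dot z.gradEps z.gradEps
    + m.s4 z.rho z.eps * tr z.L
    + m.s5 z.rho z.eps * tr z.hessRho

end MaterialFunctions

/-- The partial derivative with respect to time. -/
noncomputable def dt (f : SpaceTime → ℝ) : SpaceTime → ℝ :=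
  fun y => fderiv ℝ f y (1, 0)

/-- The partial derivative with respect to the `i`-th spatial coordinate. -/
noncomputable def dx (i : Fin 3) (f : SpaceTime → ℝ) : SpaceTime → ℝ :=
  fun y => fderiv ℝ f y (0, Pi.single i 1)

/-- The fields of mass density, velocity and specific internal energy. -/
structure Fields where
  rho : SpaceTime → ℝ
  v : SpaceTime → V
  eps : SpaceTime → ℝ

namespace Fields

/-- Smooth fields. -/
structure Smooth (w : Fields) : Prop where
  rho : ContDiff ℝ ∞ w.rho
  v : ContDiff ℝ ∞ w.v
  eps : ContDiff ℝ ∞ w.eps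

/-- The velocity gradient `v_{i,j}`. -/
noncomputable def gradV (w : Fields) (y : SpaceTime) : T2 :=
  fun i j => dx j (fun y' => w.v y' i) y

/-- The state variables along the given fields. -/
noncomputable def state (w : Fields) (y : SpaceTime) : State :=
  (w.rho y, w.eps y, fun i => dx i w.rho y,
    fun i j => (w.gradV y i j + w.gradV y j i) / 2,
    fun i => dx i w.eps y, fun i j => dx j (dx i w.rho) y)

/-- The material derivative `∂f/∂t + v·∇f`. -/
noncomputable def materialDeriv (w : Fields) (f : SpaceTime → ℝ) (y : SpaceTime) : ℝ :=
  dt f y + ∑ j, w.v y j * dx j f y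

/-- The left-hand side of the balance of mass, `∂ρ/∂t + ∇·(ρ v)`. -/
noncomputable def massBalance (w : Fields) (y : SpaceTime) : ℝ :=
  dt w.rho y + ∑ j, dx j (fun y' => w.rho y' * w.v y' j) y

/-- The left-hand side of the balance of linear momentum,
`ρ (∂v/∂t + (v·∇) v) - ∇·T`. -/
noncomputable def momentumBalance (m : MaterialFunctions) (w : Fields) (y : SpaceTime) : V :=
  fun i => w.rho y * w.materialDeriv (fun y' => w.v y' i) y
    - ∑ j, dx j (fun y' => m.stress (w.state y') i j) y

/-- The left-hand side of the balance of energy,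
`ρ (∂ε/∂t + v·∇ε) - T·∇v + ∇·q`. -/
noncomputable def energyBalance (m : MaterialFunctions) (w : Fields) (y : SpaceTime) : ℝ :=
  w.rho y * w.materialDeriv w.eps y - ddot (m.stress (w.state y)) (w.gradV y)
    + ∑ j, dx j (fun y' => m.heatFlux (w.state y') j) y

/-- The local entropy production `ρ (∂s/∂t + v·∇s) + ∇·J`. -/
noncomputable def entropyProduction (m : MaterialFunctions) (J : State → V) (w : Fields)
    (y : SpaceTime) : ℝ :=
  w.rho y * w.materialDeriv (fun y' => m.entropy (w.state y')) y
    + ∑ j, dx j (fun y' => J (w.state y') j) y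

end Fields

/-- The Lagrange multipliers, functions of the state variables: those of the balance
equations, of their spatial gradients, and of the second gradient of the mass balance. -/
structure Multipliers where
  lam1 : State → ℝ
  lam2 : State → V
  lam3 : State → ℝ
  Lam1 : State → V
  Lam2 : State → T2
  Lam3 : State → V
  Theta1 : State → T2

/-- The left-hand side of the extended entropy inequality: the entropy production minus the
balance equations, their first gradients, and the second gradient of the mass balance, each
contracted with its Lagrange multiplier. -/
noncomputable def extendedProduction (m : MaterialFunctions) (J : State → V) (μ : Multipliers)
    (w : Fields) (y : SpaceTime) : ℝ :=
  w.entropyProduction m J y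
    - μ.lam1 (w.state y) * w.massBalance y
    - dot (μ.lam2 (w.state y)) (w.momentumBalance m y)
    - μ.lam3 (w.state y) * w.energyBalance m y
    - dot (μ.Lam1 (w.state y)) (fun k => dx k w.massBalance y)
    - ddot (μ.Lam2 (w.state y)) (fun i k => dx k (fun y' => w.momentumBalance m y' i) y)
    - dot (μ.Lam3 (w.state y)) (fun k => dx k (w.energyBalance m) y)
    - ddot (μ.Theta1 (w.state y)) (fun i k => dx k (dx i w.massBalance) y)

/-- The extended (Liu) entropy principle over `D`: for some Lagrange multipliers depending on
the state variables only, the extended entropy inequality holds along arbitrary smooth fields,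
at every point at which `(ρ, ε) ∈ D`. -/
def ExtendedEntropyPrinciple (D : Set (ℝ × ℝ)) (m : MaterialFunctions) (J : State → V) : Prop :=
  ∃ μ : Multipliers, ∀ w : Fields, w.Smooth → ∀ y : SpaceTime, (w.rho y, w.eps y) ∈ D →
    0 ≤ extendedProduction m J μ w y

end Korteweg

/-! The fields in the entropy inequality are arbitrary, while the multipliers see only the spatial
state. Fix spatial fields with vanishing velocity at the origin and extend them affinely in time,
with the rates that solve the balance equations there: exactly for mass, to first order for momentum
and energy. Every term with a multiplier then vanishes at the origin, and `reduced_inequality`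
remains: entropy production computed with the time derivatives dictated by the balance laws. It is
affine in those spatial derivatives that are not state variables. Such derivatives can be prescribed
freely at a point, so their coefficients vanish (`eq_zero_of_forall_affine_nonneg`).

Fields of one coordinate suffice for the entropy. A fourth derivative of the density enters only
through the rate of `L`, with coefficient `s₄ (α₁ + α₄)`; a third derivative of the velocity then
isolates `s₅`. At `∇ρ = 0`, second derivatives of velocity and energy prescribe the derivatives of
the flux in `L` and in `∇ε`. These two prescriptions are compatible only if `s₃ (α₁ + α₄) = 0` and
`s₂ = 0` (`s2_s3_relation`). Factors `α₁ + α₄` are removed by density and continuity.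

With `s = s₀ + s₁ |∇ρ|²`, three-dimensional jets (`jet_inequality`) yield `FluxConditions`. The
derivative of `J` in `L` is completely known, but the coefficients of `∇∇ε` and `∇∇∇ρ` control only
the component of `J` along `ξ` as `∇ε` moves along `ξ`, or `∇∇ρ` along `ξ ⊗ ξ`. The undetermined
remainder is removed by isotropy together with the inequality that is left. If `∇ρ` is an
eigenvector of `∇∇ρ`, with `L = 0` and `∇ε = 0`, the flux component along that axis is affine in
each of the two transverse eigenvalues (`second_difference`). Comparing coefficients of the axial
eigenvalue gives Euler equations in `|∇ρ|`, whose only solution vanishing at zero is zero; this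
makes the flux independent of `∇∇ρ` there and then determines it (`axisFlux_eq`). The difference
between `J` at `L = 0` and its expected value satisfies `IsotropicNull`, and rotations, reflections
and an antisymmetry in `∇ε` force such functions to vanish (`IsotropicNull.eq_zero`).

Once `J` is explicit (`flux_eq`), the inequality left is a polynomial in `γ`, with `∇ρ = γ • axis
0`, and in the eigenvalues of diagonal `L` and `∇∇ρ`. The terms linear in `∇∇ρ` give `α₄`, `α₁` and
`∂s₁/∂ε = 0`, the terms linear in `L` at `γ = 0` give `p`, and the growth in `γ²` gives `α₂` and
`α₃`. Connectedness of the slices turns `∂s₁/∂ε = 0` into dependence on `ρ` alone. -/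

namespace Korteweg

/-! ### Spatial derivatives and fields affine in time. -/

/-- The partial derivative with respect to the `i`-th coordinate of a function of position. -/
noncomputable def pd (i : Fin 3) (f : V → ℝ) : V → ℝ :=
  fun x => fderiv ℝ f x (Pi.single i 1)

theorem ContDiff.pd {f : V → ℝ} (hf : ContDiff ℝ ∞ f) (i : Fin 3) : ContDiff ℝ ∞ (pd i f) :=
  (hf.fderiv_right (m := ∞) (by simp)).clm_apply contDiff_const

theorem ContDiffAt.pd {f : V → ℝ} {x : V} (hf : ContDiffAt ℝ ∞ f x) (i : Fin 3) :
    ContDiffAt ℝ ∞ (pd i f) x :=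
  (hf.fderiv_right (m := ∞) (by simp)).clm_apply contDiffAt_const

theorem ContDiff.dx {f : SpaceTime → ℝ} (hf : ContDiff ℝ ∞ f) (i : Fin 3) :
    ContDiff ℝ ∞ (dx i f) :=
  (hf.fderiv_right (m := ∞) (by simp)).clm_apply contDiff_const

theorem ContDiff.dt {f : SpaceTime → ℝ} (hf : ContDiff ℝ ∞ f) : ContDiff ℝ ∞ (dt f) :=
  (hf.fderiv_right (m := ∞) (by simp)).clm_apply contDiff_const

theorem ContDiffAt.dx {f : SpaceTime → ℝ} {y : SpaceTime} (hf : ContDiffAt ℝ ∞ f y)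
    (i : Fin 3) : ContDiffAt ℝ ∞ (dx i f) y :=
  (hf.fderiv_right (m := ∞) (by simp)).clm_apply contDiffAt_const

theorem differentiable_of_smooth {E F : Type*} [NormedAddCommGroup E] [NormedSpace ℝ E]
    [NormedAddCommGroup F] [NormedSpace ℝ F] {f : E → F} (hf : ContDiff ℝ ∞ f) :
    Differentiable ℝ f := hf.differentiable (by simp)

theorem differentiableAt_of_smooth {E F : Type*} [NormedAddCommGroup E] [NormedSpace ℝ E]
    [NormedAddCommGroup F] [NormedSpace ℝ F] {f : E → F} {x : E} (hf : ContDiffAt ℝ ∞ f x) :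
    DifferentiableAt ℝ f x := hf.differentiableAt (by simp)

/-- Chain rule along the inclusion of a time slice. It lets the gradients of a balance equation be
read off from its values on the slice `t = 0` alone. -/
theorem dx_eq_pd {f : SpaceTime → ℝ} {t : ℝ} {x : V} (hf : DifferentiableAt ℝ f (t, x))
    (k : Fin 3) : dx k f (t, x) = pd k (fun x' => f (t, x')) x := by
  have h1 : HasFDerivAt (fun x' : V => ((t, x') : SpaceTime))
      (ContinuousLinearMap.inr ℝ ℝ V) x := hasFDerivAt_prodMk_right t x
  have h2 := (hf.hasFDerivAt).comp x h1
  have h3 : fderiv ℝ (fun x' => f (t, x')) x = _ := h2.fderiv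
  simp [pd, dx, h3]

theorem pd_congr {f g : V → ℝ} {x : V} (h : f =ᶠ[nhds x] g) (k : Fin 3) :
    pd k f x = pd k g x := by
  simp [pd, h.fderiv_eq]

theorem pd_mul {f g : V → ℝ} {x : V} (hf : DifferentiableAt ℝ f x)
    (hg : DifferentiableAt ℝ g x) (k : Fin 3) :
    pd k (fun x => f x * g x) x = pd k f x * g x + f x * pd k g x := by
  simp [pd, fderiv_fun_mul hf hg]; ring

theorem pd_add {f g : V → ℝ} {x : V} (hf : DifferentiableAt ℝ f x)
    (hg : DifferentiableAt ℝ g x) (k : Fin 3) :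
    pd k (fun x => f x + g x) x = pd k f x + pd k g x := by
  simp [pd, fderiv_fun_add hf hg]

theorem pd_sub {f g : V → ℝ} {x : V} (hf : DifferentiableAt ℝ f x)
    (hg : DifferentiableAt ℝ g x) (k : Fin 3) :
    pd k (fun x => f x - g x) x = pd k f x - pd k g x := by
  simp [pd, fderiv_fun_sub hf hg]

theorem pd_const (c : ℝ) (k : Fin 3) (x : V) : pd k (fun _ => c) x = 0 := by
  simp [pd]

/-- The function `a(x) + t b(x)` of time and position. -/
def affineInTime (a b : V → ℝ) : SpaceTime → ℝ := fun y => a y.2 + y.1 * b y.2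

theorem contDiff_affineInTime {a b : V → ℝ} (ha : ContDiff ℝ ∞ a) (hb : ContDiff ℝ ∞ b) :
    ContDiff ℝ ∞ (affineInTime a b) :=
  (ha.comp contDiff_snd).add (contDiff_fst.mul (hb.comp contDiff_snd))

theorem hasFDerivAt_affineInTime {a b : V → ℝ} (ha : Differentiable ℝ a)
    (hb : Differentiable ℝ b) (y : SpaceTime) :
    HasFDerivAt (affineInTime a b)
      ((fderiv ℝ a y.2).comp (ContinuousLinearMap.snd ℝ ℝ V) +
        (y.1 • (fderiv ℝ b y.2).comp (ContinuousLinearMap.snd ℝ ℝ V)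
          + b y.2 • ContinuousLinearMap.fst ℝ ℝ V)) y := by
  have h1 := (ha y.2).hasFDerivAt.comp y (hasFDerivAt_snd (𝕜 := ℝ) (p := y))
  have h2 := (hb y.2).hasFDerivAt.comp y (hasFDerivAt_snd (𝕜 := ℝ) (p := y))
  exact h1.add ((hasFDerivAt_fst (𝕜 := ℝ) (p := y)).mul h2)

theorem dx_affineInTime {a b : V → ℝ} (ha : Differentiable ℝ a) (hb : Differentiable ℝ b)
    (i : Fin 3) : dx i (affineInTime a b) = affineInTime (pd i a) (pd i b) := by
  funext y
  simp [dx, (hasFDerivAt_affineInTime ha hb y).fderiv, affineInTime, pd]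

theorem dt_affineInTime {a b : V → ℝ} (ha : Differentiable ℝ a) (hb : Differentiable ℝ b) :
    dt (affineInTime a b) = fun y => b y.2 := by
  funext y
  simp [dt, (hasFDerivAt_affineInTime ha hb y).fderiv]

/-- The fields `(r + t R, u + t U, e + t F)`. -/
def affineFields (r e : V → ℝ) (u : Fin 3 → V → ℝ) (R F : V → ℝ) (U : Fin 3 → V → ℝ) :
    Fields where
  rho := affineInTime r R
  v := fun y i => affineInTime (u i) (U i) y
  eps := affineInTime e F

/-- The state variables of the fields `(r, u, e)` of position. -/
noncomputable def jetState (r e : V → ℝ) (u : Fin 3 → V → ℝ) (x : V) : State :=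
  (r x, e x, fun i => pd i r x, fun i j => (pd j (u i) x + pd i (u j) x) / 2,
    fun i => pd i e x, fun i j => pd j (pd i r) x)

theorem contDiff_jetState {r e : V → ℝ} {u : Fin 3 → V → ℝ} (hr : ContDiff ℝ ∞ r)
    (he : ContDiff ℝ ∞ e) (hu : ∀ i, ContDiff ℝ ∞ (u i)) :
    ContDiff ℝ ∞ (jetState r e u) := by
  refine hr.prodMk (he.prodMk (ContDiff.prodMk ?_ (ContDiff.prodMk ?_ (ContDiff.prodMk ?_ ?_))))
  · exact contDiff_pi.2 fun i => ContDiff.pd hr i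
  · exact contDiff_pi.2 fun i => contDiff_pi.2 fun j =>
      ((ContDiff.pd (hu i) j).add (ContDiff.pd (hu j) i)).div_const 2
  · exact contDiff_pi.2 fun i => ContDiff.pd he i
  · exact contDiff_pi.2 fun i => contDiff_pi.2 fun j => ContDiff.pd (ContDiff.pd hr i) j

theorem smooth_affineFields {r e R F : V → ℝ} {u U : Fin 3 → V → ℝ} (hr : ContDiff ℝ ∞ r)
    (he : ContDiff ℝ ∞ e) (hu : ∀ i, ContDiff ℝ ∞ (u i)) (hR : ContDiff ℝ ∞ R)
    (hF : ContDiff ℝ ∞ F) (hU : ∀ i, ContDiff ℝ ∞ (U i)) :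
    (affineFields r e u R F U).Smooth :=
  ⟨contDiff_affineInTime hr hR,
    contDiff_pi.2 fun i => contDiff_affineInTime (hu i) (hU i), contDiff_affineInTime he hF⟩

theorem gradV_affineFields {r e R F : V → ℝ} {u U : Fin 3 → V → ℝ}
    (hu : ∀ i, ContDiff ℝ ∞ (u i)) (hU : ∀ i, ContDiff ℝ ∞ (U i)) (y : SpaceTime)
    (i j : Fin 3) :
    (affineFields r e u R F U).gradV y i j = pd j (u i) y.2 + y.1 * pd j (U i) y.2 :=
  congrFun (dx_affineInTime (differentiable_of_smooth (hu i)) (differentiable_of_smooth (hU i)) j) y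

theorem state_affineFields {r e R F : V → ℝ} {u U : Fin 3 → V → ℝ} (hr : ContDiff ℝ ∞ r)
    (he : ContDiff ℝ ∞ e) (hu : ∀ i, ContDiff ℝ ∞ (u i)) (hR : ContDiff ℝ ∞ R)
    (hF : ContDiff ℝ ∞ F) (hU : ∀ i, ContDiff ℝ ∞ (U i)) (y : SpaceTime) :
    (affineFields r e u R F U).state y = jetState r e u y.2 + y.1 • jetState R F U y.2 := by
  have h1 : ∀ i, dx i (affineInTime r R) = _ := fun i =>
    dx_affineInTime (differentiable_of_smooth hr) (differentiable_of_smooth hR) i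
  have h2 : ∀ i, dx i (affineInTime e F) = _ := fun i =>
    dx_affineInTime (differentiable_of_smooth he) (differentiable_of_smooth hF) i
  have h3 : ∀ i j, dx j (affineInTime (pd i r) (pd i R)) = _ := fun i j =>
    dx_affineInTime (differentiable_of_smooth (ContDiff.pd hr i))
      (differentiable_of_smooth (ContDiff.pd hR i)) j
  unfold Fields.state
  simp only [gradV_affineFields hu hU]
  simp only [affineFields, h1, h2, h3]
  simp only [affineInTime, jetState, Prod.smul_mk, Prod.mk_add_mk, smul_eq_mul, Prod.mk.injEq,
    true_and]
  refine ⟨?_, ?_, ?_, ?_⟩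
  · funext i; simp
  · funext i j; simp; ring
  · funext i; simp
  · funext i j; simp

/-! ### Smoothness of the constitutive functions over `D`. -/

section Smoothness

variable {D : Set (ℝ × ℝ)}

theorem contDiff_rho : ContDiff ℝ ∞ State.rho := contDiff_fst

theorem contDiff_eps : ContDiff ℝ ∞ State.eps := contDiff_fst.comp contDiff_snd

theorem contDiff_gradRho : ContDiff ℝ ∞ State.gradRho :=
  contDiff_fst.comp (contDiff_snd.comp contDiff_snd)

theorem contDiff_L : ContDiff ℝ ∞ State.L :=
  contDiff_fst.comp (contDiff_snd.comp (contDiff_snd.comp contDiff_snd))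

theorem contDiff_gradEps : ContDiff ℝ ∞ State.gradEps :=
  contDiff_fst.comp (contDiff_snd.comp (contDiff_snd.comp (contDiff_snd.comp contDiff_snd)))

theorem contDiff_hessRho : ContDiff ℝ ∞ State.hessRho :=
  contDiff_snd.comp (contDiff_snd.comp (contDiff_snd.comp (contDiff_snd.comp contDiff_snd)))

theorem contDiff_gradRho_apply (i : Fin 3) : ContDiff ℝ ∞ fun z : State => z.gradRho i :=
  contDiff_pi.1 contDiff_gradRho i

theorem contDiff_gradEps_apply (i : Fin 3) : ContDiff ℝ ∞ fun z : State => z.gradEps i :=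
  contDiff_pi.1 contDiff_gradEps i

theorem contDiff_L_apply (i j : Fin 3) : ContDiff ℝ ∞ fun z : State => z.L i j :=
  contDiff_pi.1 (contDiff_pi.1 contDiff_L i) j

theorem contDiff_hessRho_apply (i j : Fin 3) : ContDiff ℝ ∞ fun z : State => z.hessRho i j :=
  contDiff_pi.1 (contDiff_pi.1 contDiff_hessRho i) j

theorem isOpen_region (hD : IsOpen D) : IsOpen (State.region D) :=
  hD.preimage ((contDiff_rho.continuous).prodMk contDiff_eps.continuous)

theorem Smooth2.contDiffAt (hD : IsOpen D) {f : ℝ → ℝ → ℝ} (hf : Smooth2 D f) {z : ℝ × ℝ}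
    (hz : z ∈ D) : ContDiffAt ℝ ∞ (fun z : ℝ × ℝ => f z.1 z.2) z :=
  ContDiffOn.contDiffAt hf (hD.mem_nhds hz)

theorem Smooth2.contDiffAt_state (hD : IsOpen D) {f : ℝ → ℝ → ℝ} (hf : Smooth2 D f) {z : State}
    (hz : z ∈ State.region D) : ContDiffAt ℝ ∞ (fun z : State => f z.rho z.eps) z :=
  ContDiffAt.comp (g := fun z : ℝ × ℝ => f z.1 z.2) (f := fun z : State => (z.rho, z.eps)) z
    (hf.contDiffAt hD hz) (contDiff_rho.contDiffAt.prodMk contDiff_eps.contDiffAt)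

theorem contDiff_dot_comp {E : Type*} [NormedAddCommGroup E] [NormedSpace ℝ E] {a b : E → V}
    (ha : ∀ i, ContDiff ℝ ∞ fun x => a x i) (hb : ∀ i, ContDiff ℝ ∞ fun x => b x i) :
    ContDiff ℝ ∞ fun x => dot (a x) (b x) :=
  ContDiff.sum fun i _ => (ha i).mul (hb i)

theorem contDiff_tr_comp {E : Type*} [NormedAddCommGroup E] [NormedSpace ℝ E] {A : E → T2}
    (hA : ∀ i j, ContDiff ℝ ∞ fun x => A x i j) : ContDiff ℝ ∞ fun x => tr (A x) :=
  ContDiff.sum fun i _ => hA i i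

theorem contDiffAt_stress (hD : IsOpen D) {m : MaterialFunctions} (hm : m.SmoothOn D) {z : State}
    (hz : z ∈ State.region D) (i j : Fin 3) : ContDiffAt ℝ ∞ (fun z => m.stress z i j) z := by
  unfold MaterialFunctions.stress
  have hg := contDiff_gradRho_apply
  have hH := contDiff_hessRho_apply
  have hL := contDiff_L_apply
  exact ((((((((hm.p.contDiffAt_state hD hz).neg.add
    ((hm.α1.contDiffAt_state hD hz).mul (contDiff_tr_comp hH).contDiffAt)).add
    ((hm.α2.contDiffAt_state hD hz).mul (contDiff_dot_comp hg hg).contDiffAt)).mul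
      contDiffAt_const).add
    ((hm.α3.contDiffAt_state hD hz).mul ((hg i).mul (hg j)).contDiffAt)).add
    ((hm.α4.contDiffAt_state hD hz).mul (hH i j).contDiffAt)).add
    (((hm.α5.contDiffAt_state hD hz).mul (contDiff_tr_comp hL).contDiffAt).mul
      contDiffAt_const)).add
    ((hm.α6.contDiffAt_state hD hz).mul (hL i j).contDiffAt))

theorem contDiffAt_heatFlux (hD : IsOpen D) {m : MaterialFunctions} (hm : m.SmoothOn D)
    {z : State} (hz : z ∈ State.region D) (i : Fin 3) :
    ContDiffAt ℝ ∞ (fun z => m.heatFlux z i) z := by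
  unfold MaterialFunctions.heatFlux
  exact ((hm.q1.contDiffAt_state hD hz).mul (contDiff_gradEps_apply i).contDiffAt).add
    ((hm.q2.contDiffAt_state hD hz).mul (contDiff_gradRho_apply i).contDiffAt)

theorem contDiffAt_entropy (hD : IsOpen D) {m : MaterialFunctions} (hm : m.SmoothOn D)
    {z : State} (hz : z ∈ State.region D) : ContDiffAt ℝ ∞ m.entropy z := by
  unfold MaterialFunctions.entropy
  have hg := contDiff_gradRho_apply
  have he := contDiff_gradEps_apply
  have hH := contDiff_hessRho_apply
  have hL := contDiff_L_apply
  exact (((((hm.s0.contDiffAt_state hD hz).add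
    ((hm.s1.contDiffAt_state hD hz).mul (contDiff_dot_comp hg hg).contDiffAt)).add
    ((hm.s2.contDiffAt_state hD hz).mul (contDiff_dot_comp hg he).contDiffAt)).add
    ((hm.s3.contDiffAt_state hD hz).mul (contDiff_dot_comp he he).contDiffAt)).add
    ((hm.s4.contDiffAt_state hD hz).mul (contDiff_tr_comp hL).contDiffAt)).add
    ((hm.s5.contDiffAt_state hD hz).mul (contDiff_tr_comp hH).contDiffAt)

end Smoothness

/-! ### Elimination of the multipliers. -/

/-- The rate `-∇·(r u)` of the density at which the balance of mass is satisfied. -/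
noncomputable def densityRate (r : V → ℝ) (u : Fin 3 → V → ℝ) (x : V) : ℝ :=
  -∑ j, pd j (fun x' => r x' * u j x') x

/-- The rate of the velocity at which the balance of momentum is satisfied. -/
noncomputable def velocityRate (m : MaterialFunctions) (r e : V → ℝ) (u : Fin 3 → V → ℝ)
    (i : Fin 3) (x : V) : ℝ :=
  (∑ j, pd j (fun x' => m.stress (jetState r e u x') i j) x) / r x
    - ∑ j, u j x * pd j (u i) x

/-- The rate of the energy at which the balance of energy is satisfied. -/
noncomputable def energyRate (m : MaterialFunctions) (r e : V → ℝ) (u : Fin 3 → V → ℝ)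
    (x : V) : ℝ :=
  (ddot (m.stress (jetState r e u x)) (fun i j => pd j (u i) x)
      - ∑ j, pd j (fun x' => m.heatFlux (jetState r e u x') j) x) / r x
    - ∑ j, u j x * pd j e x

/-- The rate of the state variables at the origin determined by the balance equations. -/
noncomputable def stateRate (m : MaterialFunctions) (r e : V → ℝ) (u : Fin 3 → V → ℝ) : State :=
  (densityRate r u 0, energyRate m r e u 0, fun i => pd i (densityRate r u) 0,
    fun i j => (pd j (velocityRate m r e u i) 0 + pd i (velocityRate m r e u j) 0) / 2,
    fun i => pd i (energyRate m r e u) 0, fun i j => pd j (pd i (densityRate r u)) 0)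

/-- The affine function with the same first order jet at the origin. -/
noncomputable def tangentAt (f : V → ℝ) (x : V) : ℝ := f 0 + fderiv ℝ f 0 x

theorem contDiff_tangentAt (f : V → ℝ) : ContDiff ℝ ∞ (tangentAt f) :=
  contDiff_const.add (fderiv ℝ f 0).contDiff

theorem tangentAt_zero (f : V → ℝ) : tangentAt f 0 = f 0 := by simp [tangentAt]

theorem pd_tangentAt (f : V → ℝ) (k : Fin 3) (x : V) : pd k (tangentAt f) x = pd k f 0 := by
  unfold pd tangentAt
  rw [fderiv_const_add, ContinuousLinearMap.fderiv]

theorem contDiff_densityRate {r : V → ℝ} {u : Fin 3 → V → ℝ} (hr : ContDiff ℝ ∞ r)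
    (hu : ∀ i, ContDiff ℝ ∞ (u i)) : ContDiff ℝ ∞ (densityRate r u) :=
  (ContDiff.sum fun j _ => ContDiff.pd (hr.mul (hu j)) j).neg

section Reduction

variable {D : Set (ℝ × ℝ)} {m : MaterialFunctions} {r e : V → ℝ} {u : Fin 3 → V → ℝ}

theorem contDiffAt_stress_jetState (hD : IsOpen D) (hm : m.SmoothOn D) (hr : ContDiff ℝ ∞ r)
    (he : ContDiff ℝ ∞ e) (hu : ∀ i, ContDiff ℝ ∞ (u i)) {x : V} (hx : (r x, e x) ∈ D)
    (i j : Fin 3) : ContDiffAt ℝ ∞ (fun x => m.stress (jetState r e u x) i j) x :=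
  ContDiffAt.comp (g := fun z => m.stress z i j) x
    (contDiffAt_stress (z := jetState r e u x) hD hm hx i j)
    (contDiff_jetState hr he hu).contDiffAt

theorem contDiffAt_heatFlux_jetState (hD : IsOpen D) (hm : m.SmoothOn D) (hr : ContDiff ℝ ∞ r)
    (he : ContDiff ℝ ∞ e) (hu : ∀ i, ContDiff ℝ ∞ (u i)) {x : V} (hx : (r x, e x) ∈ D)
    (j : Fin 3) : ContDiffAt ℝ ∞ (fun x => m.heatFlux (jetState r e u x) j) x :=
  ContDiffAt.comp (g := fun z => m.heatFlux z j) x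
    (contDiffAt_heatFlux (z := jetState r e u x) hD hm hx j)
    (contDiff_jetState hr he hu).contDiffAt

theorem contDiffAt_velocityRate (hD : IsOpen D) (hm : m.SmoothOn D) (hr : ContDiff ℝ ∞ r)
    (he : ContDiff ℝ ∞ e) (hu : ∀ i, ContDiff ℝ ∞ (u i)) {x : V} (hx : (r x, e x) ∈ D)
    (hrx : r x ≠ 0) (i : Fin 3) : ContDiffAt ℝ ∞ (velocityRate m r e u i) x :=
  ((ContDiffAt.sum fun j _ => ContDiffAt.pd
    (contDiffAt_stress_jetState hD hm hr he hu hx i j) j).div hr.contDiffAt hrx).sub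
    (ContDiff.sum fun j _ => (hu j).mul (ContDiff.pd (hu i) j)).contDiffAt

theorem contDiffAt_energyRate (hD : IsOpen D) (hm : m.SmoothOn D) (hr : ContDiff ℝ ∞ r)
    (he : ContDiff ℝ ∞ e) (hu : ∀ i, ContDiff ℝ ∞ (u i)) {x : V} (hx : (r x, e x) ∈ D)
    (hrx : r x ≠ 0) : ContDiffAt ℝ ∞ (energyRate m r e u) x :=
  (((ContDiffAt.sum fun i _ => ContDiffAt.sum fun j _ =>
      (contDiffAt_stress_jetState hD hm hr he hu hx i j).mul
        (ContDiff.pd (hu i) j).contDiffAt).sub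
    (ContDiffAt.sum fun j _ => ContDiffAt.pd
      (contDiffAt_heatFlux_jetState hD hm hr he hu hx j) j)).div hr.contDiffAt hrx).sub
    (ContDiff.sum fun j _ => (hu j).mul (ContDiff.pd he j)).contDiffAt

/-- Along fields whose time derivatives satisfy the balance equations to first order, the
extended entropy inequality contains no multipliers. -/
theorem reduced_inequality (hD : IsOpen D) (hDpos : ∀ z ∈ D, 0 < z.1) (hm : m.SmoothOn D)
    {J : State → V} (hJ : ContDiffOn ℝ ∞ J (State.region D))
    (hent : ExtendedEntropyPrinciple D m J) (hr : ContDiff ℝ ∞ r)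
    (he : ContDiff ℝ ∞ e) (hu : ∀ i, ContDiff ℝ ∞ (u i)) (hu0 : ∀ i, u i 0 = 0)
    (h0 : (r 0, e 0) ∈ D) :
    0 ≤ r 0 * deriv (fun t : ℝ => m.entropy (jetState r e u 0 + t • stateRate m r e u)) 0
      + ∑ j, pd j (fun x => J (jetState r e u x) j) 0 := by
  obtain ⟨μ, hμ⟩ := hent
  -- Two gradients of the mass balance must vanish, so the density gets its exact rate, which is
  -- smooth everywhere. The other rates are smooth only where `(r, e) ∈ D`, hence not admissible as
  -- global fields; their first order Taylor polynomials are, and momentum and energy need no more.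
  set R := densityRate r u with hRdef
  set F := tangentAt (energyRate m r e u) with hFdef
  set U := fun i => tangentAt (velocityRate m r e u i) with hUdef
  have hR : ContDiff ℝ ∞ R := contDiff_densityRate hr hu
  have hF : ContDiff ℝ ∞ F := contDiff_tangentAt _
  have hU : ∀ i, ContDiff ℝ ∞ (U i) := fun i => contDiff_tangentAt _
  set w := affineFields r e u R F U with hw
  have hws : w.Smooth := smooth_affineFields hr he hu hR hF hU
  have hst : ∀ y, w.state y = jetState r e u y.2 + y.1 • jetState R F U y.2 :=
    state_affineFields hr he hu hR hF hU
  have hst0 : ∀ x, w.state (0, x) = jetState r e u x := fun x => by simp [hst]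
  have hstC : ContDiff ℝ ∞ w.state := by
    have h1 : w.state = _ := funext hst
    rw [h1]
    exact ((contDiff_jetState hr he hu).comp contDiff_snd).add
      (contDiff_fst.smul ((contDiff_jetState hR hF hU).comp contDiff_snd))
  have hopen : ∀ᶠ x in nhds (0 : V), (r x, e x) ∈ D :=
    (hr.continuous.prodMk he.continuous).continuousAt.preimage_mem_nhds (hD.mem_nhds h0)
  have hreg : ∀ x, (r x, e x) ∈ D → w.state (0, x) ∈ State.region D := fun x hx => by
    rw [hst0]; exact hx
  have hr0 : r 0 ≠ 0 := (hDpos _ h0).ne'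
  have hwrho : ContDiff ℝ ∞ w.rho := hws.rho
  have hwv : ∀ i, ContDiff ℝ ∞ fun y => w.v y i := contDiff_pi.1 hws.v
  have hwe : ContDiff ℝ ∞ w.eps := hws.eps
  -- balance of mass
  have hmassC : ContDiff ℝ ∞ w.massBalance :=
    (ContDiff.dt hwrho).add (ContDiff.sum fun j _ => ContDiff.dx (hwrho.mul (hwv j)) j)
  have hmass0 : ∀ x, w.massBalance (0, x) = 0 := by
    intro x
    unfold Fields.massBalance
    have h1 : dt w.rho (0, x) = R x :=
      congrFun (dt_affineInTime (differentiable_of_smooth hr) (differentiable_of_smooth hR)) (0, x)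
    have h2 : ∀ j, dx j (fun y' => w.rho y' * w.v y' j) (0, x)
        = pd j (fun x' => r x' * u j x') x := by
      intro j
      rw [dx_eq_pd (differentiable_of_smooth (hwrho.mul (hwv j)) _)]
      simp [hw, affineFields, affineInTime]
    simp only [h1, h2, hRdef, densityRate]; ring
  have hmass1 : ∀ k x, dx k w.massBalance (0, x) = 0 := by
    intro k x
    rw [dx_eq_pd (differentiable_of_smooth hmassC _)]
    simp only [hmass0, pd_const]
  have hmass2 : ∀ i k, dx k (dx i w.massBalance) (0, 0) = 0 := by
    intro i k
    rw [dx_eq_pd (differentiable_of_smooth (ContDiff.dx hmassC i) _)]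
    simp only [hmass1, pd_const]
  -- balance of momentum
  have hstressC : ∀ x, (r x, e x) ∈ D → ∀ i j,
      ContDiffAt ℝ ∞ (fun y => m.stress (w.state y) i j) (0, x) := fun x hx i j =>
    ContDiffAt.comp (g := fun z => m.stress z i j) (0, x)
      (contDiffAt_stress hD hm (hreg x hx) i j) hstC.contDiffAt
  have hstress1 : ∀ x, (r x, e x) ∈ D → ∀ i j, dx j (fun y => m.stress (w.state y) i j) (0, x)
      = pd j (fun x => m.stress (jetState r e u x) i j) x := by
    intro x hx i j
    rw [dx_eq_pd (differentiableAt_of_smooth (hstressC x hx i j))]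
    simp only [hst0]
  have hdtv : ∀ i x, dt (fun y' => w.v y' i) (0, x) = U i x := fun i x =>
    congrFun (dt_affineInTime (differentiable_of_smooth (hu i)) (differentiable_of_smooth (hU i)))
      (0, x)
  have hdxv : ∀ i j x, dx j (fun y' => w.v y' i) (0, x) = pd j (u i) x := by
    intro i j x
    have := congrFun (dx_affineInTime (differentiable_of_smooth (hu i))
      (differentiable_of_smooth (hU i)) j) (0, x)
    exact this.trans (by simp [affineInTime])
  have hv0 : ∀ i x, w.v (0, x) i = u i x := fun i x => by
    simp [hw, affineFields, affineInTime]
  have hrho0 : ∀ x, w.rho (0, x) = r x := fun x => by simp [hw, affineFields, affineInTime]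
  have heps0 : ∀ x, w.eps (0, x) = e x := fun x => by simp [hw, affineFields, affineInTime]
  have hmomC : ∀ i, ContDiffAt ℝ ∞ (fun y => w.momentumBalance m y i) (0, 0) := by
    intro i
    unfold Fields.momentumBalance Fields.materialDeriv
    exact (hwrho.contDiffAt.mul ((ContDiff.dt (hwv i)).contDiffAt.add
      (ContDiffAt.sum fun j _ => (hwv j).contDiffAt.mul
        (ContDiff.dx (hwv i) j).contDiffAt))).sub
      (ContDiffAt.sum fun j _ => ContDiffAt.dx (hstressC 0 h0 i j) j)
  -- On the slice `t = 0` the residual is the density times the error of the Taylor polynomial, so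
  -- its value and gradient vanish at the origin.
  have hmom : ∀ i, ∀ᶠ x in nhds (0 : V),
      w.momentumBalance m (0, x) i = r x * (U i x - velocityRate m r e u i x) := by
    intro i
    filter_upwards [hopen] with x hx
    have hrx : r x ≠ 0 := (hDpos _ hx).ne'
    unfold Fields.momentumBalance Fields.materialDeriv velocityRate
    simp only [hrho0, hdtv, hv0, hdxv, hstress1 x hx]
    field_simp
    ring
  have hmom0 : ∀ i, w.momentumBalance m (0, 0) i = 0 := by
    intro i
    rw [(hmom i).self_of_nhds]
    simp [hUdef, tangentAt_zero]
  have hmom1 : ∀ i k, dx k (fun y => w.momentumBalance m y i) (0, 0) = 0 := by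
    intro i k
    rw [dx_eq_pd (differentiableAt_of_smooth (hmomC i)), pd_congr (hmom i)]
    have hd := differentiableAt_of_smooth (contDiffAt_velocityRate hD hm hr he hu h0 hr0 i)
    have hUd := differentiable_of_smooth (hU i) 0
    rw [pd_mul (g := fun x => U i x - velocityRate m r e u i x) (differentiable_of_smooth hr _)
      (hUd.sub hd), pd_sub hUd hd]
    simp [hUdef, tangentAt_zero, pd_tangentAt]
  -- balance of energy
  have hheatC : ∀ x, (r x, e x) ∈ D → ∀ j,
      ContDiffAt ℝ ∞ (fun y => m.heatFlux (w.state y) j) (0, x) := fun x hx j =>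
    ContDiffAt.comp (g := fun z => m.heatFlux z j) (0, x)
      (contDiffAt_heatFlux hD hm (hreg x hx) j) hstC.contDiffAt
  have hheat1 : ∀ x, (r x, e x) ∈ D → ∀ j, dx j (fun y => m.heatFlux (w.state y) j) (0, x)
      = pd j (fun x => m.heatFlux (jetState r e u x) j) x := by
    intro x hx j
    rw [dx_eq_pd (differentiableAt_of_smooth (hheatC x hx j))]
    simp only [hst0]
  have hdte : ∀ x, dt w.eps (0, x) = F x := fun x =>
    congrFun (dt_affineInTime (differentiable_of_smooth he) (differentiable_of_smooth hF)) (0, x)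
  have hdxe : ∀ j x, dx j w.eps (0, x) = pd j e x := by
    intro j x
    have := congrFun (dx_affineInTime (differentiable_of_smooth he)
      (differentiable_of_smooth hF) j) (0, x)
    exact this.trans (by simp [affineInTime])
  have henC : ContDiffAt ℝ ∞ (w.energyBalance m) (0, 0) := by
    unfold Fields.energyBalance Fields.materialDeriv Fields.gradV
    exact ((hwrho.contDiffAt.mul ((ContDiff.dt hwe).contDiffAt.add
      (ContDiffAt.sum fun j _ => (hwv j).contDiffAt.mul
        (ContDiff.dx hwe j).contDiffAt))).sub
      (ContDiffAt.sum fun i _ => ContDiffAt.sum fun j _ => (hstressC 0 h0 i j).mul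
        (ContDiff.dx (hwv i) j).contDiffAt)).add
      (ContDiffAt.sum fun j _ => ContDiffAt.dx (hheatC 0 h0 j) j)
  have hen : ∀ᶠ x in nhds (0 : V),
      w.energyBalance m (0, x) = r x * (F x - energyRate m r e u x) := by
    filter_upwards [hopen] with x hx
    have hrx : r x ≠ 0 := (hDpos _ hx).ne'
    have hgv : w.gradV (0, x) = fun i j => pd j (u i) x := by
      funext i j; exact hdxv i j x
    unfold Fields.energyBalance Fields.materialDeriv energyRate
    simp only [hrho0, hdte, hv0, hdxe, hheat1 x hx, hst0, hgv]
    field_simp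
    ring
  have hen0 : w.energyBalance m (0, 0) = 0 := by
    rw [hen.self_of_nhds]
    simp [hFdef, tangentAt_zero]
  have hen1 : ∀ k, dx k (w.energyBalance m) (0, 0) = 0 := by
    intro k
    rw [dx_eq_pd (differentiableAt_of_smooth henC), pd_congr hen]
    have hd := differentiableAt_of_smooth (contDiffAt_energyRate hD hm hr he hu h0 hr0)
    have hFd := differentiable_of_smooth hF 0
    rw [pd_mul (g := fun x => F x - energyRate m r e u x) (differentiable_of_smooth hr _)
      (hFd.sub hd), pd_sub hFd hd]
    simp [hFdef, tangentAt_zero, pd_tangentAt]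
  -- conclusion
  have hmain := hμ w hws (0, 0) (by rw [hrho0, heps0]; exact h0)
  unfold extendedProduction at hmain
  have hmomz : w.momentumBalance m (0, 0) = fun _ => 0 := funext hmom0
  simp only [hmass0, hmass1, hmass2, hmom1, hen0, hen1, hmomz, dot, ddot, mul_zero,
    Finset.sum_const_zero, sub_zero] at hmain
  -- All multipliers are gone. The velocity vanishes at the origin, so the material derivative of
  -- the entropy is its time derivative.
  unfold Fields.entropyProduction Fields.materialDeriv at hmain
  simp only [hv0, hu0, hrho0, zero_mul, Finset.sum_const_zero, add_zero] at hmain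
  have hJd : DifferentiableAt ℝ J (w.state (0, 0)) :=
    differentiableAt_of_smooth (hJ.contDiffAt ((isOpen_region hD).mem_nhds (hreg 0 h0)))
  have hJ1 : ∀ j, dx j (fun y' => J (w.state y') j) (0, 0)
      = pd j (fun x => J (jetState r e u x) j) 0 := by
    intro j
    have hJw : DifferentiableAt ℝ (fun y => J (w.state y)) (0, 0) :=
      hJd.comp _ (differentiable_of_smooth hstC _)
    rw [dx_eq_pd (differentiableAt_pi.1 hJw j)]
    simp only [hst0]
  have hS : dt (fun y' => m.entropy (w.state y')) (0, 0)
      = deriv (fun t : ℝ => m.entropy (jetState r e u 0 + t • stateRate m r e u)) 0 := by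
    have hrate : stateRate m r e u = jetState R F U 0 := by
      unfold stateRate jetState
      simp only [hFdef, hUdef, tangentAt_zero, pd_tangentAt]
      rfl
    have hd : DifferentiableAt ℝ (fun y => m.entropy (w.state y)) (0, 0) :=
      (differentiableAt_of_smooth (contDiffAt_entropy hD hm (hreg 0 h0))).comp _
        (differentiable_of_smooth hstC _)
    have h1 : HasDerivAt (fun t : ℝ => ((t, 0) : SpaceTime)) (1, 0) 0 :=
      (hasDerivAt_id (0 : ℝ)).prodMk (hasDerivAt_const (0 : ℝ) (0 : V))
    have h2 := hd.hasFDerivAt.comp_hasDerivAt (0 : ℝ) h1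
    have h3 : (fun t : ℝ => m.entropy (jetState r e u 0 + t • stateRate m r e u))
        = (fun y => m.entropy (w.state y)) ∘ fun t : ℝ => ((t, 0) : SpaceTime) := by
      funext t
      simp [hst, hrate]
    rw [h3, h2.deriv]
    rfl
  rw [hS] at hmain
  simpa only [hJ1] using hmain

end Reduction

/-! ### Partial derivatives of the material functions. -/

section PartialDerivatives

variable {D : Set (ℝ × ℝ)} {f : ℝ → ℝ → ℝ}

/-- `dRho` and `dEps` are one-variable derivatives; joint differentiability makes them the
components of the Fréchet derivative. All chain rules for material functions rest on this. -/
theorem Smooth2.hasFDerivAt (hD : IsOpen D) (hf : Smooth2 D f) {ρ ε : ℝ} (h : (ρ, ε) ∈ D) :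
    HasFDerivAt (fun z : ℝ × ℝ => f z.1 z.2)
      (dRho f ρ ε • ContinuousLinearMap.fst ℝ ℝ ℝ + dEps f ρ ε • ContinuousLinearMap.snd ℝ ℝ ℝ)
      (ρ, ε) := by
  have h1 := (differentiableAt_of_smooth (hf.contDiffAt hD h)).hasFDerivAt
  have hr : dRho f ρ ε = fderiv ℝ (fun z : ℝ × ℝ => f z.1 z.2) (ρ, ε) (1, 0) :=
    (h1.comp_hasDerivAt (f := fun r : ℝ => ((r, ε) : ℝ × ℝ)) ρ
      ((hasDerivAt_id ρ).prodMk (hasDerivAt_const ρ ε))).deriv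
  have he : dEps f ρ ε = fderiv ℝ (fun z : ℝ × ℝ => f z.1 z.2) (ρ, ε) (0, 1) :=
    (h1.comp_hasDerivAt (f := fun e : ℝ => ((ρ, e) : ℝ × ℝ)) ε
      ((hasDerivAt_const ε ρ).prodMk (hasDerivAt_id ε))).deriv
  refine h1.congr_fderiv ?_
  ext <;> simp [hr, he]

theorem Smooth2.hasDerivAt (hD : IsOpen D) (hf : Smooth2 D f) {a b : ℝ → ℝ} {a' b' t : ℝ}
    (ha : HasDerivAt a a' t) (hb : HasDerivAt b b' t) (h : (a t, b t) ∈ D) :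
    HasDerivAt (fun s => f (a s) (b s))
      (dRho f (a t) (b t) * a' + dEps f (a t) (b t) * b') t := by
  have h1 := (hf.hasFDerivAt hD h).comp_hasDerivAt (f := fun s => (a s, b s)) t (ha.prodMk hb)
  exact h1.congr_deriv (by simp)

theorem Smooth2.dRho (hD : IsOpen D) (hf : Smooth2 D f) : Smooth2 D (dRho f) := by
  intro z hz
  have h1 : ContDiffAt ℝ ∞ (fun z => fderiv ℝ (fun z : ℝ × ℝ => f z.1 z.2) z (1, 0)) z :=
    ((hf.contDiffAt hD hz).fderiv_right (m := ∞) (by simp)).clm_apply contDiffAt_const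
  refine (h1.congr_of_eventuallyEq ?_).contDiffWithinAt
  filter_upwards [hD.mem_nhds hz] with y hy
  rw [(hf.hasFDerivAt (ρ := y.1) (ε := y.2) hD hy).fderiv]
  simp

theorem Smooth2.dEps (hD : IsOpen D) (hf : Smooth2 D f) : Smooth2 D (dEps f) := by
  intro z hz
  have h1 : ContDiffAt ℝ ∞ (fun z => fderiv ℝ (fun z : ℝ × ℝ => f z.1 z.2) z (0, 1)) z :=
    ((hf.contDiffAt hD hz).fderiv_right (m := ∞) (by simp)).clm_apply contDiffAt_const
  refine (h1.congr_of_eventuallyEq ?_).contDiffWithinAt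
  filter_upwards [hD.mem_nhds hz] with y hy
  rw [(hf.hasFDerivAt (ρ := y.1) (ε := y.2) hD hy).fderiv]
  simp

end PartialDerivatives

/-! ### The reduced inequality for fields of one coordinate. -/

/-- The state of fields that depend on the first coordinate only. -/
def lineState (ρ ε g l e h : ℝ) : State :=
  (ρ, ε, fun i => g * delta i 0, fun i j => l * (delta i 0 * delta j 0),
    fun i => e * delta i 0, fun i j => h * (delta i 0 * delta j 0))

theorem lineState_add_smul (ρ ε g l e h ρ' ε' g' l' e' h' t : ℝ) :
    lineState ρ ε g l e h + t • lineState ρ' ε' g' l' e' h'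
      = lineState (ρ + t * ρ') (ε + t * ε') (g + t * g') (l + t * l') (e + t * e')
        (h + t * h') := by
  simp only [lineState, Prod.smul_mk, Prod.mk_add_mk, smul_eq_mul, Prod.mk.injEq, true_and]
  refine ⟨?_, ?_, ?_, ?_⟩ <;> funext i <;> (try funext j) <;> simp <;> ring

/-- The divergence differentiates along the first axis only, so one column of the stress is enough;
in it `α₁` and `α₄` occur through their sum, as do `α₂` with `α₃` and `α₅` with `α₆`. -/
theorem stress_lineState (m : MaterialFunctions) (ρ ε g l e h : ℝ) (i : Fin 3) :
    m.stress (lineState ρ ε g l e h) i 0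
      = (-m.p ρ ε + (m.α1 ρ ε + m.α4 ρ ε) * h + (m.α2 ρ ε + m.α3 ρ ε) * g ^ 2
        + (m.α5 ρ ε + m.α6 ρ ε) * l) * delta i 0 := by
  fin_cases i <;>
  simp [MaterialFunctions.stress, lineState, State.rho, State.eps, State.gradRho, State.L,
    State.hessRho, tr, dot, delta]
  ring

theorem heatFlux_lineState (m : MaterialFunctions) (ρ ε g l e h : ℝ) (i : Fin 3) :
    m.heatFlux (lineState ρ ε g l e h) i = (m.q1 ρ ε * e + m.q2 ρ ε * g) * delta i 0 := by
  simp [MaterialFunctions.heatFlux, lineState, State.rho, State.eps, State.gradRho,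
    State.gradEps]
  ring

theorem entropy_lineState (m : MaterialFunctions) (ρ ε g l e h : ℝ) :
    m.entropy (lineState ρ ε g l e h) = m.s0 ρ ε + m.s1 ρ ε * g ^ 2 + m.s2 ρ ε * (g * e)
      + m.s3 ρ ε * e ^ 2 + m.s4 ρ ε * l + m.s5 ρ ε * h := by
  simp [MaterialFunctions.entropy, lineState, State.rho, State.eps, State.gradRho, State.L,
    State.gradEps, State.hessRho, tr, dot, delta]
  ring

/-- No differentiability is required: restriction to the line through `x` along the first axis
recovers `f`, so if `f` is not differentiable neither is the composite, and both sides are the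
default value zero. -/
theorem pd_line (f : ℝ → ℝ) (i : Fin 3) (x : V) :
    pd i (fun x => f (x 0)) x = deriv f (x 0) * delta i 0 := by
  have hp : HasFDerivAt (fun x : V => x 0)
      (ContinuousLinearMap.proj (R := ℝ) (φ := fun _ : Fin 3 => ℝ) 0) x :=
    (ContinuousLinearMap.proj (R := ℝ) (φ := fun _ : Fin 3 => ℝ) 0).hasFDerivAt
  by_cases hf : DifferentiableAt ℝ f (x 0)
  · have h1 := (HasDerivAt.comp_hasFDerivAt (h₂ := f) x hf.hasDerivAt hp)
    have h2 : fderiv ℝ (fun x : V => f (x 0)) x = _ := h1.fderiv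
    simp [pd, h2, delta, Pi.single_apply, eq_comm]
  · have h1 : ¬ DifferentiableAt ℝ (fun x : V => f (x 0)) x := by
      intro h
      apply hf
      have h2 : HasDerivAt (fun s : ℝ => x + (s - x 0) • (Pi.single 0 1 : V))
          (Pi.single 0 1) (x 0) := by
        have := (((hasDerivAt_id (x 0)).sub_const (x 0)).smul_const
          (Pi.single 0 1 : V)).const_add x
        simpa using this
      have h3 : DifferentiableAt ℝ (fun x : V => f (x 0))
          ((fun s : ℝ => x + (s - x 0) • (Pi.single 0 1 : V)) (x 0)) := by simpa using h
      have h4 := h3.comp (x 0) h2.differentiableAt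
      have h5 : (fun x : V => f (x 0)) ∘ (fun s : ℝ => x + (s - x 0) • (Pi.single 0 1 : V)) = f := by
        funext s
        simp
      rwa [h5] at h4
    simp [pd, fderiv_zero_of_not_differentiableAt h1, deriv_zero_of_not_differentiableAt hf]

section Line

variable {D : Set (ℝ × ℝ)} {m : MaterialFunctions} {a b u : ℝ → ℝ}

/-- The states of the fields `(a, u, b)` of one coordinate. -/
noncomputable def lineJet (a b u : ℝ → ℝ) (s : ℝ) : State :=
  lineState (a s) (b s) (deriv a s) (deriv u s) (deriv b s) (deriv (deriv a) s)

/-- The normal stress along the fields `(a, u, b)` of one coordinate. -/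
noncomputable def lineStress (m : MaterialFunctions) (a b u : ℝ → ℝ) (s : ℝ) : ℝ :=
  -m.p (a s) (b s) + (m.α1 (a s) (b s) + m.α4 (a s) (b s)) * deriv (deriv a) s
    + (m.α2 (a s) (b s) + m.α3 (a s) (b s)) * deriv a s ^ 2
    + (m.α5 (a s) (b s) + m.α6 (a s) (b s)) * deriv u s

/-- The heat flux along the fields `(a, u, b)` of one coordinate. -/
noncomputable def lineFlux (m : MaterialFunctions) (a b : ℝ → ℝ) (s : ℝ) : ℝ :=
  m.q1 (a s) (b s) * deriv b s + m.q2 (a s) (b s) * deriv a s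

/-- The rate of the density. -/
noncomputable def lineDensityRate (a u : ℝ → ℝ) (s : ℝ) : ℝ := -deriv (fun x => a x * u x) s

/-- The rate of the velocity. -/
noncomputable def lineVelocityRate (m : MaterialFunctions) (a b u : ℝ → ℝ) (s : ℝ) : ℝ :=
  deriv (lineStress m a b u) s / a s - u s * deriv u s

/-- The rate of the energy. -/
noncomputable def lineEnergyRate (m : MaterialFunctions) (a b u : ℝ → ℝ) (s : ℝ) : ℝ :=
  (lineStress m a b u s * deriv u s - deriv (lineFlux m a b) s) / a s - u s * deriv b s

theorem jetState_line (x : V) :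
    jetState (fun x => a (x 0)) (fun x => b (x 0)) (fun i x => u (x 0) * delta i 0) x
      = lineJet a b u (x 0) := by
  have h1 : ∀ (f : ℝ → ℝ) i, pd i (fun x => f (x 0)) = fun x => deriv f (x 0) * delta i 0 :=
    fun f i => funext (pd_line f i)
  have h2 : ∀ (f : ℝ → ℝ) (c : ℝ) i x,
      pd i (fun x => f (x 0) * c) x = deriv f (x 0) * c * delta i 0 := by
    intro f c i x
    rw [pd_line (fun s => f s * c), deriv_mul_const_field]
  unfold jetState lineJet lineState
  simp only [h1, h2, Prod.mk.injEq, true_and]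
  refine ⟨?_, ?_⟩ <;> funext i j <;> ring

theorem densityRate_line : densityRate (fun x => a (x 0)) (fun i x => u (x 0) * delta i 0)
    = fun x => lineDensityRate a u (x 0) := by
  funext x
  unfold densityRate lineDensityRate
  have h : ∀ j, pd j (fun x' => a (x' 0) * (u (x' 0) * delta j 0)) x
      = deriv (fun x => a x * u x) (x 0) * delta j 0 * delta j 0 := by
    intro j
    rw [pd_line (fun s => a s * (u s * delta j 0))]
    simp only [← mul_assoc, deriv_mul_const_field]
  simp only [h]
  simp [delta]

theorem velocityRate_line (i : Fin 3) :
    velocityRate m (fun x => a (x 0)) (fun x => b (x 0)) (fun i x => u (x 0) * delta i 0) i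
      = fun x => lineVelocityRate m a b u (x 0) * delta i 0 := by
  funext x
  unfold velocityRate lineVelocityRate
  simp only [jetState_line]
  have h1 : ∀ j, pd j (fun x => m.stress (lineJet a b u (x 0)) i j) x
      = deriv (fun s => m.stress (lineJet a b u s) i j) (x 0) * delta j 0 := fun j =>
    pd_line (fun s => m.stress (lineJet a b u s) i j) j x
  have h2 : ∀ s, m.stress (lineJet a b u s) i 0 = lineStress m a b u s * delta i 0 := by
    intro s
    rw [lineJet, stress_lineState]
    simp only [lineStress]
  have h3 : ∀ j, pd j (fun x => u (x 0) * delta i 0) x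
      = deriv u (x 0) * delta i 0 * delta j 0 := by
    intro j
    rw [pd_line (fun s => u s * delta i 0), deriv_mul_const_field]
  simp only [h1, h3, Fin.sum_univ_three, h2, deriv_mul_const_field]
  simp [delta]
  split_ifs <;> simp

theorem energyRate_line :
    energyRate m (fun x => a (x 0)) (fun x => b (x 0)) (fun i x => u (x 0) * delta i 0)
      = fun x => lineEnergyRate m a b u (x 0) := by
  funext x
  unfold energyRate lineEnergyRate
  simp only [jetState_line]
  have h1 : ∀ j, pd j (fun x => m.heatFlux (lineJet a b u (x 0)) j) x
      = deriv (lineFlux m a b) (x 0) * delta j 0 * delta j 0 := by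
    intro j
    rw [pd_line (fun s => m.heatFlux (lineJet a b u s) j)]
    simp only [lineJet, heatFlux_lineState, deriv_mul_const_field]
    rfl
  have h2 : m.stress (lineJet a b u (x 0)) 0 0 = lineStress m a b u (x 0) := by
    rw [lineJet, stress_lineState]
    simp [lineStress, delta]
  have h3 : ∀ i j, pd j (fun x => u (x 0) * delta i 0) x
      = deriv u (x 0) * delta i 0 * delta j 0 := by
    intro i j
    rw [pd_line (fun s => u s * delta i 0), deriv_mul_const_field]
  simp only [h1, h3, pd_line b, ddot, Fin.sum_univ_three, h2]
  simp [delta]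

theorem stateRate_line :
    stateRate m (fun x => a (x 0)) (fun x => b (x 0)) (fun i x => u (x 0) * delta i 0)
      = lineState (lineDensityRate a u 0) (lineEnergyRate m a b u 0)
        (deriv (lineDensityRate a u) 0) (deriv (lineVelocityRate m a b u) 0)
        (deriv (lineEnergyRate m a b u) 0) (deriv (deriv (lineDensityRate a u)) 0) := by
  have h1 : ∀ (f : ℝ → ℝ) i, pd i (fun x => f (x 0)) = fun x => deriv f (x 0) * delta i 0 :=
    fun f i => funext (pd_line f i)
  have h2 : ∀ (f : ℝ → ℝ) (c : ℝ) i x,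
      pd i (fun x => f (x 0) * c) x = deriv f (x 0) * c * delta i 0 := by
    intro f c i x
    rw [pd_line (fun s => f s * c), deriv_mul_const_field]
  unfold stateRate
  simp only [velocityRate_line, energyRate_line, densityRate_line]
  unfold lineState
  simp only [h1, h2, Prod.mk.injEq, true_and, Pi.zero_apply]
  refine ⟨?_, ?_⟩ <;> funext i j <;> ring

/-- The reduced inequality for fields of one coordinate. -/
theorem line_inequality (hD : IsOpen D) (hDpos : ∀ z ∈ D, 0 < z.1) (hm : m.SmoothOn D)
    {J : State → V} (hJ : ContDiffOn ℝ ∞ J (State.region D))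
    (hent : ExtendedEntropyPrinciple D m J) (ha : ContDiff ℝ ∞ a) (hb : ContDiff ℝ ∞ b)
    (hu : ContDiff ℝ ∞ u) (hu0 : u 0 = 0) {ρ ε g l e h : ℝ} (haρ : a 0 = ρ) (hbε : b 0 = ε)
    (hag : deriv a 0 = g) (hul : deriv u 0 = l) (hbe : deriv b 0 = e)
    (hah : deriv (deriv a) 0 = h) (h0 : (ρ, ε) ∈ D) {R Φ R' Ψ' Φ' R'' dJ : ℝ}
    (hR : lineDensityRate a u 0 = R) (hΦ : lineEnergyRate m a b u 0 = Φ)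
    (hR' : deriv (lineDensityRate a u) 0 = R')
    (hΨ' : m.s4 ρ ε = 0 ∨ deriv (lineVelocityRate m a b u) 0 = Ψ')
    (hΦ' : deriv (lineEnergyRate m a b u) 0 = Φ')
    (hR'' : m.s5 ρ ε = 0 ∨ deriv (deriv (lineDensityRate a u)) 0 = R'')
    (hdJ : HasDerivAt (fun s => J (lineJet a b u s) 0) dJ 0) :
    0 ≤ ρ * ((dRho m.s0 ρ ε + dRho m.s1 ρ ε * g ^ 2 + dRho m.s2 ρ ε * (g * e)
          + dRho m.s3 ρ ε * e ^ 2 + dRho m.s4 ρ ε * l + dRho m.s5 ρ ε * h) * R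
        + (dEps m.s0 ρ ε + dEps m.s1 ρ ε * g ^ 2 + dEps m.s2 ρ ε * (g * e)
          + dEps m.s3 ρ ε * e ^ 2 + dEps m.s4 ρ ε * l + dEps m.s5 ρ ε * h) * Φ
        + (2 * m.s1 ρ ε * g + m.s2 ρ ε * e) * R' + (m.s2 ρ ε * g + 2 * m.s3 ρ ε * e) * Φ'
        + m.s4 ρ ε * Ψ' + m.s5 ρ ε * R'') + dJ := by
  have hx : ContDiff ℝ ∞ fun x : V => x 0 := contDiff_apply ℝ ℝ 0
  have hmain := reduced_inequality hD hDpos hm hJ hent (r := fun x => a (x 0))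
    (e := fun x => b (x 0)) (u := fun i x => u (x 0) * delta i 0) (ha.comp hx) (hb.comp hx)
    (fun i => (hu.comp hx).mul contDiff_const) (fun i => by simp [hu0])
    (by simpa [haρ, hbε] using h0)
  simp only [jetState_line, stateRate_line, Pi.zero_apply] at hmain
  have h1 : ∀ j, pd j (fun x => J (lineJet a b u (x 0)) j) 0
      = deriv (fun s => J (lineJet a b u s) j) 0 * delta j 0 := fun j =>
    pd_line (fun s => J (lineJet a b u s) j) j 0
  simp only [h1, Fin.sum_univ_three, hdJ.deriv] at hmain
  simp only [lineJet, lineState_add_smul, entropy_lineState, haρ, hbε, hag, hul, hbe, hah, hR,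
    hΦ, hR', hΦ'] at hmain
  set P := deriv (lineVelocityRate m a b u) 0
  set Q := deriv (deriv (lineDensityRate a u)) 0
  have hlin : ∀ c d : ℝ, HasDerivAt (fun t : ℝ => c + t * d) d 0 := fun c d => by
    simpa using ((hasDerivAt_id (0 : ℝ)).mul_const d).const_add c
  have h0' : (ρ + 0 * R, ε + 0 * Φ) ∈ D := by simpa using h0
  have hs : ∀ f : ℝ → ℝ → ℝ, Smooth2 D f →
      HasDerivAt (fun t : ℝ => f (ρ + t * R) (ε + t * Φ)) (dRho f ρ ε * R + dEps f ρ ε * Φ) 0 := by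
    intro f hf
    simpa using hf.hasDerivAt hD (hlin ρ R) (hlin ε Φ) h0'
  have hE := (((((hs _ hm.s0).fun_add ((hs _ hm.s1).fun_mul ((hlin g R').fun_pow 2))).fun_add
    ((hs _ hm.s2).fun_mul ((hlin g R').fun_mul (hlin e Φ')))).fun_add
    ((hs _ hm.s3).fun_mul ((hlin e Φ').fun_pow 2))).fun_add
    ((hs _ hm.s4).fun_mul (hlin l P))).fun_add ((hs _ hm.s5).fun_mul (hlin h Q))
  rw [hE.deriv] at hmain
  -- This is the purpose of the disjunctive hypotheses: once `s₄` or `s₅` is known to vanish, the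
  -- rate it multiplies, which contains the highest derivatives, need not be computed.
  have h4 : m.s4 ρ ε * P = m.s4 ρ ε * Ψ' := by
    rcases hΨ' with h | h <;> simp [h]
  have h5 : m.s5 ρ ε * Q = m.s5 ρ ε * R'' := by
    rcases hR'' with h | h <;> simp [h]
  rw [← h4, ← h5]
  refine hmain.trans_eq ?_
  have hd : delta 0 0 = 1 ∧ delta 1 0 = 0 ∧ delta 2 0 = 0 := by simp [delta]
  rw [hd.1, hd.2.1, hd.2.2]
  simp only [zero_mul, add_zero]
  push_cast
  ring

end Line

/-! ### Vanishing of `s₂`, `s₃`, `s₄`, `s₅`. -/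

theorem eq_zero_of_forall_affine_nonneg {c d : ℝ} (h : ∀ t : ℝ, 0 ≤ c + t * d) : d = 0 := by
  by_contra hd
  have h1 := h (-(c + 1) / d)
  rw [div_mul_cancel₀ _ hd] at h1
  linarith

section Density

variable {D : Set (ℝ × ℝ)} {f : ℝ → ℝ → ℝ}

/-- If `f` were nonzero at a point it would be nonzero nearby by continuity, in particular at some
point of `D` with `A ≠ 0`. This is how the factor `α₁ + α₄` is cancelled. -/
theorem Smooth2.eq_zero_of_mul_eq_zero (hD : IsOpen D) (hf : Smooth2 D f) {A : ℝ × ℝ → ℝ}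
    (hA : D ⊆ closure {z | z ∈ D ∧ A z ≠ 0}) (h : ∀ ρ ε, (ρ, ε) ∈ D → f ρ ε * A (ρ, ε) = 0)
    {ρ ε : ℝ} (hz : (ρ, ε) ∈ D) : f ρ ε = 0 := by
  by_contra hne
  have hc : ContinuousAt (fun z : ℝ × ℝ => f z.1 z.2) (ρ, ε) := (hf.contDiffAt hD hz).continuousAt
  have h1 : ∀ᶠ z : ℝ × ℝ in nhds (ρ, ε), f z.1 z.2 ≠ 0 := hc.eventually_ne hne
  obtain ⟨z, ⟨hz2, hz3⟩, hz1⟩ :=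
    ((mem_closure_iff_frequently.1 (hA hz)).and_eventually h1).exists
  exact (mul_ne_zero hz1 hz3) (h z.1 z.2 hz2)

theorem dRho_eq_zero (hD : IsOpen D) (h : ∀ ρ ε, (ρ, ε) ∈ D → f ρ ε = 0) {ρ ε : ℝ}
    (hz : (ρ, ε) ∈ D) : dRho f ρ ε = 0 := by
  have h1 : (fun r => f r ε) =ᶠ[nhds ρ] fun _ => 0 := by
    have : ∀ᶠ r in nhds ρ, (r, ε) ∈ D :=
      (by fun_prop : Continuous fun r : ℝ => (r, ε)).continuousAt.preimage_mem_nhds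
        (hD.mem_nhds hz)
    filter_upwards [this] with r hr using h r ε hr
  simp [dRho, h1.deriv_eq]

theorem dEps_eq_zero (hD : IsOpen D) (h : ∀ ρ ε, (ρ, ε) ∈ D → f ρ ε = 0) {ρ ε : ℝ}
    (hz : (ρ, ε) ∈ D) : dEps f ρ ε = 0 := by
  have h1 : (fun r => f ρ r) =ᶠ[nhds ε] fun _ => 0 := by
    have : ∀ᶠ r in nhds ε, (ρ, r) ∈ D :=
      (by fun_prop : Continuous fun r : ℝ => (ρ, r)).continuousAt.preimage_mem_nhds
        (hD.mem_nhds hz)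
    filter_upwards [this] with r hr using h ρ r hr
  simp [dEps, h1.deriv_eq]

end Density

section Tests

variable {D : Set (ℝ × ℝ)} {m : MaterialFunctions} {J : State → V}

theorem hasDerivAt_comp_flux (hD : IsOpen D) (hJ : ContDiffOn ℝ ∞ J (State.region D))
    {γ : ℝ → State} {γ' : State} {s : ℝ} (hγ : HasDerivAt γ γ' s) (h : γ s ∈ State.region D)
    (i : Fin 3) : HasDerivAt (fun s => J (γ s) i) (fderiv ℝ J (γ s) γ' i) s := by
  have h1 := (differentiableAt_of_smooth
    (hJ.contDiffAt ((isOpen_region hD).mem_nhds h))).hasFDerivAt.comp_hasDerivAt s hγ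
  exact (hasDerivAt_pi.1 h1) i

theorem hasDerivAt_lineState {a b g l e h : ℝ → ℝ} {a' b' g' l' e' h' s : ℝ}
    (ha : HasDerivAt a a' s) (hb : HasDerivAt b b' s) (hg : HasDerivAt g g' s)
    (hl : HasDerivAt l l' s) (he : HasDerivAt e e' s) (hh : HasDerivAt h h' s) :
    HasDerivAt (fun s => lineState (a s) (b s) (g s) (l s) (e s) (h s))
      (lineState a' b' g' l' e' h') s := by
  refine ha.prodMk (hb.prodMk (HasDerivAt.prodMk ?_ (HasDerivAt.prodMk ?_
    (HasDerivAt.prodMk ?_ ?_))))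
  · exact hasDerivAt_pi.2 fun i => hg.mul_const _
  · exact hasDerivAt_pi.2 fun i => hasDerivAt_pi.2 fun j => hl.mul_const _
  · exact hasDerivAt_pi.2 fun i => he.mul_const _
  · exact hasDerivAt_pi.2 fun i => hasDerivAt_pi.2 fun j => hh.mul_const _

theorem lineState_zero : lineState 0 0 0 0 0 0 = 0 := by
  simp only [lineState, zero_mul]; rfl

theorem hasDerivAt_flux_lineJet (hD : IsOpen D) (hJ : ContDiffOn ℝ ∞ J (State.region D))
    {a b u g l e h : ℝ → ℝ} {a' b' g' l' e' h' : ℝ} (hz : (a 0, b 0) ∈ D)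
    (hag : deriv a = g) (hgh : deriv g = h) (hul : deriv u = l) (hbe : deriv b = e)
    (ha : HasDerivAt a a' 0) (hb : HasDerivAt b b' 0) (hg : HasDerivAt g g' 0)
    (hl : HasDerivAt l l' 0) (he : HasDerivAt e e' 0) (hh : HasDerivAt h h' 0) :
    HasDerivAt (fun s => J (lineJet a b u s) 0)
      (fderiv ℝ J (lineState (a 0) (b 0) (g 0) (l 0) (e 0) (h 0))
        (lineState a' b' g' l' e' h') 0) 0 := by
  unfold lineJet
  rw [hag, hgh, hul, hbe]
  exact hasDerivAt_comp_flux (γ := fun s => lineState (a s) (b s) (g s) (l s) (e s) (h s)) hD hJ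
    (hasDerivAt_lineState ha hb hg hl he hh) hz 0

/-- The velocity rate contains `div T / ρ`, hence a third derivative of the density; the rate of `L`
contains a fourth one, with coefficient `(α₁ + α₄) / ρ`. Only `s₄` multiplies that rate. -/
theorem s4_mul_eq_zero (hD : IsOpen D) (hDpos : ∀ z ∈ D, 0 < z.1) (hm : m.SmoothOn D)
    (hJ : ContDiffOn ℝ ∞ J (State.region D)) (hent : ExtendedEntropyPrinciple D m J)
    {ρ ε : ℝ} (h0 : (ρ, ε) ∈ D) : m.s4 ρ ε * (m.α1 ρ ε + m.α4 ρ ε) = 0 := by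
  have hρ : ρ ≠ 0 := (hDpos _ h0).ne'
  apply eq_zero_of_forall_affine_nonneg (c := 0)
  intro c
  -- At the origin all derivatives below the fourth vanish and the fourth is `c`. The state and its
  -- first derivative there are those of a homogeneous medium at rest, so the flux contributes
  -- nothing.
  set a : ℝ → ℝ := fun s => ρ + c * s ^ 4 / 24 with ha
  set a1 : ℝ → ℝ := fun s => c * s ^ 3 / 6 with ha1
  set a2 : ℝ → ℝ := fun s => c * s ^ 2 / 2 with ha2
  have hda : ∀ s, HasDerivAt a (a1 s) s := fun s =>
    ((((hasDerivAt_id s).fun_pow 4).const_mul c).div_const 24 |>.const_add ρ).congr_deriv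
      (by simp [ha1]; ring)
  have hda1 : ∀ s, HasDerivAt a1 (a2 s) s := fun s =>
    ((((hasDerivAt_id s).fun_pow 3).const_mul c).div_const 6).congr_deriv (by simp [ha2]; ring)
  have hda2 : ∀ s, HasDerivAt a2 (c * s) s := fun s =>
    ((((hasDerivAt_id s).fun_pow 2).const_mul c).div_const 2).congr_deriv (by simp; ring)
  have hA : deriv a = a1 := funext fun s => (hda s).deriv
  have hA1 : deriv a1 = a2 := funext fun s => (hda1 s).deriv
  have hz : (a 0, ε) ∈ D := by simpa [ha] using h0
  have hb : ∀ s : ℝ, HasDerivAt (fun _ : ℝ => ε) 0 s := fun s => hasDerivAt_const s ε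
  have hcomp : ∀ f : ℝ → ℝ → ℝ, Smooth2 D f → ∀ s, (a s, ε) ∈ D →
      HasDerivAt (fun s => f (a s) ε) (dRho f (a s) ε * a1 s) s := fun f hf s hs =>
    (hf.hasDerivAt hD (hda s) (hb s) hs).congr_deriv (by simp)
  have hnear : ∀ᶠ s in nhds (0 : ℝ), (a s, ε) ∈ D :=
    (by fun_prop : Continuous fun s : ℝ => (a s, ε)).continuousAt.preimage_mem_nhds
      (hD.mem_nhds hz)
  have hα : Smooth2 D fun r e => m.α1 r e + m.α4 r e := ContDiffOn.add hm.α1 hm.α4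
  have hβ : Smooth2 D fun r e => m.α2 r e + m.α3 r e := ContDiffOn.add hm.α2 hm.α3
  set A : ℝ → ℝ → ℝ := fun r e => m.α1 r e + m.α4 r e with hAdef
  set B : ℝ → ℝ → ℝ := fun r e => m.α2 r e + m.α3 r e with hBdef
  have hτ : lineStress m a (fun _ => ε) (fun _ => 0)
      = fun s => -m.p (a s) ε + A (a s) ε * a2 s + B (a s) ε * a1 s ^ 2 := by
    funext s
    simp [lineStress, hA, hA1, hAdef, hBdef]
  have hτ1 : ∀ᶠ s in nhds (0 : ℝ), lineVelocityRate m a (fun _ => ε) (fun _ => 0) s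
      = (-(dRho m.p (a s) ε * a1 s) + (dRho A (a s) ε * a1 s * a2 s + A (a s) ε * (c * s))
        + (dRho B (a s) ε * a1 s * a1 s ^ 2 + B (a s) ε * (2 * a1 s * a2 s))) / a s := by
    filter_upwards [hnear] with s hs
    have h1 := ((hcomp _ hm.p s hs).fun_neg.fun_add ((hcomp _ hα s hs).fun_mul (hda2 s))).fun_add
      ((hcomp _ hβ s hs).fun_mul ((hda1 s).fun_pow 2))
    rw [lineVelocityRate, hτ, h1.deriv]
    simp
  have hs4 : deriv (lineVelocityRate m a (fun _ => ε) (fun _ => 0)) 0 = A ρ ε * c / ρ := by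
    rw [Filter.EventuallyEq.deriv_eq hτ1]
    have hp := hcomp _ (hm.p.dRho hD) 0 hz
    have hA' := hcomp _ (hα.dRho hD) 0 hz
    have hB' := hcomp _ (hβ.dRho hD) 0 hz
    have hl : HasDerivAt (fun s : ℝ => c * s) c 0 := by
      simpa using (hasDerivAt_id (0 : ℝ)).const_mul c
    have h1 := (((hp.fun_mul (hda1 0)).fun_neg.fun_add
      (((hA'.fun_mul (hda1 0)).fun_mul (hda2 0)).fun_add ((hcomp _ hα 0 hz).fun_mul hl))).fun_add
      (((hB'.fun_mul (hda1 0)).fun_mul ((hda1 0).fun_pow 2)).fun_add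
        ((hcomp _ hβ 0 hz).fun_mul (((hda1 0).const_mul 2).fun_mul (hda2 0))))).fun_div (hda 0)
      (by simpa [ha] using hρ)
    rw [h1.deriv]
    simp [ha, ha1, ha2]
    field_simp
  have hR : lineDensityRate a (fun _ => 0) = fun _ => 0 := by
    funext s; simp [lineDensityRate]
  have hκ : lineFlux m a (fun _ => ε) = fun s => m.q2 (a s) ε * a1 s := by
    funext s; simp [lineFlux, hA]
  have hΦ : lineEnergyRate m a (fun _ => ε) (fun _ => 0) 0 = 0 := by
    have h1 := (hcomp _ hm.q2 0 hz).fun_mul (hda1 0)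
    rw [lineEnergyRate, hκ, h1.deriv]
    simp [ha1, ha2]
  have hJ0 := hasDerivAt_flux_lineJet (u := fun _ => 0) (l := fun _ => 0) (e := fun _ => 0) hD hJ hz
    hA hA1 (by simp) (by simp) (hda 0) (hb 0)
    (hda1 0) (hasDerivAt_const _ _) (hasDerivAt_const _ _) (hda2 0)
  have key := line_inequality (a := a) (b := fun _ => ε) (u := fun _ => 0) hD hDpos hm hJ hent
    (by fun_prop) contDiff_const contDiff_const rfl (ρ := ρ) (ε := ε) (g := 0) (l := 0) (e := 0)
    (h := 0) (by simp [ha]) rfl (by simp [hA, ha1]) (by simp) (by simp) (by simp [hA, hA1, ha2]) h0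
    (R := 0) (by simp [hR]) hΦ (R' := 0) (by simp [hR]) (.inr hs4) rfl (R'' := 0)
    (.inr (by simp [hR])) hJ0
  have e0 : lineState (a1 0) 0 (a2 0) 0 0 (c * 0) = 0 := by
    rw [← lineState_zero]; simp [ha1, ha2]
  rw [e0] at key
  have : ρ * (m.s4 ρ ε * (A ρ ε * c / ρ)) = c * (m.s4 ρ ε * A ρ ε) := by field_simp
  simpa [this] using key

/-- At constant density the rate of `∇∇ρ` is `-ρ` times the third derivative of the velocity. A
cubic velocity with third derivative `-c` makes it `ρ c`, and no other term survives at the origin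
once `s₄` vanishes. -/
theorem s5_eq_zero (hD : IsOpen D) (hDpos : ∀ z ∈ D, 0 < z.1) (hm : m.SmoothOn D)
    (hJ : ContDiffOn ℝ ∞ J (State.region D)) (hent : ExtendedEntropyPrinciple D m J)
    {ρ ε : ℝ} (h0 : (ρ, ε) ∈ D) (h4 : m.s4 ρ ε = 0) : m.s5 ρ ε = 0 := by
  have hρ : ρ ≠ 0 := (hDpos _ h0).ne'
  suffices h : ρ * (m.s5 ρ ε * ρ) = 0 by simpa [hρ] using h
  apply eq_zero_of_forall_affine_nonneg (c := 0)
  intro c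
  set u : ℝ → ℝ := fun s => -c * s ^ 3 / 6 with hu
  set u1 : ℝ → ℝ := fun s => -c * s ^ 2 / 2 with hu1
  have hdu : ∀ s, HasDerivAt u (u1 s) s := fun s =>
    ((((hasDerivAt_id s).fun_pow 3).const_mul (-c)).div_const 6).congr_deriv (by simp [hu1]; ring)
  have hdu1 : ∀ s, HasDerivAt u1 (-c * s) s := fun s =>
    ((((hasDerivAt_id s).fun_pow 2).const_mul (-c)).div_const 2).congr_deriv (by simp; ring)
  have hdu2 : ∀ s, HasDerivAt (fun s => -c * s) (-c) s := fun s => by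
    simpa using (hasDerivAt_id s).const_mul (-c)
  have hU : deriv u = u1 := funext fun s => (hdu s).deriv
  have hR : lineDensityRate (fun _ => ρ) u = fun s => -(ρ * u1 s) := by
    funext s
    rw [lineDensityRate, ((hdu s).const_mul ρ).deriv]
  have hR1 : deriv (lineDensityRate (fun _ => ρ) u) = fun s => -(ρ * (-c * s)) := by
    funext s
    rw [hR, ((hdu1 s).const_mul ρ).fun_neg.deriv]
  have hR2 : deriv (deriv (lineDensityRate (fun _ => ρ) u)) 0 = ρ * c := by
    rw [hR1, ((hdu2 0).const_mul ρ).fun_neg.deriv]; ring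
  have hκ : lineFlux m (fun _ => ρ) (fun _ => ε) = fun _ => 0 := by
    funext s; simp [lineFlux]
  have hΦ : lineEnergyRate m (fun _ => ρ) (fun _ => ε) u 0 = 0 := by
    rw [lineEnergyRate, hκ]
    simp [hU, hu1]
  have hJ0 := hasDerivAt_flux_lineJet (a := fun _ => ρ) (b := fun _ => ε) (u := u)
    (g := fun _ => 0) (h := fun _ => 0) (e := fun _ => 0) hD hJ h0 (by simp) (by simp) hU (by simp)
    (hasDerivAt_const _ _) (hasDerivAt_const _ _) (hasDerivAt_const _ _) (hdu1 0)
    (hasDerivAt_const _ _) (hasDerivAt_const _ _)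
  have key := line_inequality (a := fun _ => ρ) (b := fun _ => ε) (u := u) hD hDpos hm hJ hent
    contDiff_const contDiff_const (by fun_prop) (by simp [hu]) (ρ := ρ) (ε := ε) (g := 0) (l := 0)
    (e := 0) (h := 0) rfl rfl (by simp) (by simp [hU, hu1]) (by simp) (by simp) h0
    (R := 0) (by simp [hR, hu1]) hΦ (R' := 0) (by simp [hR1]) (Ψ' := 0) (.inl h4) rfl
    (.inr hR2) hJ0
  have e0 : lineState 0 0 0 (-c * 0) 0 0 = 0 := by
    rw [← lineState_zero]; simp
  rw [e0] at key
  have : c * (ρ * (m.s5 ρ ε * ρ)) = ρ * (m.s5 ρ ε * (ρ * c)) := by ring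
  simpa [this] using key

end Tests

section Tests

variable {D : Set (ℝ × ℝ)} {m : MaterialFunctions} {J : State → V}

/-- The separated directions `l` and `e` are those in which second derivatives of velocity and
energy move the state. -/
theorem fderiv_lineState (J : State → V) (z : State) (a b g l e h : ℝ) (i : Fin 3) :
    fderiv ℝ J z (lineState a b g l e h) i = fderiv ℝ J z (lineState a b g 0 0 h) i
      + l * fderiv ℝ J z (lineState 0 0 0 1 0 0) i
      + e * fderiv ℝ J z (lineState 0 0 0 0 1 0) i := by
  have h1 : lineState a b g l e h = lineState a b g 0 0 h + l • lineState 0 0 0 1 0 0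
      + e • lineState 0 0 0 0 1 0 := by
    rw [lineState_add_smul, lineState_add_smul]; simp
  rw [h1, map_add, map_add, map_smul, map_smul]
  simp

/-- The constant `c0` collects everything independent of `B` and `E`, the second derivatives of
velocity and energy. At `∇ρ = 0` the inequality is jointly affine in the two, and its coefficients
relate the derivatives of the flux to `s₂` and `s₃`. -/
theorem quadratic_line_inequality (hD : IsOpen D) (hDpos : ∀ z ∈ D, 0 < z.1) (hm : m.SmoothOn D)
    (hJ : ContDiffOn ℝ ∞ J (State.region D)) (hent : ExtendedEntropyPrinciple D m J)
    (h4 : ∀ ρ ε, (ρ, ε) ∈ D → m.s4 ρ ε = 0) (h5 : ∀ ρ ε, (ρ, ε) ∈ D → m.s5 ρ ε = 0)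
    {ρ ε : ℝ} (h0 : (ρ, ε) ∈ D) (l e h : ℝ) : ∃ c0 : ℝ, ∀ B E : ℝ,
    0 ≤ c0 + B * (-ρ ^ 2 * m.s2 ρ ε * e + 2 * m.s3 ρ ε * e * (-m.p ρ ε
          + (m.α1 ρ ε + m.α4 ρ ε) * h + 2 * (m.α5 ρ ε + m.α6 ρ ε) * l)
        + fderiv ℝ J (lineState ρ ε 0 l e h) (lineState 0 0 0 1 0 0) 0)
      + E * (-(dEps m.s0 ρ ε + dEps m.s3 ρ ε * e ^ 2) * m.q1 ρ ε
          - 6 * m.s3 ρ ε * e ^ 2 * dEps m.q1 ρ ε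
        + fderiv ℝ J (lineState ρ ε 0 l e h) (lineState 0 0 0 0 1 0) 0) := by
  have hρ : ρ ≠ 0 := (hDpos _ h0).ne'
  set A : ℝ → ℝ → ℝ := fun r e => m.α1 r e + m.α4 r e with hAdef
  set B2 : ℝ → ℝ → ℝ := fun r e => m.α2 r e + m.α3 r e with hBdef
  set C : ℝ → ℝ → ℝ := fun r e => m.α5 r e + m.α6 r e with hCdef
  have hA : Smooth2 D A := ContDiffOn.add hm.α1 hm.α4
  have hB2 : Smooth2 D B2 := ContDiffOn.add hm.α2 hm.α3
  have hC : Smooth2 D C := ContDiffOn.add hm.α5 hm.α6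
  set τ0 : ℝ := -m.p ρ ε + A ρ ε * h + C ρ ε * l with hτ0
  set τ1 : ℝ := -dEps m.p ρ ε * e + dEps A ρ ε * e * h + dEps C ρ ε * e * l with hτ1
  set κ2 : ℝ := dRho m.q1 ρ ε * h * e + dEps (dEps m.q1) ρ ε * e ^ 3
    + 2 * dEps m.q2 ρ ε * e * h with hκ2
  refine ⟨ρ * ((dRho m.s0 ρ ε + dRho m.s3 ρ ε * e ^ 2) * (-(ρ * l))
      + (dEps m.s0 ρ ε + dEps m.s3 ρ ε * e ^ 2)
        * ((τ0 * l - (dEps m.q1 ρ ε * e ^ 2 + m.q2 ρ ε * h)) / ρ)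
      + 2 * m.s3 ρ ε * e * ((τ1 * l - κ2) / ρ - l * e))
      + fderiv ℝ J (lineState ρ ε 0 l e h) (lineState 0 e h 0 0 0) 0, fun B E => ?_⟩
  set a : ℝ → ℝ := fun s => ρ + h * s ^ 2 / 2 with ha
  set a1 : ℝ → ℝ := fun s => h * s with ha1
  set b : ℝ → ℝ := fun s => ε + e * s + E * s ^ 2 / 2 with hb
  set b1 : ℝ → ℝ := fun s => e + E * s with hb1
  set u : ℝ → ℝ := fun s => l * s + B * s ^ 2 / 2 with hu
  set u1 : ℝ → ℝ := fun s => l + B * s with hu1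
  have hlin : ∀ c s : ℝ, HasDerivAt (fun s => c * s) c s := fun c s => by
    simpa using (hasDerivAt_id s).const_mul c
  have hquad : ∀ c s : ℝ, HasDerivAt (fun s => c * s ^ 2 / 2) (c * s) s := fun c s =>
    ((((hasDerivAt_id s).fun_pow 2).const_mul c).div_const 2).congr_deriv (by simp; ring)
  have hda : ∀ s, HasDerivAt a (a1 s) s := fun s => (hquad h s).const_add ρ
  have hda1 : ∀ s, HasDerivAt a1 h s := fun s => hlin h s
  have hdb : ∀ s, HasDerivAt b (b1 s) s := fun s => ((hlin e s).const_add ε).fun_add (hquad E s)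
  have hdb1 : ∀ s, HasDerivAt b1 E s := fun s => (hlin E s).const_add e
  have hdu : ∀ s, HasDerivAt u (u1 s) s := fun s => (hlin l s).fun_add (hquad B s)
  have hdu1 : ∀ s, HasDerivAt u1 B s := fun s => (hlin B s).const_add l
  have hDa : deriv a = a1 := funext fun s => (hda s).deriv
  have hDa1 : deriv a1 = fun _ => h := funext fun s => (hda1 s).deriv
  have hDb : deriv b = b1 := funext fun s => (hdb s).deriv
  have hDu : deriv u = u1 := funext fun s => (hdu s).deriv
  have hz : (a 0, b 0) ∈ D := by simpa [ha, hb] using h0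
  have hnear : ∀ᶠ s in nhds (0 : ℝ), (a s, b s) ∈ D :=
    (by fun_prop : Continuous fun s : ℝ => (a s, b s)).continuousAt.preimage_mem_nhds
      (hD.mem_nhds hz)
  have hcomp : ∀ f : ℝ → ℝ → ℝ, Smooth2 D f → ∀ s, (a s, b s) ∈ D →
      HasDerivAt (fun s => f (a s) (b s))
        (dRho f (a s) (b s) * a1 s + dEps f (a s) (b s) * b1 s) s := fun f hf s hs =>
    hf.hasDerivAt hD (hda s) (hdb s) hs
  have ea : a 0 = ρ := by simp [ha]
  have eb : b 0 = ε := by simp [hb]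
  have eu : u 0 = 0 := by simp [hu]
  have ea1 : a1 0 = 0 := by simp [ha1]
  have eb1 : b1 0 = e := by simp [hb1]
  have eu1 : u1 0 = l := by simp [hu1]
  -- rate of the density
  have hR : lineDensityRate a u = fun s => -(a1 s * u s + a s * u1 s) := by
    funext s
    rw [lineDensityRate, ((hda s).fun_mul (hdu s)).deriv]
  have hR0 : lineDensityRate a u 0 = -(ρ * l) := by rw [hR]; simp [ea, eu, ea1, eu1]
  have hR1 : deriv (lineDensityRate a u) 0 = -(ρ * B) := by
    rw [hR, (((hda1 0).fun_mul (hdu 0)).fun_add ((hda 0).fun_mul (hdu1 0))).fun_neg.deriv]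
    simp [ea, eu, ea1, eu1]
  -- stress and heat flux
  have hτ : lineStress m a b u
      = fun s => -m.p (a s) (b s) + A (a s) (b s) * h + B2 (a s) (b s) * a1 s ^ 2
        + C (a s) (b s) * u1 s := by
    funext s
    simp [lineStress, hDa, hDa1, hDu, hAdef, hBdef, hCdef]
  have hτd : HasDerivAt (lineStress m a b u) (τ1 + C ρ ε * B) 0 := by
    rw [hτ]
    refine (((((hcomp _ hm.p 0 hz).fun_neg).fun_add ((hcomp _ hA 0 hz).mul_const h)).fun_add
      ((hcomp _ hB2 0 hz).fun_mul ((hda1 0).fun_pow 2))).fun_add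
      ((hcomp _ hC 0 hz).fun_mul (hdu1 0))).congr_deriv ?_
    simp [ea, eb, ea1, eb1, eu1, hτ1]
    ring
  have hτv : lineStress m a b u 0 = τ0 := by
    rw [hτ]; simp [ea, eb, ea1, eu1, hτ0]
  have hκ : lineFlux m a b
      = fun s => m.q1 (a s) (b s) * b1 s + m.q2 (a s) (b s) * a1 s := by
    funext s
    simp [lineFlux, hDa, hDb]
  set κ' : ℝ → ℝ := fun s =>
    (dRho m.q1 (a s) (b s) * a1 s + dEps m.q1 (a s) (b s) * b1 s) * b1 s + m.q1 (a s) (b s) * E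
    + ((dRho m.q2 (a s) (b s) * a1 s + dEps m.q2 (a s) (b s) * b1 s) * a1 s
      + m.q2 (a s) (b s) * h) with hκ'
  have hκd : ∀ᶠ s in nhds (0 : ℝ), deriv (lineFlux m a b) s = κ' s := by
    filter_upwards [hnear] with s hs
    rw [hκ, (((hcomp _ hm.q1 s hs).fun_mul (hdb1 s)).fun_add
      ((hcomp _ hm.q2 s hs).fun_mul (hda1 s))).deriv]
  have hκ'v : κ' 0 = dEps m.q1 ρ ε * e ^ 2 + m.q1 ρ ε * E + m.q2 ρ ε * h := by
    simp [hκ', ea, eb, ea1, eb1]; ring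
  -- The factor 3 arises as two from the square of `b1` and one from the derivative of `q₁` in front
  -- of `E`.
  have hκ'd : HasDerivAt κ' (κ2 + 3 * dEps m.q1 ρ ε * e * E) 0 := by
    have h1 := hcomp _ (hm.q1.dRho hD) 0 hz
    have h2 := hcomp _ (hm.q1.dEps hD) 0 hz
    have h3 := hcomp _ (hm.q2.dRho hD) 0 hz
    have h4 := hcomp _ (hm.q2.dEps hD) 0 hz
    refine ((((h1.fun_mul (hda1 0)).fun_add (h2.fun_mul (hdb1 0))).fun_mul (hdb1 0)).fun_add
      ((hcomp _ hm.q1 0 hz).mul_const E)).fun_add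
      ((((h3.fun_mul (hda1 0)).fun_add (h4.fun_mul (hdb1 0))).fun_mul (hda1 0)).fun_add
      ((hcomp _ hm.q2 0 hz).mul_const h)) |>.congr_deriv ?_
    simp [ea, eb, ea1, eb1, hκ2]
    ring
  -- rate of the energy
  have hΦ : ∀ᶠ s in nhds (0 : ℝ), lineEnergyRate m a b u s
      = (lineStress m a b u s * u1 s - κ' s) / a s - u s * b1 s := by
    filter_upwards [hκd] with s hs
    rw [lineEnergyRate, hs, hDu, hDb]
  have hΦ0 : lineEnergyRate m a b u 0
      = (τ0 * l - (dEps m.q1 ρ ε * e ^ 2 + m.q1 ρ ε * E + m.q2 ρ ε * h)) / ρ := by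
    rw [hΦ.self_of_nhds, hτv, hκ'v, ea, eu, eu1]; simp
  have hΦ1 : deriv (lineEnergyRate m a b u) 0
      = ((τ1 + C ρ ε * B) * l + τ0 * B - (κ2 + 3 * dEps m.q1 ρ ε * e * E)) / ρ - l * e := by
    rw [Filter.EventuallyEq.deriv_eq hΦ]
    have h1 := (((hτd.fun_mul (hdu1 0)).fun_sub hκ'd).fun_div (hda 0) (by rw [ea]; exact hρ)).fun_sub
      ((hdu 0).fun_mul (hdb1 0))
    rw [h1.deriv, hτv, hκ'v, ea, eu, eu1, ea1, eb1]
    field_simp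
    ring
  have hJ0 := hasDerivAt_flux_lineJet hD hJ hz hDa hDa1 hDu hDb (hda 0) (hdb 0)
    (hda1 0) (hdu1 0) (hdb1 0) (hasDerivAt_const _ _)
  have key := line_inequality hD hDpos hm hJ hent (a := a) (b := b) (u := u)
    (by fun_prop) (by fun_prop) (by fun_prop) eu ea eb (by rw [hDa, ea1]) (by rw [hDu, eu1])
    (by rw [hDb, eb1]) (by rw [hDa, hDa1]) h0 hR0 hΦ0 hR1 (Ψ' := 0) (.inl (h4 _ _ h0)) hΦ1
    (R'' := 0) (.inl (h5 _ _ h0)) hJ0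
  rw [ea, eb, ea1, eb1, eu1, fderiv_lineState, h4 _ _ h0, h5 _ _ h0, dRho_eq_zero hD h4 h0,
    dRho_eq_zero hD h5 h0, dEps_eq_zero hD h4 h0, dEps_eq_zero hD h5 h0] at key
  refine key.trans_eq ?_
  simp only [hτ0]
  field_simp
  ring

theorem hasDerivAt_flux_l (hD : IsOpen D) (hJ : ContDiffOn ℝ ∞ J (State.region D))
    {ρ ε : ℝ} (h0 : (ρ, ε) ∈ D) (l e h : ℝ) :
    HasDerivAt (fun l => J (lineState ρ ε 0 l e h) 0)
      (fderiv ℝ J (lineState ρ ε 0 l e h) (lineState 0 0 0 1 0 0) 0) l :=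
  hasDerivAt_comp_flux (γ := fun l => lineState ρ ε 0 l e h) hD hJ
    (hasDerivAt_lineState (hasDerivAt_const _ _) (hasDerivAt_const _ _) (hasDerivAt_const _ _)
      (hasDerivAt_id l) (hasDerivAt_const _ _) (hasDerivAt_const _ _)) h0 0

theorem hasDerivAt_flux_e (hD : IsOpen D) (hJ : ContDiffOn ℝ ∞ J (State.region D))
    {ρ ε : ℝ} (h0 : (ρ, ε) ∈ D) (l e h : ℝ) :
    HasDerivAt (fun e => J (lineState ρ ε 0 l e h) 0)
      (fderiv ℝ J (lineState ρ ε 0 l e h) (lineState 0 0 0 0 1 0) 0) e :=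
  hasDerivAt_comp_flux (γ := fun e => lineState ρ ε 0 l e h) hD hJ
    (hasDerivAt_lineState (hasDerivAt_const _ _) (hasDerivAt_const _ _) (hasDerivAt_const _ _)
      (hasDerivAt_const _ _) (hasDerivAt_id e) (hasDerivAt_const _ _)) h0 0

/-- The `B`-coefficient says that the derivative of the flux in `l` is `e κ'(l)`, the
`E`-coefficient that its derivative in `e` does not depend on `l`. Integrating the first gives `J(l,
e) = J(0, e) + e κ(l)`, and the second then forces `κ(l) = 0`. -/
theorem s2_s3_relation (hD : IsOpen D) (hDpos : ∀ z ∈ D, 0 < z.1) (hm : m.SmoothOn D)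
    (hJ : ContDiffOn ℝ ∞ J (State.region D)) (hent : ExtendedEntropyPrinciple D m J)
    (h4 : ∀ ρ ε, (ρ, ε) ∈ D → m.s4 ρ ε = 0) (h5 : ∀ ρ ε, (ρ, ε) ∈ D → m.s5 ρ ε = 0)
    {ρ ε : ℝ} (h0 : (ρ, ε) ∈ D) (l h : ℝ) :
    ρ ^ 2 * m.s2 ρ ε * l - 2 * m.s3 ρ ε * ((-m.p ρ ε + (m.α1 ρ ε + m.α4 ρ ε) * h) * l
      + (m.α5 ρ ε + m.α6 ρ ε) * l ^ 2) = 0 := by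
  set κ : ℝ → ℝ := fun l => ρ ^ 2 * m.s2 ρ ε * l
    - 2 * m.s3 ρ ε * ((-m.p ρ ε + (m.α1 ρ ε + m.α4 ρ ε) * h) * l
      + (m.α5 ρ ε + m.α6 ρ ε) * l ^ 2) with hκ
  have hL : ∀ l e, fderiv ℝ J (lineState ρ ε 0 l e h) (lineState 0 0 0 1 0 0) 0
      = e * (ρ ^ 2 * m.s2 ρ ε - 2 * m.s3 ρ ε * (-m.p ρ ε
          + (m.α1 ρ ε + m.α4 ρ ε) * h + 2 * (m.α5 ρ ε + m.α6 ρ ε) * l)) := by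
    intro l e
    obtain ⟨c0, hc0⟩ := quadratic_line_inequality hD hDpos hm hJ hent h4 h5 h0 l e h
    have h1 := eq_zero_of_forall_affine_nonneg (c := c0) fun B => by simpa using hc0 B 0
    linear_combination h1
  have hE : ∀ l e, fderiv ℝ J (lineState ρ ε 0 l e h) (lineState 0 0 0 0 1 0) 0
      = (dEps m.s0 ρ ε + dEps m.s3 ρ ε * e ^ 2) * m.q1 ρ ε
          + 6 * m.s3 ρ ε * e ^ 2 * dEps m.q1 ρ ε := by
    intro l e
    obtain ⟨c0, hc0⟩ := quadratic_line_inequality hD hDpos hm hJ hent h4 h5 h0 l e h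
    have h1 := eq_zero_of_forall_affine_nonneg (c := c0) fun E => by simpa using hc0 0 E
    linear_combination h1
  have hκd : ∀ l, HasDerivAt κ (ρ ^ 2 * m.s2 ρ ε - 2 * m.s3 ρ ε * (-m.p ρ ε
      + (m.α1 ρ ε + m.α4 ρ ε) * h + 2 * (m.α5 ρ ε + m.α6 ρ ε) * l)) l := by
    intro l
    refine (((hasDerivAt_id l).const_mul (ρ ^ 2 * m.s2 ρ ε)).fun_sub
      ((((hasDerivAt_id l).const_mul _).fun_add
        (((hasDerivAt_id l).fun_pow 2).const_mul _)).const_mul (2 * m.s3 ρ ε))).congr_deriv ?_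
    simp only [id]
    push_cast
    ring
  have hconst : ∀ l e, J (lineState ρ ε 0 l e h) 0 - e * κ l = J (lineState ρ ε 0 0 e h) 0 := by
    intro l e
    have hd : ∀ l, HasDerivAt (fun l => J (lineState ρ ε 0 l e h) 0 - e * κ l) 0 l := fun l =>
      ((hasDerivAt_flux_l hD hJ h0 l e h).fun_sub ((hκd l).const_mul e)).congr_deriv
        (by rw [hL]; ring)
    have := is_const_of_deriv_eq_zero (fun l => (hd l).differentiableAt) (fun l => (hd l).deriv) l 0
    simpa [hκ] using this
  have h1 := hasDerivAt_flux_e hD hJ h0 l 0 h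
  have h2 : HasDerivAt (fun e => J (lineState ρ ε 0 l e h) 0)
      (fderiv ℝ J (lineState ρ ε 0 0 0 h) (lineState 0 0 0 0 1 0) 0 + κ l) 0 := by
    have h3 := (hasDerivAt_flux_e hD hJ h0 0 0 h).fun_add
      ((hasDerivAt_id (0 : ℝ)).mul_const (κ l))
    have h4 : (fun e => J (lineState ρ ε 0 l e h) 0)
        = fun e => J (lineState ρ ε 0 0 e h) 0 + id e * κ l := by
      funext e
      rw [← hconst l e]; simp
    rw [h4]
    exact h3.congr_deriv (by ring)
  have h3 := h1.unique h2
  rw [hE, hE] at h3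
  linarith

/-- The coefficients `s₂, …, s₅` of the entropy vanish. -/
theorem entropy_coefficients_eq_zero (hD : IsOpen D) (hDpos : ∀ z ∈ D, 0 < z.1)
    (hm : m.SmoothOn D) (hJ : ContDiffOn ℝ ∞ J (State.region D))
    (hcap : D ⊆ closure {z : ℝ × ℝ | z ∈ D ∧ m.α1 z.1 z.2 + m.α4 z.1 z.2 ≠ 0})
    (hent : ExtendedEntropyPrinciple D m J) {ρ ε : ℝ} (h0 : (ρ, ε) ∈ D) :
    m.s2 ρ ε = 0 ∧ m.s3 ρ ε = 0 ∧ m.s4 ρ ε = 0 ∧ m.s5 ρ ε = 0 := by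
  have h4 : ∀ ρ ε, (ρ, ε) ∈ D → m.s4 ρ ε = 0 := fun ρ ε h =>
    hm.s4.eq_zero_of_mul_eq_zero (A := fun z => m.α1 z.1 z.2 + m.α4 z.1 z.2) hD hcap
      (fun ρ ε h => s4_mul_eq_zero hD hDpos hm hJ hent h) h
  have h5 : ∀ ρ ε, (ρ, ε) ∈ D → m.s5 ρ ε = 0 := fun ρ ε h =>
    s5_eq_zero hD hDpos hm hJ hent h (h4 ρ ε h)
  have h3 : ∀ ρ ε, (ρ, ε) ∈ D → m.s3 ρ ε = 0 := fun ρ ε h =>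
    hm.s3.eq_zero_of_mul_eq_zero (A := fun z => m.α1 z.1 z.2 + m.α4 z.1 z.2) hD hcap
      (fun ρ ε h => by
        -- The difference between `h = 1` and `h = 0` isolates the term `s₃ (α₁ + α₄)`.
        have e1 := s2_s3_relation hD hDpos hm hJ hent h4 h5 h 1 1
        have e2 := s2_s3_relation hD hDpos hm hJ hent h4 h5 h 1 0
        linear_combination (1 / 2) * (e2 - e1)) h
  have h2 : m.s2 ρ ε = 0 := by
    have e1 := s2_s3_relation hD hDpos hm hJ hent h4 h5 h0 1 0
    rw [h3 _ _ h0] at e1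
    have hρ : ρ ≠ 0 := (hDpos _ h0).ne'
    simpa [hρ] using e1
  exact ⟨h2, h3 _ _ h0, h4 _ _ h0, h5 _ _ h0⟩

end Tests

/-! ### The reduced inequality for three-dimensional jets. -/

/-- A polynomial of degree two in its standard form. -/
noncomputable def quadPoly (c : ℝ) (g : V) (H : T2) (x : V) : ℝ :=
  c + ∑ i, g i * x i + (∑ i, ∑ j, H i j * (x i * x j)) / 2

theorem contDiff_quadPoly (c : ℝ) (g : V) (H : T2) : ContDiff ℝ ∞ (quadPoly c g H) := by
  unfold quadPoly; fun_prop

theorem contDiff_dot_right (ξ : V) : ContDiff ℝ ∞ fun x => dot ξ x := by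
  unfold dot; fun_prop

theorem hasFDerivAt_coord (j : Fin 3) (x : V) : HasFDerivAt (fun x : V => x j)
    (ContinuousLinearMap.proj (R := ℝ) (φ := fun _ : Fin 3 => ℝ) j) x :=
  (ContinuousLinearMap.proj (R := ℝ) (φ := fun _ : Fin 3 => ℝ) j).hasFDerivAt

theorem pd_quadPoly (c : ℝ) (g : V) {H : T2} (hH : ∀ i j, H i j = H j i) (k : Fin 3) :
    pd k (quadPoly c g H) = quadPoly (g k) (H k) 0 := by
  funext x
  have h1 : HasFDerivAt (quadPoly c g H) (∑ i, g i • (ContinuousLinearMap.proj (R := ℝ)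
      (φ := fun _ : Fin 3 => ℝ) i) + (2 : ℝ)⁻¹ • ∑ i, ∑ j, H i j • (x i •
        (ContinuousLinearMap.proj (R := ℝ) (φ := fun _ : Fin 3 => ℝ) j) +
        x j • (ContinuousLinearMap.proj (R := ℝ) (φ := fun _ : Fin 3 => ℝ) i))) x := by
    unfold quadPoly
    simp only [div_eq_inv_mul]
    refine HasFDerivAt.add (HasFDerivAt.const_add c (HasFDerivAt.fun_sum fun i _ =>
      (hasFDerivAt_coord i x).const_mul (g i))) (HasFDerivAt.const_mul
        (HasFDerivAt.fun_sum fun i _ => HasFDerivAt.fun_sum fun j _ =>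
          ((hasFDerivAt_coord i x).mul (hasFDerivAt_coord j x)).const_mul (H i j)) _)
  rw [pd, h1.fderiv]
  fin_cases k <;> simp [quadPoly, Fin.sum_univ_three, hH 1 0, hH 2 0, hH 2 1] <;> ring

theorem pd_dot_pow (ξ : V) (c : ℝ) (n : ℕ) (k : Fin 3) :
    pd k (fun x => c * dot ξ x ^ (n + 1)) = fun x => ((n + 1) * c * ξ k) * dot ξ x ^ n := by
  funext x
  have h0 : HasFDerivAt (fun x => dot ξ x) (∑ i, ξ i • (ContinuousLinearMap.proj (R := ℝ)
      (φ := fun _ : Fin 3 => ℝ) i)) x :=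
    HasFDerivAt.fun_sum fun i _ => (hasFDerivAt_coord i x).const_mul (ξ i)
  have h1 := (h0.pow (n + 1)).const_mul c
  rw [pd, h1.fderiv]
  fin_cases k <;> simp [Fin.sum_univ_three] <;> ring

section Inequality

variable {D : Set (ℝ × ℝ)} {m : MaterialFunctions} {J : State → V}

theorem entropy_eq (hs : ∀ ρ ε, (ρ, ε) ∈ D →
      m.s2 ρ ε = 0 ∧ m.s3 ρ ε = 0 ∧ m.s4 ρ ε = 0 ∧ m.s5 ρ ε = 0) {z : State}
    (hz : z ∈ State.region D) :
    m.entropy z = m.s0 z.rho z.eps + m.s1 z.rho z.eps * dot z.gradRho z.gradRho := by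
  obtain ⟨h2, h3, h4, h5⟩ := hs _ _ hz
  simp [MaterialFunctions.entropy, h2, h3, h4, h5]

theorem hasDerivAt_dot_line (g g' : V) :
    HasDerivAt (fun t : ℝ => dot (g + t • g') (g + t • g')) (2 * dot g g') 0 := by
  have h : ∀ i, HasDerivAt (fun t : ℝ => (g + t • g') i) (g' i) 0 := fun i => by
    simpa using ((hasDerivAt_id (0 : ℝ)).mul_const (g' i)).const_add (g i)
  refine (HasDerivAt.fun_sum fun i (_ : i ∈ Finset.univ) => (h i).fun_mul (h i)).congr_deriv ?_
  simp only [dot, Finset.mul_sum]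
  refine Finset.sum_congr rfl fun i _ => ?_
  simp; ring

/-- With `s₂, …, s₅` gone, the entropy rate involves only the rates of `ρ`, `ε` and `∇ρ`; the
gradients of the velocity and energy rates no longer matter. -/
theorem deriv_entropy_line (hD : IsOpen D) (hm : m.SmoothOn D)
    (hs : ∀ ρ ε, (ρ, ε) ∈ D → m.s2 ρ ε = 0 ∧ m.s3 ρ ε = 0 ∧ m.s4 ρ ε = 0 ∧ m.s5 ρ ε = 0)
    {z : State} (hz : z ∈ State.region D) (y : State) :
    deriv (fun t : ℝ => m.entropy (z + t • y)) 0
      = (dRho m.s0 z.rho z.eps + dRho m.s1 z.rho z.eps * dot z.gradRho z.gradRho) * y.rho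
      + (dEps m.s0 z.rho z.eps + dEps m.s1 z.rho z.eps * dot z.gradRho z.gradRho) * y.eps
      + 2 * m.s1 z.rho z.eps * dot z.gradRho y.gradRho := by
  have hnear : ∀ᶠ t : ℝ in nhds 0, z + t • y ∈ State.region D :=
    (by fun_prop : Continuous fun t : ℝ => z + t • y).continuousAt.preimage_mem_nhds
      ((isOpen_region hD).mem_nhds (by simpa using hz))
  have heq : (fun t : ℝ => m.entropy (z + t • y)) =ᶠ[nhds 0] fun t =>
      m.s0 (z.rho + t * y.rho) (z.eps + t * y.eps) + m.s1 (z.rho + t * y.rho) (z.eps + t * y.eps)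
        * dot (z.gradRho + t • y.gradRho) (z.gradRho + t • y.gradRho) := by
    filter_upwards [hnear] with t ht
    exact entropy_eq hs ht
  rw [heq.deriv_eq]
  have hlin : ∀ c d : ℝ, HasDerivAt (fun t : ℝ => c + t * d) d 0 := fun c d => by
    simpa using ((hasDerivAt_id (0 : ℝ)).mul_const d).const_add c
  have h0 : (z.rho + 0 * y.rho, z.eps + 0 * y.eps) ∈ D := by
    simpa using (show (z.rho, z.eps) ∈ D from hz)
  have h1 := hm.s0.hasDerivAt hD (hlin z.rho y.rho) (hlin z.eps y.eps) h0
  have h2 := hm.s1.hasDerivAt hD (hlin z.rho y.rho) (hlin z.eps y.eps) h0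
  rw [(h1.fun_add (h2.fun_mul (hasDerivAt_dot_line z.gradRho y.gradRho))).deriv]
  simp
  ring

/-- The divergence of the heat flux determined by a state and a Hessian of the energy. -/
noncomputable def divHeatFlux (m : MaterialFunctions) (ρ ε : ℝ) (g e : V) (H E : T2) : ℝ :=
  m.q1 ρ ε * tr E + m.q2 ρ ε * tr H + dRho m.q1 ρ ε * dot g e + dEps m.q1 ρ ε * dot e e
    + dRho m.q2 ρ ε * dot g g + dEps m.q2 ρ ε * dot g e

theorem pd_comp_fields (hD : IsOpen D) {f : ℝ → ℝ → ℝ} (hf : Smooth2 D f) {r e : V → ℝ} {x : V}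
    (hr : DifferentiableAt ℝ r x) (he : DifferentiableAt ℝ e x) (hx : (r x, e x) ∈ D)
    (k : Fin 3) : DifferentiableAt ℝ (fun x => f (r x) (e x)) x ∧
      pd k (fun x => f (r x) (e x)) x
      = dRho f (r x) (e x) * pd k r x + dEps f (r x) (e x) * pd k e x := by
  have h1 := (hf.hasFDerivAt hD hx).comp x (hr.hasFDerivAt.prodMk he.hasFDerivAt)
  have h2 : fderiv ℝ (fun x => f (r x) (e x)) x = _ := h1.fderiv
  exact ⟨h1.differentiableAt, by simp [pd, h2]⟩

theorem pd_comp_flux (hD : IsOpen D) (hJ : ContDiffOn ℝ ∞ J (State.region D)) {ζ : V → State}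
    {x : V} (hζ : DifferentiableAt ℝ ζ x) (hx : ζ x ∈ State.region D) (i k : Fin 3) :
    pd k (fun x => J (ζ x) i) x = fderiv ℝ J (ζ x) (fderiv ℝ ζ x (Pi.single k 1)) i := by
  have h1 := (differentiableAt_of_smooth
    (hJ.contDiffAt ((isOpen_region hD).mem_nhds hx))).hasFDerivAt.comp x hζ.hasFDerivAt
  have h2 := (hasFDerivAt_pi'.1 h1 i).fderiv
  have h3 : fderiv ℝ (fun x => J (ζ x) i) x = _ := h2
  simp [pd, h3]

theorem fderiv_jetState {r e : V → ℝ} {u : Fin 3 → V → ℝ} (hr : ContDiff ℝ ∞ r)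
    (he : ContDiff ℝ ∞ e) (hu : ∀ i, ContDiff ℝ ∞ (u i)) (x : V) (k : Fin 3) :
    fderiv ℝ (jetState r e u) x (Pi.single k 1)
      = (pd k r x, pd k e x, fun i => pd k (pd i r) x,
        fun i j => (pd k (pd j (u i)) x + pd k (pd i (u j)) x) / 2,
        fun i => pd k (pd i e) x, fun i j => pd k (pd j (pd i r)) x) := by
  have d1 : ∀ {f : V → ℝ}, ContDiff ℝ ∞ f → HasFDerivAt f (fderiv ℝ f x) x := fun hf =>
    (differentiable_of_smooth hf x).hasFDerivAt
  have h : HasFDerivAt (jetState r e u) ((fderiv ℝ r x).prod ((fderiv ℝ e x).prod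
      ((ContinuousLinearMap.pi fun i => fderiv ℝ (pd i r) x).prod
      ((ContinuousLinearMap.pi fun i => ContinuousLinearMap.pi fun j =>
        (2 : ℝ)⁻¹ • (fderiv ℝ (pd j (u i)) x + fderiv ℝ (pd i (u j)) x)).prod
      ((ContinuousLinearMap.pi fun i => fderiv ℝ (pd i e) x).prod
      (ContinuousLinearMap.pi fun i => ContinuousLinearMap.pi fun j =>
        fderiv ℝ (pd j (pd i r)) x)))))) x := by
    refine (d1 hr).prodMk ((d1 he).prodMk (HasFDerivAt.prodMk ?_ (HasFDerivAt.prodMk ?_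
      (HasFDerivAt.prodMk ?_ ?_))))
    · exact hasFDerivAt_pi.2 fun i => d1 (ContDiff.pd hr i)
    · refine hasFDerivAt_pi.2 fun i => hasFDerivAt_pi.2 fun j => ?_
      simp only [div_eq_inv_mul]
      exact ((d1 (ContDiff.pd (hu i) j)).add (d1 (ContDiff.pd (hu j) i))).const_mul _
    · exact hasFDerivAt_pi.2 fun i => d1 (ContDiff.pd he i)
    · exact hasFDerivAt_pi.2 fun i => hasFDerivAt_pi.2 fun j =>
        d1 (ContDiff.pd (ContDiff.pd hr i) j)
  rw [h.fderiv]
  simp only [ContinuousLinearMap.prod_apply, Prod.mk.injEq]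
  refine ⟨rfl, rfl, ?_, ?_, ?_, ?_⟩
  · funext i; rfl
  · funext i j
    simp [pd]; ring
  · funext i; rfl
  · funext i j; rfl

/-- The reduced inequality as an inequality for the jets of the fields at a point. -/
theorem jet_inequality (hD : IsOpen D) (hDpos : ∀ z ∈ D, 0 < z.1) (hm : m.SmoothOn D)
    (hJ : ContDiffOn ℝ ∞ J (State.region D)) (hent : ExtendedEntropyPrinciple D m J)
    (hs : ∀ ρ ε, (ρ, ε) ∈ D → m.s2 ρ ε = 0 ∧ m.s3 ρ ε = 0 ∧ m.s4 ρ ε = 0 ∧ m.s5 ρ ε = 0)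
    {ρ ε : ℝ} (h0 : (ρ, ε) ∈ D) (g e ξ : V) {L H E : T2} {B : Fin 3 → T2} (a : ℝ)
    (hL : ∀ i j, L i j = L j i) (hH : ∀ i j, H i j = H j i) (hE : ∀ i j, E i j = E j i)
    (hB : ∀ i j k, B i j k = B i k j) :
    0 ≤ -ρ ^ 2 * (dRho m.s0 ρ ε + dRho m.s1 ρ ε * dot g g) * tr L
      + (dEps m.s0 ρ ε + dEps m.s1 ρ ε * dot g g)
        * (ddot (m.stress (ρ, ε, g, L, e, H)) L - divHeatFlux m ρ ε g e H E)
      - 2 * ρ * m.s1 ρ ε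
        * ∑ i, g i * ∑ j, (g j * L j i + g i * L j j + ρ * B j j i)
      + ∑ j, fderiv ℝ J (ρ, ε, g, L, e, H) (g j, e j, fun i => H i j,
          fun i k => (B i k j + B k i j) / 2, fun i => E i j,
          fun i k => a * (ξ i * ξ k * ξ j)) j := by
  have hρ : ρ ≠ 0 := (hDpos _ h0).ne'
  -- The cubic term gives `∇∇∇ρ = a ξ ⊗ ξ ⊗ ξ` without altering the lower jet at the origin. For
  -- velocity and energy, second derivatives are the highest that enter.
  set r : V → ℝ := fun x => quadPoly ρ g H x + a / 6 * dot ξ x ^ 3 with hr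
  set η : V → ℝ := quadPoly ε e E with hη
  set u : Fin 3 → V → ℝ := fun i => quadPoly 0 (L i) (B i) with hu
  have hrC : ContDiff ℝ ∞ r :=
    (contDiff_quadPoly _ _ _).add (contDiff_const.mul ((contDiff_dot_right ξ).pow 3))
  have hηC : ContDiff ℝ ∞ η := contDiff_quadPoly _ _ _
  have huC : ∀ i, ContDiff ℝ ∞ (u i) := fun i => contDiff_quadPoly _ _ _
  have q0 : ∀ (c : ℝ) (g : V) (H : T2), quadPoly c g H 0 = c := fun c g H => by simp [quadPoly]
  have z0 : dot ξ 0 = 0 := by simp [dot]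
  have hzero : ∀ i j : Fin 3, (0 : T2) i j = (0 : T2) j i := fun _ _ => rfl
  have qd : ∀ (c : ℝ) (g : V) (H : T2) (x : V), DifferentiableAt ℝ (quadPoly c g H) x :=
    fun c g H x => differentiable_of_smooth (contDiff_quadPoly c g H) x
  have cd : ∀ (c : ℝ) (n : ℕ) (x : V), DifferentiableAt ℝ (fun x => c * dot ξ x ^ n) x :=
    fun c n x => differentiable_of_smooth (contDiff_const.mul ((contDiff_dot_right ξ).pow n)) x
  have r1 : ∀ k, pd k r = fun x => quadPoly (g k) (H k) 0 x + (a / 2 * ξ k) * dot ξ x ^ 2 := by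
    intro k
    funext x
    rw [hr, pd_add (qd _ _ _ x) (cd _ _ x), pd_quadPoly _ _ hH, pd_dot_pow]
    push_cast; ring
  have r2 : ∀ k j, pd j (pd k r) = fun x => quadPoly (H k j) 0 0 x
      + (a * ξ k * ξ j) * dot ξ x ^ 1 := by
    intro k j
    funext x
    rw [r1, pd_add (qd _ _ _ x) (cd _ _ x), pd_quadPoly _ _ hzero, pd_dot_pow]
    have : (0 : T2) j = 0 := rfl
    rw [this]
    push_cast; ring
  have r3 : ∀ k j i, pd i (pd j (pd k r)) 0 = a * (ξ k * ξ j * ξ i) := by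
    intro k j i
    rw [r2, pd_add (qd _ _ _ 0) (cd _ _ 0), pd_quadPoly _ _ hzero, pd_dot_pow, q0]
    simp; ring
  have r10 : ∀ k, pd k r 0 = g k := fun k => by simp [r1, q0, z0]
  have r20 : ∀ k j, pd j (pd k r) 0 = H k j := fun k j => by simp [r2, q0, z0]
  have η10 : ∀ k, pd k η 0 = e k := fun k => by rw [hη, pd_quadPoly _ _ hE, q0]
  have η20 : ∀ k j, pd j (pd k η) 0 = E k j := fun k j => by
    rw [hη, pd_quadPoly _ _ hE, pd_quadPoly _ _ hzero, q0]
  have u10 : ∀ i k, pd k (u i) 0 = L i k := fun i k => by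
    rw [hu]; simp only; rw [pd_quadPoly _ _ (hB i), q0]
  have u20 : ∀ i k j, pd j (pd k (u i)) 0 = B i k j := fun i k j => by
    rw [hu]; simp only; rw [pd_quadPoly _ _ (hB i), pd_quadPoly _ _ hzero, q0]
  have hr0 : r 0 = ρ := by simp [hr, q0, z0]
  have hη0 : η 0 = ε := q0 _ _ _
  have hu0 : ∀ i, u i 0 = 0 := fun i => q0 _ _ _
  have hz : (r 0, η 0) ∈ D := by rw [hr0, hη0]; exact h0
  have hjet : jetState r η u 0 = (ρ, ε, g, L, e, H) := by
    simp only [jetState, r10, r20, η10, u10, hr0, hη0, Prod.mk.injEq, true_and]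
    refine ⟨?_, trivial⟩
    funext i j
    rw [hL j i]; ring
  have hreg : ((ρ, ε, g, L, e, H) : State) ∈ State.region D := h0
  have main := reduced_inequality hD hDpos hm hJ hent hrC hηC huC hu0 hz
  rw [hjet, deriv_entropy_line hD hm hs hreg] at main
  have hflux : ∀ j, pd j (fun x => J (jetState r η u x) j) 0
      = fderiv ℝ J (ρ, ε, g, L, e, H) (g j, e j, fun i => H i j,
          fun i k => (B i k j + B k i j) / 2, fun i => E i j,
          fun i k => a * (ξ i * ξ k * ξ j)) j := by
    intro j
    rw [pd_comp_flux hD hJ (differentiable_of_smooth (contDiff_jetState hrC hηC huC) 0)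
      (by rw [hjet]; exact hreg), fderiv_jetState hrC hηC huC, hjet]
    simp only [r10, r20, r3, η10, η20, u20]
  simp only [hflux] at main
  -- rate of the density
  have dr : ∀ x, DifferentiableAt ℝ r x := fun x => differentiable_of_smooth hrC x
  have dη : ∀ x, DifferentiableAt ℝ η x := fun x => differentiable_of_smooth hηC x
  have du : ∀ i x, DifferentiableAt ℝ (u i) x := fun i x => differentiable_of_smooth (huC i) x
  have dpr : ∀ k x, DifferentiableAt ℝ (pd k r) x := fun k x =>
    differentiable_of_smooth (ContDiff.pd hrC k) x
  have dpη : ∀ k x, DifferentiableAt ℝ (pd k η) x := fun k x =>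
    differentiable_of_smooth (ContDiff.pd hηC k) x
  have dpu : ∀ i k x, DifferentiableAt ℝ (pd k (u i)) x := fun i k x =>
    differentiable_of_smooth (ContDiff.pd (huC i) k) x
  have hR : ∀ x, densityRate r u x = -∑ j, (pd j r x * u j x + r x * pd j (u j) x) := by
    intro x
    simp only [densityRate, pd_mul (dr x) (du _ x)]
  have hR0 : densityRate r u 0 = -(ρ * tr L) := by
    rw [hR]; simp [hu0, hr0, u10, tr, Finset.mul_sum]
  have hR1 : ∀ i, pd i (densityRate r u) 0
      = -∑ j, (g j * L j i + g i * L j j + ρ * B j j i) := by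
    intro i
    have h1 : densityRate r u = fun x => -∑ j, (pd j r x * u j x + r x * pd j (u j) x) :=
      funext hR
    have h2 : HasFDerivAt (fun x => -∑ j, (pd j r x * u j x + r x * pd j (u j) x))
        (-∑ j, ((pd j r 0 • fderiv ℝ (u j) 0 + u j 0 • fderiv ℝ (pd j r) 0)
          + (r 0 • fderiv ℝ (pd j (u j)) 0 + pd j (u j) 0 • fderiv ℝ r 0))) 0 :=
      (HasFDerivAt.fun_sum fun j _ => ((dpr j 0).hasFDerivAt.mul (du j 0).hasFDerivAt).add
        ((dr 0).hasFDerivAt.mul (dpu j j 0).hasFDerivAt)).neg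
    rw [h1, pd, h2.fderiv]
    have e1 : ∀ j, fderiv ℝ (u j) 0 (Pi.single i 1) = L j i := fun j => u10 j i
    have e2 : ∀ j, fderiv ℝ (pd j (u j)) 0 (Pi.single i 1) = B j j i := fun j => u20 j j i
    have e3 : fderiv ℝ r 0 (Pi.single i 1) = g i := r10 i
    simp only [_root_.neg_apply, _root_.sum_apply,
      _root_.add_apply, _root_.smul_apply, smul_eq_mul, hu0, r10, hr0,
      u10, e1, e2, e3]
    congr 1
    refine Finset.sum_congr rfl fun j _ => ?_
    ring
  -- rate of the energy
  have hq : ∀ j, pd j (fun x => m.heatFlux (jetState r η u x) j) 0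
      = (dRho m.q1 ρ ε * g j + dEps m.q1 ρ ε * e j) * e j + m.q1 ρ ε * E j j
        + ((dRho m.q2 ρ ε * g j + dEps m.q2 ρ ε * e j) * g j + m.q2 ρ ε * H j j) := by
    intro j
    obtain ⟨d1, p1⟩ := pd_comp_fields hD hm.q1 (dr 0) (dη 0) hz j
    obtain ⟨d2, p2⟩ := pd_comp_fields hD hm.q2 (dr 0) (dη 0) hz j
    have h1 : (fun x => m.heatFlux (jetState r η u x) j)
        = fun x => m.q1 (r x) (η x) * pd j η x + m.q2 (r x) (η x) * pd j r x := rfl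
    rw [h1, pd_add (d1.fun_mul (dpη j 0)) (d2.fun_mul (dpr j 0)), pd_mul d1 (dpη j 0),
      pd_mul d2 (dpr j 0), p1, p2, hr0, hη0, r10, r20, η10, η20]
  have hΦ : energyRate m r η u 0
      = (ddot (m.stress (ρ, ε, g, L, e, H)) L - divHeatFlux m ρ ε g e H E) / ρ := by
    unfold energyRate
    simp only [hq, hjet, u10, hu0, hr0, zero_mul, Finset.sum_const_zero, sub_zero]
    congr 2
    simp only [divHeatFlux, tr, dot, Fin.sum_univ_three]
    ring
  refine main.trans_eq ?_
  rw [hr0]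
  simp only [stateRate, State.rho, State.eps, State.gradRho, hR0, hR1, hΦ, dot]
  field_simp
  simp only [Finset.sum_neg_distrib, mul_neg]
  ring

end Inequality

/-! ### Orthogonal matrices and diagonal tensors. -/

/-- The diagonal tensor. -/
def diag (a b c : ℝ) : T2 := fun i j => if i = j then ![a, b, c] i else 0

/-- The tensor `ξ ⊗ ξ`. -/
def outer (ξ : V) : T2 := fun i j => ξ i * ξ j

/-- The unit vectors of the coordinate axes. -/
def axis (k : Fin 3) : V := fun i => delta i k

theorem dot_axis (k : Fin 3) (a : V) : dot (axis k) a = a k := by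
  fin_cases k <;> simp [dot, axis, delta]

theorem diag_symm (a b c : ℝ) (i j : Fin 3) : diag a b c i j = diag a b c j i := by
  by_cases h : i = j
  · rw [h]
  · simp [diag, h, Ne.symm h]

theorem outer_symm (ξ : V) (i j : Fin 3) : outer ξ i j = outer ξ j i := mul_comm _ _

theorem add_smul_outer_symm {H : T2} (hH : ∀ i j, H i j = H j i) (t : ℝ) (ξ : V) (i j : Fin 3) :
    (H + t • outer ξ) i j = (H + t • outer ξ) j i := by
  simp [hH i j, outer_symm ξ i j]

theorem diag_add_outer (a b c t : ℝ) :
    diag a b c + t • outer (axis 0) = diag (a + t) b c := by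
  funext i j
  fin_cases i <;> fin_cases j <;> simp [diag, outer, axis, delta]

/-- Rotations in the plane of the first two axes. -/
def rot01 (c s : ℝ) : Matrix (Fin 3) (Fin 3) ℝ := !![c, s, 0; -s, c, 0; 0, 0, 1]

/-- Rotations in the plane of the first and the third axis. -/
def rot02 (c s : ℝ) : Matrix (Fin 3) (Fin 3) ℝ := !![c, 0, s; 0, 1, 0; -s, 0, c]

/-- Reflections in the coordinate planes. -/
def reflection (a b c : ℝ) : Matrix (Fin 3) (Fin 3) ℝ := !![a, 0, 0; 0, b, 0; 0, 0, c]

/-- The exchange of the first two axes. -/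
def swap01 : Matrix (Fin 3) (Fin 3) ℝ := !![0, 1, 0; 1, 0, 0; 0, 0, 1]

/-- The exchange of the first and the third axis. -/
def swap02 : Matrix (Fin 3) (Fin 3) ℝ := !![0, 0, 1; 0, 1, 0; 1, 0, 0]

/-- The exchange of the last two axes. -/
def swap12 : Matrix (Fin 3) (Fin 3) ℝ := !![1, 0, 0; 0, 0, 1; 0, 1, 0]

theorem mem_orthogonalGroup_of {Q : Matrix (Fin 3) (Fin 3) ℝ}
    (h : ∀ i j, ∑ k, Q i k * Q j k = if i = j then 1 else 0) :
    Q ∈ Matrix.orthogonalGroup (Fin 3) ℝ := by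
  rw [Matrix.mem_orthogonalGroup_iff]
  ext i j
  simpa [Matrix.mul_apply, Matrix.one_apply] using h i j

theorem rot01_mem {c s : ℝ} (h : c ^ 2 + s ^ 2 = 1) :
    rot01 c s ∈ Matrix.orthogonalGroup (Fin 3) ℝ := by
  apply mem_orthogonalGroup_of
  intro i j
  fin_cases i <;> fin_cases j <;> simp [rot01, Fin.sum_univ_three] <;>
  first | ring1 | linear_combination h

theorem rot02_mem {c s : ℝ} (h : c ^ 2 + s ^ 2 = 1) :
    rot02 c s ∈ Matrix.orthogonalGroup (Fin 3) ℝ := by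
  apply mem_orthogonalGroup_of
  intro i j
  fin_cases i <;> fin_cases j <;> simp [rot02, Fin.sum_univ_three] <;>
  first | ring1 | linear_combination h

theorem reflection_mem {a b c : ℝ} (ha : a * a = 1) (hb : b * b = 1) (hc : c * c = 1) :
    reflection a b c ∈ Matrix.orthogonalGroup (Fin 3) ℝ := by
  apply mem_orthogonalGroup_of
  intro i j
  fin_cases i <;> fin_cases j <;> simp [reflection, Fin.sum_univ_three, ha, hb, hc]

theorem swap01_mem : swap01 ∈ Matrix.orthogonalGroup (Fin 3) ℝ := by
  apply mem_orthogonalGroup_of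
  intro i j
  fin_cases i <;> fin_cases j <;> simp [swap01, Fin.sum_univ_three]

theorem swap02_mem : swap02 ∈ Matrix.orthogonalGroup (Fin 3) ℝ := by
  apply mem_orthogonalGroup_of
  intro i j
  fin_cases i <;> fin_cases j <;> simp [swap02, Fin.sum_univ_three]

theorem swap12_mem : swap12 ∈ Matrix.orthogonalGroup (Fin 3) ℝ := by
  apply mem_orthogonalGroup_of
  intro i j
  fin_cases i <;> fin_cases j <;> simp [swap12, Fin.sum_univ_three]

theorem actT_rot01_diag {c s : ℝ} (h : c ^ 2 + s ^ 2 = 1) (a b : ℝ) :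
    actT (rot01 c s) (diag a a b) = diag a a b := by
  funext i j
  fin_cases i <;> fin_cases j <;> simp [actT, rot01, diag, Fin.sum_univ_three] <;>
  first | ring1 | linear_combination a * h

theorem actT_rot02_diag {c s : ℝ} (h : c ^ 2 + s ^ 2 = 1) (a b : ℝ) :
    actT (rot02 c s) (diag a b a) = diag a b a := by
  funext i j
  fin_cases i <;> fin_cases j <;> simp [actT, rot02, diag, Fin.sum_univ_three] <;>
  first | ring1 | linear_combination a * h

theorem actT_reflection_diag {x y z : ℝ} (hx : x * x = 1) (hy : y * y = 1) (hz : z * z = 1)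
    (a b c : ℝ) : actT (reflection x y z) (diag a b c) = diag a b c := by
  funext i j
  fin_cases i <;> fin_cases j <;> simp [actT, reflection, diag, Fin.sum_univ_three, hx, hy, hz]

theorem actT_swap01_diag (a b c : ℝ) : actT swap01 (diag a b c) = diag b a c := by
  funext i j
  fin_cases i <;> fin_cases j <;> simp [actT, swap01, diag, Fin.sum_univ_three]

theorem actT_swap02_diag (a b c : ℝ) : actT swap02 (diag a b c) = diag c b a := by
  funext i j
  fin_cases i <;> fin_cases j <;> simp [actT, swap02, diag, Fin.sum_univ_three]

theorem actT_swap12_diag (a b c : ℝ) : actT swap12 (diag a b c) = diag a c b := by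
  funext i j
  fin_cases i <;> fin_cases j <;> simp [actT, swap12, diag, Fin.sum_univ_three]

/-- The plane vector `(x, y)` can be turned onto the first axis: take its normalization as `(c, s)`,
and the identity when it is zero. -/
theorem exists_rotation (x y : ℝ) : ∃ c s : ℝ, c ^ 2 + s ^ 2 = 1 ∧ -s * x + c * y = 0 := by
  by_cases h : x ^ 2 + y ^ 2 = 0
  · have hy : y = 0 := by nlinarith [sq_nonneg x, sq_nonneg y]
    exact ⟨1, 0, by norm_num, by simp [hy]⟩
  · have hpos : 0 < x ^ 2 + y ^ 2 := lt_of_le_of_ne (by positivity) (Ne.symm h)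
    have hne : Real.sqrt (x ^ 2 + y ^ 2) ≠ 0 := (Real.sqrt_pos.2 hpos).ne'
    refine ⟨x / Real.sqrt (x ^ 2 + y ^ 2), y / Real.sqrt (x ^ 2 + y ^ 2), ?_, ?_⟩
    · rw [div_pow, div_pow, Real.sq_sqrt hpos.le]
      field_simp
    · field_simp
      ring

theorem exists_diagonalization {H : T2} (hH : ∀ i j, H i j = H j i) :
    ∃ Q ∈ Matrix.orthogonalGroup (Fin 3) ℝ, ∃ a b c, actT Q (diag a b c) = H := by
  have hA : (Matrix.of H).IsHermitian := by
    ext i j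
    simp [hH i j]
  refine ⟨hA.eigenvectorUnitary, hA.eigenvectorUnitary.2, hA.eigenvalues 0, hA.eigenvalues 1,
    hA.eigenvalues 2, ?_⟩
  have h := hA.spectral_theorem
  funext i j
  have hij := congrFun (congrFun h i) j
  rw [Matrix.of_apply] at hij
  rw [hij]
  simp [Unitary.conjStarAlgAut_apply, Matrix.mul_apply, actT, diag, Fin.sum_univ_three,
    Matrix.diagonal_apply]
  ring

/-! ### Vanishing of isotropic null functions. -/

section Isotropy

/-- An antisymmetry of maps whose component in any direction does not change along it. -/
theorem dot_antisymm {φ : V → V} (h0 : φ 0 = 0)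
    (h : ∀ e ξ, dot ξ (φ (e + ξ)) = dot ξ (φ e)) (x y : V) : dot x (φ y) = -dot y (φ x) := by
  have h1 := h 0 x
  -- Linearity of `φ` is not needed: moving from `y` to `x` along `x - y` keeps that component, and
  -- both diagonal terms `x · φ x` and `y · φ y` vanish.
  have h2 := h y (x - y)
  rw [zero_add, h0] at h1
  rw [add_sub_cancel] at h2
  simp only [dot, Pi.sub_apply, Pi.zero_apply, mul_zero, Finset.sum_const_zero, sub_mul,
    Finset.sum_sub_distrib] at *
  have h3 := h 0 y
  rw [zero_add, h0] at h3
  simp only [Pi.zero_apply, mul_zero, Finset.sum_const_zero] at h3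
  linarith

/-- An isotropic vector function of two vectors and a symmetric tensor whose component along `ξ`
changes neither in the direction `ξ ⊗ ξ` of the tensor nor in the direction `ξ` of the second
vector, and which vanishes along the axis when the first vector is an eigenvector of the tensor
and the second one is zero. -/
structure IsotropicNull (f : V → V → T2 → V) : Prop where
  iso : ∀ Q ∈ Matrix.orthogonalGroup (Fin 3) ℝ, ∀ g e H, (∀ i j, H i j = H j i) →
    f (actV Q g) (actV Q e) (actT Q H) = actV Q (f g e H)
  hess : ∀ g e H, (∀ i j, H i j = H j i) → ∀ (ξ : V) (t : ℝ),
    dot ξ (f g e (H + t • outer ξ)) = dot ξ (f g e H)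
  grad : ∀ g e H, (∀ i j, H i j = H j i) → ∀ ξ : V, dot ξ (f g (e + ξ) H) = dot ξ (f g e H)
  eigen : ∀ γ a b c : ℝ, f (γ • axis 0) 0 (diag a b c) 0 = 0

theorem actV_zero (Q : Matrix (Fin 3) (Fin 3) ℝ) : actV Q 0 = 0 := by
  funext i; simp [actV]

namespace IsotropicNull

variable {f : V → V → T2 → V}

/-- The first component does not see the first eigenvalue. That eigenvalue can therefore be matched
to another one, which makes the tensor invariant under rotations of a coordinate plane. -/
theorem hess_diag (hf : IsotropicNull f) (g e : V) (a a' b c : ℝ) :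
    f g e (diag a b c) 0 = f g e (diag a' b c) 0 := by
  have h := hf.hess g e _ (diag_symm a b c) (axis 0) (a' - a)
  rw [diag_add_outer, dot_axis, dot_axis] at h
  rw [← h]; congr 3; ring

/-- The reflection reversing the second axis fixes all arguments but changes the sign of this
component. -/
theorem one_eq_zero (hf : IsotropicNull f) {g : V} (hg : g 1 = 0) (a b c : ℝ) :
    f g 0 (diag a b c) 1 = 0 := by
  have h := hf.iso _ (reflection_mem (a := 1) (b := -1) (c := 1) (by norm_num) (by norm_num)
    (by norm_num)) g 0 _ (diag_symm a b c)
  rw [actT_reflection_diag (by norm_num) (by norm_num) (by norm_num)] at h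
  have hg' : actV (reflection 1 (-1) 1) g = g := by
    funext i; fin_cases i <;> simp [actV, reflection, Fin.sum_univ_three, hg]
  rw [hg', actV_zero] at h
  have h1 := congrFun h 1
  simp [actV, reflection, Fin.sum_univ_three] at h1
  linarith

theorem two_eq_zero (hf : IsotropicNull f) {g : V} (hg : g 2 = 0) (a b c : ℝ) :
    f g 0 (diag a b c) 2 = 0 := by
  have h := hf.iso _ (reflection_mem (a := 1) (b := 1) (c := -1) (by norm_num) (by norm_num)
    (by norm_num)) g 0 _ (diag_symm a b c)
  rw [actT_reflection_diag (by norm_num) (by norm_num) (by norm_num)] at h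
  have hg' : actV (reflection 1 1 (-1)) g = g := by
    funext i; fin_cases i <;> simp [actV, reflection, Fin.sum_univ_three, hg]
  rw [hg', actV_zero] at h
  have h1 := congrFun h 2
  simp [actV, reflection, Fin.sum_univ_three] at h1
  linarith

/-- The component along the axis vanishes if the first vector lies in the plane of the first two
axes. -/
theorem zero_of_plane (hf : IsotropicNull f) {g : V} (hg : g 2 = 0) (a b c : ℝ) :
    f g 0 (diag a b c) 0 = 0 := by
  -- With the first two eigenvalues equal, rotation in that plane takes `g` to the first axis
  -- without changing the tensor. There the first component vanishes by `eigen` and the second by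
  -- reflection; rotating back gives zero.
  rw [hf.hess_diag g 0 a b b c]
  obtain ⟨x, y, hxy, h0⟩ := exists_rotation (g 0) (g 1)
  have h := hf.iso _ (rot01_mem hxy) g 0 _ (diag_symm b b c)
  have hg' : actV (rot01 x y) g = (x * g 0 + y * g 1) • axis 0 := by
    funext i
    fin_cases i <;> simp [actV, rot01, Fin.sum_univ_three, axis, delta, hg]
    linarith
  rw [actT_rot01_diag hxy, actV_zero, hg'] at h
  have e0 := congrFun h 0
  have e1 := congrFun h 1
  rw [hf.eigen] at e0
  rw [hf.one_eq_zero (by simp [axis, delta])] at e1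
  simp [actV, rot01, Fin.sum_univ_three] at e0 e1
  linear_combination (-f g 0 (diag b b c) 0) * hxy - x * e0 + y * e1

theorem zero_of_diag (hf : IsotropicNull f) (g : V) (a b c : ℝ) :
    f g 0 (diag a b c) 0 = 0 := by
  -- Equal first and third eigenvalues permit a rotation that removes the third component of `g`,
  -- reducing to the planar case.
  rw [hf.hess_diag g 0 a c b c]
  obtain ⟨x, y, hxy, h0⟩ := exists_rotation (g 0) (g 2)
  have h := hf.iso _ (rot02_mem hxy) g 0 _ (diag_symm c b c)
  have hg' : actV (rot02 x y) g 2 = 0 := by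
    simp [actV, rot02, Fin.sum_univ_three]
    linarith
  rw [actT_rot02_diag hxy, actV_zero] at h
  have e0 := congrFun h 0
  have e1 := congrFun h 2
  rw [hf.zero_of_plane hg'] at e0
  rw [hf.two_eq_zero hg'] at e1
  simp [actV, rot02, Fin.sum_univ_three] at e0 e1
  linear_combination (-f g 0 (diag c b c) 0) * hxy - x * e0 + y * e1

theorem apply_one (hf : IsotropicNull f) (g e : V) (a b c : ℝ) :
    f g e (diag a b c) 1 = f (actV swap01 g) (actV swap01 e) (diag b a c) 0 := by
  have h := congrFun (hf.iso _ swap01_mem g e _ (diag_symm a b c)) 0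
  rw [actT_swap01_diag] at h
  rw [h]
  simp [actV, swap01, Fin.sum_univ_three]

theorem apply_two (hf : IsotropicNull f) (g e : V) (a b c : ℝ) :
    f g e (diag a b c) 2 = f (actV swap02 g) (actV swap02 e) (diag c b a) 0 := by
  have h := congrFun (hf.iso _ swap02_mem g e _ (diag_symm a b c)) 0
  rw [actT_swap02_diag] at h
  rw [h]
  simp [actV, swap02, Fin.sum_univ_three]

theorem eq_zero_of_diag (hf : IsotropicNull f) (g : V) (a b c : ℝ) :
    f g 0 (diag a b c) = 0 := by
  funext i
  fin_cases i
  · exact hf.zero_of_diag g a b c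
  · exact (hf.apply_one g 0 a b c).trans (by rw [actV_zero]; exact hf.zero_of_diag _ _ _ _)
  · exact (hf.apply_two g 0 a b c).trans (by rw [actV_zero]; exact hf.zero_of_diag _ _ _ _)

/-- The function vanishes at zero second vector, so `grad` makes it antisymmetric as a map of that
vector. -/
theorem antisymm (hf : IsotropicNull f) (g : V) (a b c : ℝ) (x y : V) :
    dot x (f g y (diag a b c)) = -dot y (f g x (diag a b c)) :=
  dot_antisymm (φ := fun e => f g e (diag a b c)) (hf.eq_zero_of_diag g a b c)
    (fun e ξ => hf.grad g e _ (diag_symm a b c) ξ) x y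

/-- The reflection reversing the second axis fixes `g`, the tensor and the first component, and
sends `axis 1` to its negative: the value is even in that vector. By antisymmetry it is also odd. -/
theorem mixed_zero_of_plane (hf : IsotropicNull f) {g : V} (hg : g 1 = 0) (a b c : ℝ) :
    f g (axis 1) (diag a b c) 0 = 0 := by
  have h := hf.iso _ (reflection_mem (a := 1) (b := -1) (c := 1) (by norm_num) (by norm_num)
    (by norm_num)) g (axis 1) _ (diag_symm a b c)
  rw [actT_reflection_diag (by norm_num) (by norm_num) (by norm_num)] at h
  have hg' : actV (reflection 1 (-1) 1) g = g := by
    funext i; fin_cases i <;> simp [actV, reflection, Fin.sum_univ_three, hg]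
  rw [hg'] at h
  have h1 := congrFun h 0
  have h2 := hf.antisymm g a b c (axis 0) (actV (reflection 1 (-1) 1) (axis 1))
  have h3 := hf.antisymm g a b c (axis 0) (axis 1)
  rw [dot_axis] at h2 h3
  simp [actV, reflection, Fin.sum_univ_three, dot, axis, delta] at h1 h2 h3
  linarith

theorem mixed_zero_of_diag (hf : IsotropicNull f) (g : V) (a b c : ℝ) :
    f g (axis 1) (diag a b c) 0 = 0 := by
  rw [hf.hess_diag g (axis 1) a b b c]
  obtain ⟨x, y, hxy, h0⟩ := exists_rotation (g 0) (g 1)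
  have h := hf.iso _ (rot01_mem hxy) g (axis 1) _ (diag_symm b b c)
  have hg' : actV (rot01 x y) g 1 = 0 := by
    simp [actV, rot01, Fin.sum_univ_three]
    linarith
  rw [actT_rot01_diag hxy] at h
  -- After rotation the second component of `g` is zero. The action on the first two axes is an
  -- antisymmetric block at `G`, and its only free entry vanishes by the planar case; hence the
  -- first two components of the rotated value are zero.
  set G := actV (rot01 x y) g
  have hm := hf.mixed_zero_of_plane hg' b b c
  have a0 := hf.antisymm G b b c (axis 0) (actV (rot01 x y) (axis 1))
  have a1 := hf.antisymm G b b c (axis 1) (actV (rot01 x y) (axis 1))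
  have a2 := hf.antisymm G b b c (axis 0) (axis 0)
  have a3 := hf.antisymm G b b c (axis 1) (axis 1)
  have a4 := hf.antisymm G b b c (axis 0) (axis 1)
  have e0 := congrFun h 0
  have e1 := congrFun h 1
  have e2 : actV (rot01 x y) (axis 1) = y • axis 0 + x • axis 1 := by
    funext i; fin_cases i <;> simp [actV, rot01, axis, delta]
  have hlin : ∀ w, dot (y • axis 0 + x • axis 1) w = y * w 0 + x * w 1 := by
    intro w; simp [dot, axis, delta, Fin.sum_univ_three]
  rw [e2] at a0 a1 e0 e1
  rw [hlin] at a0 a1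
  simp only [dot_axis] at a0 a1 a2 a3 a4
  have e3 : actV (rot01 x y) (f g (axis 1) (diag b b c)) 0
      = x * f g (axis 1) (diag b b c) 0 + y * f g (axis 1) (diag b b c) 1 := by
    simp [actV, rot01, Fin.sum_univ_three]
  have e4 : actV (rot01 x y) (f g (axis 1) (diag b b c)) 1
      = -y * f g (axis 1) (diag b b c) 0 + x * f g (axis 1) (diag b b c) 1 := by
    simp [actV, rot01, Fin.sum_univ_three]
  rw [e3] at e0
  rw [e4] at e1
  have b0 : f G (axis 0) (diag b b c) 0 = 0 := by linarith
  have b1 : f G (axis 1) (diag b b c) 1 = 0 := by linarith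
  have b2 : f G (axis 0) (diag b b c) 1 = 0 := by linarith
  rw [b0, b2] at a0
  rw [hm, b1] at a1
  rw [a0] at e0
  rw [a1] at e1
  linear_combination (-f g (axis 1) (diag b b c) 0) * hxy - x * e0 + y * e1

/-- By antisymmetry the first component at `e` is `-e · f(axis 0)`, and each component of `f(axis
0)` is, up to sign, the first component at a coordinate vector. These are diagonal or mixed entries,
already zero. -/
theorem zero_of_diag' (hf : IsotropicNull f) (g e : V) (a b c : ℝ) :
    f g e (diag a b c) 0 = 0 := by
  have h0 := hf.antisymm g a b c (axis 0) (axis 0)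
  have h1 := hf.antisymm g a b c (axis 0) (axis 1)
  have h2 := hf.antisymm g a b c (axis 0) (axis 2)
  have h := hf.antisymm g a b c (axis 0) e
  have m1 := hf.mixed_zero_of_diag g a b c
  have m2 := congrFun (hf.iso _ swap12_mem g (axis 2) _ (diag_symm a b c)) 0
  have hs : actV swap12 (axis 2) = axis 1 := by
    funext i; fin_cases i <;> simp [actV, swap12, axis, delta]
  rw [actT_swap12_diag, hs, hf.mixed_zero_of_diag] at m2
  have m3 : actV swap12 (f g (axis 2) (diag a b c)) 0 = f g (axis 2) (diag a b c) 0 := by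
    simp [actV, swap12, Fin.sum_univ_three]
  rw [m3] at m2
  simp only [dot_axis] at h0 h1 h2 h
  rw [h]
  simp only [dot, Fin.sum_univ_three]
  have b0 : f g (axis 0) (diag a b c) 0 = 0 := by linarith
  have b1 : f g (axis 0) (diag a b c) 1 = 0 := by linarith
  have b2 : f g (axis 0) (diag a b c) 2 = 0 := by linarith
  rw [b0, b1, b2]; ring

theorem eq_zero_of_diag' (hf : IsotropicNull f) (g e : V) (a b c : ℝ) :
    f g e (diag a b c) = 0 := by
  funext i
  fin_cases i
  · exact hf.zero_of_diag' g e a b c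
  · exact (hf.apply_one g e a b c).trans (hf.zero_of_diag' _ _ _ _ _)
  · exact (hf.apply_two g e a b c).trans (hf.zero_of_diag' _ _ _ _ _)

theorem eq_zero (hf : IsotropicNull f) (g e : V) {H : T2} (hH : ∀ i j, H i j = H j i) :
    f g e H = 0 := by
  obtain ⟨Q, hQ, a, b, c, rfl⟩ := exists_diagonalization hH
  have hinv : ∀ w : V, actV Q (actV Q.transpose w) = w := by
    intro w
    have h1 : Q * Q.transpose = 1 := (Matrix.mem_orthogonalGroup_iff (Fin 3) ℝ).1 hQ
    have h2 : ∀ (P : Matrix (Fin 3) (Fin 3) ℝ) w, actV P w = P.mulVec w := fun P w => rfl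
    rw [h2, h2, Matrix.mulVec_mulVec, h1, Matrix.one_mulVec]
  have h := hf.iso Q hQ (actV Q.transpose g) (actV Q.transpose e) _ (diag_symm a b c)
  rw [hinv, hinv, hf.eq_zero_of_diag', actV_zero] at h
  exact h

end IsotropicNull

end Isotropy

/-! ### Coefficients of the highest derivatives. -/

section Extraction

variable {D : Set (ℝ × ℝ)} {m : MaterialFunctions} {J : State → V}

/-- The consequences of the entropy principle that are linear in the highest derivatives, and the
remaining inequality. -/
structure FluxConditions (D : Set (ℝ × ℝ)) (m : MaterialFunctions) (J : State → V) : Prop where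
  dL : ∀ ρ ε, (ρ, ε) ∈ D → ∀ (g e : V) (L H S : T2), (∀ i j, L i j = L j i) →
    (∀ i j, H i j = H j i) → (∀ i j, S i j = S j i) → ∀ i,
    fderiv ℝ J (ρ, ε, g, L, e, H) (0, 0, 0, S, 0, 0) i = 2 * ρ ^ 2 * m.s1 ρ ε * tr S * g i
  dGradEps : ∀ ρ ε, (ρ, ε) ∈ D → ∀ (g e : V) (L H : T2), (∀ i j, L i j = L j i) →
    (∀ i j, H i j = H j i) → ∀ ξ : V,
    dot ξ (fderiv ℝ J (ρ, ε, g, L, e, H) (0, 0, 0, 0, ξ, 0))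
      = (dEps m.s0 ρ ε + dEps m.s1 ρ ε * dot g g) * m.q1 ρ ε * dot ξ ξ
  dHess : ∀ ρ ε, (ρ, ε) ∈ D → ∀ (g e : V) (L H : T2), (∀ i j, L i j = L j i) →
    (∀ i j, H i j = H j i) → ∀ ξ : V,
    dot ξ (fderiv ℝ J (ρ, ε, g, L, e, H) (0, 0, 0, 0, 0, outer ξ)) = 0
  nonneg : ∀ ρ ε, (ρ, ε) ∈ D → ∀ (g e : V) (L H : T2), (∀ i j, L i j = L j i) →
    (∀ i j, H i j = H j i) →
    0 ≤ -ρ ^ 2 * (dRho m.s0 ρ ε + dRho m.s1 ρ ε * dot g g) * tr L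
      + (dEps m.s0 ρ ε + dEps m.s1 ρ ε * dot g g)
        * (ddot (m.stress (ρ, ε, g, L, e, H)) L - divHeatFlux m ρ ε g e H 0)
      - 2 * ρ * m.s1 ρ ε * ∑ i, g i * ∑ j, (g j * L j i + g i * L j j)
      + ∑ j, fderiv ℝ J (ρ, ε, g, L, e, H) (g j, e j, fun i => H i j, 0, 0, 0) j

theorem fluxConditions (hD : IsOpen D) (hDpos : ∀ z ∈ D, 0 < z.1) (hm : m.SmoothOn D)
    (hJ : ContDiffOn ℝ ∞ J (State.region D)) (hent : ExtendedEntropyPrinciple D m J)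
    (hs : ∀ ρ ε, (ρ, ε) ∈ D → m.s2 ρ ε = 0 ∧ m.s3 ρ ε = 0 ∧ m.s4 ρ ε = 0 ∧ m.s5 ρ ε = 0) :
    FluxConditions D m J := by
  have hsplit : ∀ (z : State) (a b : ℝ) (c : V) (S : T2) (w : V) (K : T2) (t : ℝ) (j : Fin 3),
      fderiv ℝ J z (a, b, c, t • S, t • w, t • K) j
      = fderiv ℝ J z (a, b, c, 0, 0, 0) j + t * fderiv ℝ J z (0, 0, 0, S, w, K) j := by
    intro z a b c S w K t j
    have h1 : ((a, b, c, t • S, t • w, t • K) : State)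
        = (a, b, c, 0, 0, 0) + t • (0, 0, 0, S, w, K) := by simp
    rw [h1, map_add, map_smul]
    rfl
  have hz : ∀ i j : Fin 3, (0 : T2) i j = (0 : T2) j i := fun _ _ => rfl
  have hz3 : ∀ i j k : Fin 3, (0 : Fin 3 → T2) i j k = (0 : Fin 3 → T2) i k j := fun _ _ _ => rfl
  have hc0 : (fun _ : Fin 3 => (0 : ℝ)) = (0 : V) := rfl
  have hT0 : (fun _ _ : Fin 3 => (0 : ℝ)) = (0 : T2) := rfl
  constructor
  · intro ρ ε h0 g e L H S hL hH hS i
    -- As with Christoffel symbols, second derivatives of the velocity are recovered from a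
    -- prescribed gradient of its symmetric part. This choice makes the derivative of `L` along axis
    -- `j` equal to `delta j i • S`, which isolates the single component `i` of the flux.
    set B : Fin 3 → T2 := fun a b k => S a b * delta k i + S a k * delta b i - S b k * delta a i
      with hB
    have hBs : ∀ a b k, B a b k = B a k b := by
      intro a b k; simp only [hB, hS k b]; ring
    have hBd : ∀ (t : ℝ) j, (fun a b => (t * B a b j + t * B b a j) / 2)
        = t • (delta j i • S) := by
      intro t j
      funext a b
      simp only [hB, Pi.smul_apply, smul_eq_mul, hS b a]; ring
    have key : ∀ t : ℝ, _ := fun t => jet_inequality hD hDpos hm hJ hent hs h0 g e 0 (L := L)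
      (H := H) (E := 0) (B := fun a b k => t * B a b k) 0 hL hH hz
      (fun a b k => by simp only [hBs a b k])
    simp only [hBd] at key
    have h1 := eq_zero_of_forall_affine_nonneg
      (c := -ρ ^ 2 * (dRho m.s0 ρ ε + dRho m.s1 ρ ε * dot g g) * tr L
      + (dEps m.s0 ρ ε + dEps m.s1 ρ ε * dot g g)
        * (ddot (m.stress (ρ, ε, g, L, e, H)) L - divHeatFlux m ρ ε g e H 0)
      - 2 * ρ * m.s1 ρ ε * ∑ i, g i * ∑ j, (g j * L j i + g i * L j j)
      + ∑ j, fderiv ℝ J (ρ, ε, g, L, e, H) (g j, e j, fun i => H i j, 0, 0, 0) j)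
      (d := -2 * ρ ^ 2 * m.s1 ρ ε * ∑ k, g k * ∑ j, B j j k
        + ∑ j, fderiv ℝ J (ρ, ε, g, L, e, H) (0, 0, 0, delta j i • S, 0, 0) j) (fun t => by
        refine (key t).trans_eq ?_
        have hfl : ∀ j, fderiv ℝ J (ρ, ε, g, L, e, H) (g j, e j, fun i => H i j,
            t • (delta j i • S), fun i => (0 : T2) i j,
            fun i k => 0 * ((0 : V) i * (0 : V) k * (0 : V) j)) j = _ := fun j => by
          have := hsplit (ρ, ε, g, L, e, H) (g j) (e j) (fun i => H i j) (delta j i • S) 0 0 t j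
          simpa [hc0, hT0] using this
        simp only [hfl, Fin.sum_univ_three]
        ring)
    have h2 : ∑ k, g k * ∑ j, B j j k = tr S * g i := by
      simp only [hB, tr, Fin.sum_univ_three]
      fin_cases i <;> simp [delta] <;> ring
    have h3 : ∑ j, fderiv ℝ J (ρ, ε, g, L, e, H) (0, 0, 0, delta j i • S, 0, 0) j
        = fderiv ℝ J (ρ, ε, g, L, e, H) (0, 0, 0, S, 0, 0) i := by
      rw [Finset.sum_eq_single i]
      · simp [delta]
      · intro j _ hj
        have : ((0, 0, 0, delta j i • S, 0, 0) : State) = 0 := by simp [delta, hj]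
        rw [this, map_zero]; rfl
      · simp
    rw [h2, h3] at h1
    linear_combination h1
  · intro ρ ε h0 g e L H hL hH ξ
    have hE : ∀ (t : ℝ) (i j : Fin 3), (t • outer ξ) i j = (t • outer ξ) j i := fun t i j => by
      simp [outer_symm ξ i j]
    have key : ∀ t : ℝ, _ := fun t => jet_inequality hD hDpos hm hJ hent hs h0 g e 0 (L := L)
      (H := H) (E := t • outer ξ) (B := 0) 0 hL hH (hE t) hz3
    have h1 := eq_zero_of_forall_affine_nonneg
      (c := -ρ ^ 2 * (dRho m.s0 ρ ε + dRho m.s1 ρ ε * dot g g) * tr L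
      + (dEps m.s0 ρ ε + dEps m.s1 ρ ε * dot g g)
        * (ddot (m.stress (ρ, ε, g, L, e, H)) L - divHeatFlux m ρ ε g e H 0)
      - 2 * ρ * m.s1 ρ ε * ∑ i, g i * ∑ j, (g j * L j i + g i * L j j)
      + ∑ j, fderiv ℝ J (ρ, ε, g, L, e, H) (g j, e j, fun i => H i j, 0, 0, 0) j)
      -- The Hessian `t • outer ξ` moves `∇ε` along axis `j` by `t ξ j • ξ`; summing over `j`
      -- produces the contraction with `ξ`. The same happens below with the cubic term and `outer
      -- ξ`.
      (d := -(dEps m.s0 ρ ε + dEps m.s1 ρ ε * dot g g) * m.q1 ρ ε * dot ξ ξ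
        + dot ξ (fderiv ℝ J (ρ, ε, g, L, e, H) (0, 0, 0, 0, ξ, 0))) (fun t => by
        refine (key t).trans_eq ?_
        have hfl : ∀ j, fderiv ℝ J (ρ, ε, g, L, e, H) (g j, e j, fun i => H i j,
            fun i k => ((0 : Fin 3 → T2) i k j + (0 : Fin 3 → T2) k i j) / 2,
            fun i => (t • outer ξ) i j, fun i k => 0 * ((0 : V) i * (0 : V) k * (0 : V) j)) j
            = fderiv ℝ J (ρ, ε, g, L, e, H) (g j, e j, fun i => H i j, 0, 0, 0) j
              + t * ξ j * fderiv ℝ J (ρ, ε, g, L, e, H) (0, 0, 0, 0, ξ, 0) j := fun j => by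
          have := hsplit (ρ, ε, g, L, e, H) (g j) (e j) (fun i => H i j) 0 ξ 0 (t * ξ j) j
          have hv : (fun i => t * (ξ i * ξ j)) = (t * ξ j) • ξ := by
            funext i; simp; ring
          simpa [hc0, hT0, outer, hv] using this
        rw [Finset.sum_congr rfl fun j _ => hfl j]
        simp only [Fin.sum_univ_three, divHeatFlux, dot, tr, Pi.smul_apply, smul_eq_mul,
          outer, Pi.zero_apply]
        ring)
    linear_combination h1
  · intro ρ ε h0 g e L H hL hH ξ
    have key : ∀ t : ℝ, _ := fun t => jet_inequality hD hDpos hm hJ hent hs h0 g e ξ (L := L)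
      (H := H) (E := 0) (B := 0) t hL hH hz hz3
    refine eq_zero_of_forall_affine_nonneg
      (c := -ρ ^ 2 * (dRho m.s0 ρ ε + dRho m.s1 ρ ε * dot g g) * tr L
      + (dEps m.s0 ρ ε + dEps m.s1 ρ ε * dot g g)
        * (ddot (m.stress (ρ, ε, g, L, e, H)) L - divHeatFlux m ρ ε g e H 0)
      - 2 * ρ * m.s1 ρ ε * ∑ i, g i * ∑ j, (g j * L j i + g i * L j j)
      + ∑ j, fderiv ℝ J (ρ, ε, g, L, e, H) (g j, e j, fun i => H i j, 0, 0, 0) j) (fun t => ?_)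
    refine (key t).trans_eq ?_
    have hfl : ∀ j, fderiv ℝ J (ρ, ε, g, L, e, H) (g j, e j, fun i => H i j,
        fun i k => ((0 : Fin 3 → T2) i k j + (0 : Fin 3 → T2) k i j) / 2,
        fun i => (0 : T2) i j, fun i k => t * (ξ i * ξ k * ξ j)) j
        = fderiv ℝ J (ρ, ε, g, L, e, H) (g j, e j, fun i => H i j, 0, 0, 0) j
          + t * ξ j * fderiv ℝ J (ρ, ε, g, L, e, H) (0, 0, 0, 0, 0, outer ξ) j := fun j => by
      have := hsplit (ρ, ε, g, L, e, H) (g j) (e j) (fun i => H i j) 0 0 (outer ξ) (t * ξ j) j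
      have hv : (fun i k => t * (ξ i * ξ k * ξ j)) = (t * ξ j) • outer ξ := by
        funext i k; simp [outer]; ring
      simpa [hc0, hT0, hv] using this
    rw [Finset.sum_congr rfl fun j _ => hfl j]
    simp only [Fin.sum_univ_three, dot, Pi.zero_apply]
    ring
  · intro ρ ε h0 g e L H hL hH
    refine (jet_inequality hD hDpos hm hJ hent hs h0 g e 0 (L := L)
      (H := H) (E := 0) (B := 0) 0 hL hH hz hz3).trans_eq ?_
    simp [hc0, hT0]

namespace FluxConditions

/-- The dependence of the flux on `L`. -/
theorem flux_L (hc : FluxConditions D m J) (hD : IsOpen D)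
    (hJ : ContDiffOn ℝ ∞ J (State.region D)) {ρ ε : ℝ} (h0 : (ρ, ε) ∈ D) (g e : V) {L H : T2}
    (hL : ∀ i j, L i j = L j i) (hH : ∀ i j, H i j = H j i) (i : Fin 3) :
    J (ρ, ε, g, L, e, H) i = J (ρ, ε, g, 0, e, H) i + 2 * ρ ^ 2 * m.s1 ρ ε * tr L * g i := by
  have hd : ∀ t : ℝ, HasDerivAt (fun t : ℝ => J (ρ, ε, g, t • L, e, H) i
      - t * (2 * ρ ^ 2 * m.s1 ρ ε * tr L * g i)) 0 t := by
    intro t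
    have hγ : HasDerivAt (fun t : ℝ => ((ρ, ε, g, t • L, e, H) : State)) (0, 0, 0, L, 0, 0) t := by
      refine (hasDerivAt_const t ρ).prodMk ((hasDerivAt_const t ε).prodMk
        ((hasDerivAt_const t g).prodMk (HasDerivAt.prodMk ?_
        ((hasDerivAt_const t e).prodMk (hasDerivAt_const t H)))))
      simpa using (hasDerivAt_id t).smul_const L
    have h1 := hasDerivAt_comp_flux hD hJ hγ h0 i
    rw [hc.dL ρ ε h0 g e (t • L) H L (fun i j => by simp [hL i j]) hH hL] at h1
    exact (h1.fun_sub ((hasDerivAt_id t).mul_const _)).congr_deriv (by simp)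
  have h1 := is_const_of_deriv_eq_zero (fun t => (hd t).differentiableAt) (fun t => (hd t).deriv) 1 0
  simp only [one_smul, zero_smul, one_mul, zero_mul, sub_zero] at h1
  linarith

/-- The component of the flux along `ξ` does not change in the direction `ξ ⊗ ξ` of `∇∇ρ`. -/
theorem flux_hess (hc : FluxConditions D m J) (hD : IsOpen D)
    (hJ : ContDiffOn ℝ ∞ J (State.region D)) {ρ ε : ℝ} (h0 : (ρ, ε) ∈ D) (g e : V) {H : T2}
    (hH : ∀ i j, H i j = H j i) (ξ : V) (t : ℝ) :
    dot ξ (J (ρ, ε, g, 0, e, H + t • outer ξ)) = dot ξ (J (ρ, ε, g, 0, e, H)) := by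
  have hd : ∀ t : ℝ, HasDerivAt (fun t : ℝ => dot ξ (J (ρ, ε, g, 0, e, H + t • outer ξ))) 0 t := by
    intro t
    have hγ : HasDerivAt (fun t : ℝ => ((ρ, ε, g, 0, e, H + t • outer ξ) : State))
        (0, 0, 0, 0, 0, outer ξ) t := by
      refine (hasDerivAt_const t ρ).prodMk ((hasDerivAt_const t ε).prodMk
        ((hasDerivAt_const t g).prodMk ((hasDerivAt_const t 0).prodMk
        ((hasDerivAt_const t e).prodMk ?_))))
      simpa using ((hasDerivAt_id t).smul_const (outer ξ)).const_add H
    have h1 := HasDerivAt.fun_sum fun i (_ : i ∈ Finset.univ) =>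
      (hasDerivAt_comp_flux hD hJ hγ h0 i).const_mul (ξ i)
    exact h1.congr_deriv (hc.dHess ρ ε h0 g e 0 _ (fun _ _ => rfl) (add_smul_outer_symm hH t ξ) ξ)
  have h1 := is_const_of_deriv_eq_zero (fun t => (hd t).differentiableAt) (fun t => (hd t).deriv) t 0
  simpa using h1

/-- The dependence on `∇ε` along `ξ` of the component of the flux along `ξ`. -/
theorem flux_gradEps (hc : FluxConditions D m J) (hD : IsOpen D)
    (hJ : ContDiffOn ℝ ∞ J (State.region D)) {ρ ε : ℝ} (h0 : (ρ, ε) ∈ D) (g e : V) {H : T2}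
    (hH : ∀ i j, H i j = H j i) (ξ : V) :
    dot ξ (J (ρ, ε, g, 0, e + ξ, H)) = dot ξ (J (ρ, ε, g, 0, e, H))
      + (dEps m.s0 ρ ε + dEps m.s1 ρ ε * dot g g) * m.q1 ρ ε * dot ξ ξ := by
  set c := (dEps m.s0 ρ ε + dEps m.s1 ρ ε * dot g g) * m.q1 ρ ε * dot ξ ξ
  have hd : ∀ t : ℝ,
      HasDerivAt (fun t : ℝ => dot ξ (J (ρ, ε, g, 0, e + t • ξ, H)) - t * c) 0 t := by
    intro t
    have hγ : HasDerivAt (fun t : ℝ => ((ρ, ε, g, 0, e + t • ξ, H) : State))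
        (0, 0, 0, 0, ξ, 0) t := by
      refine (hasDerivAt_const t ρ).prodMk ((hasDerivAt_const t ε).prodMk
        ((hasDerivAt_const t g).prodMk ((hasDerivAt_const t 0).prodMk
        (HasDerivAt.prodMk ?_ (hasDerivAt_const t H)))))
      simpa using ((hasDerivAt_id t).smul_const ξ).const_add e
    have h1 := HasDerivAt.fun_sum fun i (_ : i ∈ Finset.univ) =>
      (hasDerivAt_comp_flux hD hJ hγ h0 i).const_mul (ξ i)
    have h2 : HasDerivAt (fun t : ℝ => dot ξ (J (ρ, ε, g, 0, e + t • ξ, H))) c t :=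
      h1.congr_deriv (hc.dGradEps ρ ε h0 g (e + t • ξ) 0 H (fun _ _ => rfl) hH ξ)
    exact (h2.fun_sub ((hasDerivAt_id t).mul_const c)).congr_deriv (by simp)
  have h1 := is_const_of_deriv_eq_zero (fun t => (hd t).differentiableAt) (fun t => (hd t).deriv) 1 0
  simp only [one_smul, zero_smul, one_mul, zero_mul, sub_zero, add_zero] at h1
  linarith

end FluxConditions

end Extraction

/-! ### Functional and differential equations for the axial flux. -/

/-- A discrete argument, which needs no derivatives of `f`. Moving along `x ⊗ x`, `(x ± y) ⊗ (x ±
y)` and `y ⊗ y` preserves, respectively, the components along `x`, `x ± y` and `y`, and the linear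
relation among these four tensors links the invariances. -/
theorem second_difference {f : T2 → V}
    (hN : ∀ H, (∀ i j, H i j = H j i) → ∀ (ξ : V) (t : ℝ),
      dot ξ (f (H + t • outer ξ)) = dot ξ (f H)) {H : T2} (hH : ∀ i j, H i j = H j i)
    (x y : V) (v : ℝ) :
    dot x (f (H + (2 * v) • outer y)) - 2 * dot x (f (H + v • outer y)) + dot x (f H) = 0 := by
  set p : ℝ → ℝ → ℝ → T2 := fun r s t =>
    H + (v / 2 * r) • outer x + (v / 2 * s) • outer (x + y) + (v / 2 * t) • outer (x - y) with hp
  set c1 : ℝ → ℝ → ℝ → ℝ := fun r s t => dot x (f (p r s t)) with hc1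
  set c2 : ℝ → ℝ → ℝ → ℝ := fun r s t => dot y (f (p r s t)) with hc2
  have hps : ∀ r s t i j, p r s t i j = p r s t j i := by
    intro r s t i j
    simp only [hp, Pi.add_apply, Pi.smul_apply, smul_eq_mul, hH i j, outer_symm _ i j]
  have h1 : ∀ r s t, c1 r s t = c1 0 s t := by
    intro r s t
    have h := hN (p 0 s t) (hps _ _ _) x (v / 2 * r)
    have e : p 0 s t + (v / 2 * r) • outer x = p r s t := by
      simp only [hp]; funext i j; simp; ring
    rw [e] at h; exact h
  have hadd : ∀ w, dot (x + y) w = dot x w + dot y w := fun w => by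
    simp [dot, add_mul, Finset.sum_add_distrib]
  have hsub : ∀ w, dot (x - y) w = dot x w - dot y w := fun w => by
    simp [dot, sub_mul, Finset.sum_sub_distrib]
  have h2 : ∀ r s t, c1 r s t + c2 r s t = c1 r 0 t + c2 r 0 t := by
    intro r s t
    have h := hN (p r 0 t) (hps _ _ _) (x + y) (v / 2 * s)
    have e : p r 0 t + (v / 2 * s) • outer (x + y) = p r s t := by
      simp only [hp]; funext i j; simp; ring
    rw [e, hadd, hadd] at h; exact h
  have h3 : ∀ r s t, c1 r s t - c2 r s t = c1 r s 0 - c2 r s 0 := by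
    intro r s t
    have h := hN (p r s 0) (hps _ _ _) (x - y) (v / 2 * t)
    have e : p r s 0 + (v / 2 * t) • outer (x - y) = p r s t := by
      simp only [hp]; funext i j; simp
    rw [e, hsub, hsub] at h; exact h
  -- Since `(x + y) ⊗ (x + y) + (x - y) ⊗ (x - y) = 2 x ⊗ x + 2 y ⊗ y`, adding `v y ⊗ y` is the
  -- shift `(-2, 1, 1)` of the coordinates.
  have h4 : ∀ r s t, c2 (r - 2) (s + 1) (t + 1) = c2 r s t := by
    intro r s t
    have h := hN (p r s t) (hps _ _ _) y v
    have e : p r s t + v • outer y = p (r - 2) (s + 1) (t + 1) := by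
      simp only [hp]; funext i j; simp [outer]; ring
    rw [e] at h; exact h
  have e1 : p 0 0 0 = H := by simp [hp]
  have e2 : p (-2) 1 1 = H + v • outer y := by
    simp only [hp]; funext i j; simp [outer]; ring
  have e3 : p (-4) 2 2 = H + (2 * v) • outer y := by
    simp only [hp]; funext i j; simp [outer]; ring
  rw [← e2, ← e3, ← e1]
  change c1 (-4) 2 2 - 2 * c1 (-2) 1 1 + c1 0 0 0 = 0
  -- Here `s` is removed first and then `t`; in `h6` the order is reversed. Equating the two gives
  -- relations for `c1` alone, and `h4` connects the values of `c2` at `r = -2` and `r = 0`.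
  have h5 : ∀ r s t, c2 r s t = -c1 0 s t + 2 * c1 0 0 t - c1 0 0 0 + c2 r 0 0 := by
    intro r s t
    have := h2 r s t
    have := h3 r 0 t
    have := h1 r s t
    have := h1 r 0 t
    have := h1 r 0 0
    linarith
  have h6 : ∀ r s t, c2 r s t = c1 0 s t - 2 * c1 0 s 0 + c1 0 0 0 + c2 r 0 0 := by
    intro r s t
    have := h3 r s t
    have := h2 r s 0
    have := h1 r s t
    have := h1 r s 0
    have := h1 r 0 0
    linarith
  have i1 := h4 0 0 0
  have i2 := h4 0 0 1
  have i3 := h4 0 1 0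
  norm_num at i1 i2 i3
  rw [h1 (-4), h1 (-2)]
  linarith [h5 (-2) 1 1, h5 (-2) 1 2, h5 (-2) 2 1, h6 (-2) 1 1, h6 (-2) 1 2, h6 (-2) 2 1,
    h5 0 1 0, h5 0 0 1, h6 0 1 0, h6 0 0 1, h5 0 2 2, h6 0 2 2, h5 0 1 1, h6 0 1 1,
    h5 0 1 2, h6 0 1 2, h5 0 2 1, h6 0 2 1]

/-- Differentiation in `v` gives `φ'(x + 2v) = φ'(x + v)`; at `x = -y`, `v = y` this says that the
derivative is constant. -/
theorem affine_of_second_difference {φ : ℝ → ℝ} (hφ : Differentiable ℝ φ)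
    (h : ∀ x v, φ (x + 2 * v) - 2 * φ (x + v) + φ x = 0) (x : ℝ) :
    φ x = φ 0 + x * (φ 1 - φ 0) := by
  have hd : ∀ x v, deriv φ (x + 2 * v) = deriv φ (x + v) := by
    intro x v
    have h1 : HasDerivAt (fun v => φ (x + 2 * v) - 2 * φ (x + v) + φ x)
        (deriv φ (x + 2 * v) * 2 - 2 * (deriv φ (x + v) * 1)) v := by
      have a1 : HasDerivAt (fun v : ℝ => x + 2 * v) 2 v := by
        simpa using ((hasDerivAt_id v).const_mul (2 : ℝ)).const_add x
      have a2 : HasDerivAt (fun v : ℝ => x + v) 1 v := (hasDerivAt_id v).const_add x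
      exact (((hφ _).hasDerivAt.comp v a1).fun_sub
        (((hφ _).hasDerivAt.comp v a2).const_mul 2)).add_const _
    have h2 : (fun v => φ (x + 2 * v) - 2 * φ (x + v) + φ x) = fun _ => 0 := funext (h x)
    rw [h2] at h1
    have := h1.unique (hasDerivAt_const v 0)
    linarith
  have hc : ∀ y, deriv φ y = deriv φ 0 := by
    intro y
    have := hd (-y) y
    have e1 : -y + 2 * y = y := by ring
    have e2 : -y + y = 0 := by ring
    rwa [e1, e2] at this
  have hl : ∀ y, HasDerivAt (fun y => φ y - y * deriv φ 0) 0 y := fun y =>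
    ((hφ y).hasDerivAt.fun_sub ((hasDerivAt_id y).mul_const _)).congr_deriv (by rw [hc]; simp)
  have hk : ∀ y, φ y - y * deriv φ 0 = φ 0 := by
    intro y
    have := is_const_of_deriv_eq_zero (fun y => (hl y).differentiableAt) (fun y => (hl y).deriv) y 0
    simpa using this
  have h1 := hk x
  have h2 := hk 1
  linear_combination h1 - x * h2

/-- The integrating factor `x ^ (n + 1)` makes the product constant, and it vanishes at the origin.
The value `φ 0 = 0` also covers the derivative at the singular point. -/
theorem eq_zero_of_euler_ode {φ : ℝ → ℝ} (hφ : Differentiable ℝ φ) (n : ℕ) (h0 : φ 0 = 0)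
    (h : ∀ x, x ≠ 0 → deriv φ x + (n + 1) * φ x / x = 0) {x : ℝ} (hx : x ≠ 0) : φ x = 0 := by
  have hd : ∀ y, HasDerivAt (fun y => y ^ (n + 1) * φ y) 0 y := by
    intro y
    refine (((hasDerivAt_id y).fun_pow (n + 1)).fun_mul (hφ y).hasDerivAt).congr_deriv ?_
    by_cases hy : y = 0
    · simp [hy, h0]
    · have h1 := h y hy
      have h2 : deriv φ y = -((n + 1) * φ y / y) := by linarith
      rw [h2]
      simp only [id, Nat.add_sub_cancel]
      push_cast
      field_simp
      ring
  have h1 := is_const_of_deriv_eq_zero (fun y => (hd y).differentiableAt) (fun y => (hd y).deriv) x 0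
  simp only [h0, mul_zero] at h1
  exact (mul_eq_zero.1 h1).resolve_left (pow_ne_zero _ hx)

/-! ### The flux when `∇ρ` is an eigenvector of `∇∇ρ`. -/

section Axis

variable {D : Set (ℝ × ℝ)} {m : MaterialFunctions} {J : State → V}

/-- The states with `∇ρ = g`, `L = 0`, `∇ε = 0` and a diagonal tensor `∇∇ρ`. -/
def axisState (ρ ε : ℝ) (g : V) (a b c : ℝ) : State := (ρ, ε, g, 0, 0, diag a b c)

/-- The flux along `∇ρ`, when `∇ρ` is an eigenvector of `∇∇ρ`. -/
def axisFlux (J : State → V) (ρ ε γ b c : ℝ) : ℝ := J (axisState ρ ε (γ • axis 0) 0 b c) 0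

theorem actT_zero (Q : Matrix (Fin 3) (Fin 3) ℝ) : actT Q 0 = 0 := by
  funext i j; simp [actT]

theorem isotropic_axisState (hJiso : IsotropicVector D J) {ρ ε : ℝ} (h0 : (ρ, ε) ∈ D)
    {Q : Matrix (Fin 3) (Fin 3) ℝ} (hQ : Q ∈ Matrix.orthogonalGroup (Fin 3) ℝ) (g : V)
    {a b c a' b' c' : ℝ} (hd : actT Q (diag a b c) = diag a' b' c') :
    J (axisState ρ ε (actV Q g) a' b' c') = actV Q (J (axisState ρ ε g a b c)) := by
  have h := hJiso Q hQ (axisState ρ ε g a b c)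
    ⟨h0, fun _ _ => rfl, fun i j => diag_symm a b c i j⟩
  rw [← h]
  simp only [axisState, actState, State.rho, State.eps, State.gradRho, State.L, State.gradEps,
    State.hessRho, actT_zero, actV_zero, hd]

theorem flux_reflection (hJiso : IsotropicVector D J) {ρ ε : ℝ} (h0 : (ρ, ε) ∈ D) {x y z : ℝ}
    (hx : x * x = 1) (hy : y * y = 1) (hz : z * z = 1) {g : V}
    (hg : actV (reflection x y z) g = g) (a b c : ℝ) :
    actV (reflection x y z) (J (axisState ρ ε g a b c)) = J (axisState ρ ε g a b c) := by
  have h := isotropic_axisState hJiso h0 (reflection_mem hx hy hz) g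
    (actT_reflection_diag hx hy hz a b c)
  rw [hg] at h
  exact h.symm

theorem flux_axis_one (hJiso : IsotropicVector D J) {ρ ε : ℝ} (h0 : (ρ, ε) ∈ D)
    (γ a b c : ℝ) : J (axisState ρ ε (γ • axis 0) a b c) 1 = 0 := by
  have h := congrFun (flux_reflection hJiso h0 (x := 1) (y := -1) (z := 1) (by norm_num)
    (by norm_num) (by norm_num) (g := γ • axis 0) (by
      funext i; fin_cases i <;> simp [actV, reflection, axis, delta]) a b c) 1
  simp [actV, reflection, Fin.sum_univ_three] at h
  linarith

theorem flux_axis_two (hJiso : IsotropicVector D J) {ρ ε : ℝ} (h0 : (ρ, ε) ∈ D)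
    (γ a b c : ℝ) : J (axisState ρ ε (γ • axis 0) a b c) 2 = 0 := by
  have h := congrFun (flux_reflection hJiso h0 (x := 1) (y := 1) (z := -1) (by norm_num)
    (by norm_num) (by norm_num) (g := γ • axis 0) (by
      funext i; fin_cases i <;> simp [actV, reflection, axis, delta]) a b c) 2
  simp [actV, reflection, Fin.sum_univ_three] at h
  linarith

/-- At `∇ρ = 0` the reflection reversing the first axis fixes the state and changes the sign of this
component. -/
theorem axisFlux_zero (hJiso : IsotropicVector D J) {ρ ε : ℝ} (h0 : (ρ, ε) ∈ D)
    (b c : ℝ) : axisFlux J ρ ε 0 b c = 0 := by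
  have h := congrFun (flux_reflection hJiso h0 (x := -1) (y := 1) (z := 1) (by norm_num)
    (by norm_num) (by norm_num) (g := (0 : ℝ) • axis 0) (by
      funext i; simp [actV]) 0 b c) 0
  simp only [axisFlux]
  simp [actV, reflection, Fin.sum_univ_three] at h ⊢
  linarith

theorem diag_add_outer_one (a b c t : ℝ) :
    diag a b c + t • outer (axis 1) = diag a (b + t) c := by
  funext i j
  fin_cases i <;> fin_cases j <;> simp [diag, outer, axis, delta]

theorem diag_add_outer_two (a b c t : ℝ) :
    diag a b c + t • outer (axis 2) = diag a b (c + t) := by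
  funext i j
  fin_cases i <;> fin_cases j <;> simp [diag, outer, axis, delta]

theorem flux_diag_zero (hc : FluxConditions D m J) (hD : IsOpen D)
    (hJ : ContDiffOn ℝ ∞ J (State.region D)) {ρ ε : ℝ} (h0 : (ρ, ε) ∈ D) (g : V)
    (a a' b c : ℝ) : J (axisState ρ ε g a b c) 0 = J (axisState ρ ε g a' b c) 0 := by
  have h := hc.flux_hess hD hJ h0 g 0 (diag_symm a b c) (axis 0) (a' - a)
  rw [diag_add_outer, dot_axis, dot_axis, add_sub_cancel] at h
  exact h.symm

theorem flux_diag_one (hc : FluxConditions D m J) (hD : IsOpen D)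
    (hJ : ContDiffOn ℝ ∞ J (State.region D)) {ρ ε : ℝ} (h0 : (ρ, ε) ∈ D) (g : V)
    (a b b' c : ℝ) : J (axisState ρ ε g a b c) 1 = J (axisState ρ ε g a b' c) 1 := by
  have h := hc.flux_hess hD hJ h0 g 0 (diag_symm a b c) (axis 1) (b' - b)
  rw [diag_add_outer_one, dot_axis, dot_axis, add_sub_cancel] at h
  exact h.symm

theorem flux_diag_two (hc : FluxConditions D m J) (hD : IsOpen D)
    (hJ : ContDiffOn ℝ ∞ J (State.region D)) {ρ ε : ℝ} (h0 : (ρ, ε) ∈ D) (g : V)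
    (a b c c' : ℝ) : J (axisState ρ ε g a b c) 2 = J (axisState ρ ε g a b c') 2 := by
  have h := hc.flux_hess hD hJ h0 g 0 (diag_symm a b c) (axis 2) (c' - c)
  rw [diag_add_outer_two, dot_axis, dot_axis, add_sub_cancel] at h
  exact h.symm

theorem hasDerivAt_axisState {r : ℝ → ℝ} {g : ℝ → V} {r' s : ℝ} {g' : V} (ε a : ℝ)
    (b c : ℝ) (hr : HasDerivAt r r' s) (hg : HasDerivAt g g' s) :
    HasDerivAt (fun s => axisState (r s) ε (g s) a b c) (r', 0, g', 0, 0, 0) s :=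
  hr.prodMk ((hasDerivAt_const s ε).prodMk (hg.prodMk ((hasDerivAt_const s 0).prodMk
    ((hasDerivAt_const s 0).prodMk (hasDerivAt_const s _)))))

/-- Transverse changes of `∇ρ` are infinitesimal rotations. The second component ignores the second
eigenvalue, so that eigenvalue may be replaced by `a`; the tensor is then invariant, and isotropy
expresses the component as `sin θ` times the axial flux. -/
theorem fderiv_flux_axis_one (hc : FluxConditions D m J) (hD : IsOpen D)
    (hJ : ContDiffOn ℝ ∞ J (State.region D)) (hJiso : IsotropicVector D J) {ρ ε : ℝ}
    (h0 : (ρ, ε) ∈ D) (γ a b c : ℝ) :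
    fderiv ℝ J (axisState ρ ε (γ • axis 0) a b c) (0, 0, γ • axis 1, 0, 0, 0) 1
      = axisFlux J ρ ε γ a c := by
  have hg : HasDerivAt (fun θ : ℝ => actV (rot01 (Real.cos θ) (-Real.sin θ)) (γ • axis 0))
      (γ • axis 1) 0 := by
    have h1 : (fun θ : ℝ => actV (rot01 (Real.cos θ) (-Real.sin θ)) (γ • axis 0))
        = fun θ => Real.cos θ • (γ • axis 0) + Real.sin θ • (γ • axis 1) := by
      funext θ i
      fin_cases i <;> simp [actV, rot01, axis, delta]
    rw [h1]
    simpa using ((Real.hasDerivAt_cos 0).smul_const (γ • axis 0)).fun_add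
      ((Real.hasDerivAt_sin 0).smul_const (γ • axis 1))
  have hg0 : actV (rot01 (Real.cos 0) (-Real.sin 0)) (γ • axis 0) = γ • axis 0 := by
    funext i
    fin_cases i <;> simp [actV, rot01, axis, delta]
  have h1 := hasDerivAt_comp_flux hD hJ (hasDerivAt_axisState (r := fun _ => ρ)
    ε a b c (hasDerivAt_const (0 : ℝ) ρ) hg) h0 1
  rw [hg0] at h1
  refine h1.unique ?_
  have h2 : ∀ θ : ℝ, J (axisState ρ ε (actV (rot01 (Real.cos θ) (-Real.sin θ)) (γ • axis 0)) a b c) 1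
      = Real.sin θ * axisFlux J ρ ε γ a c := by
    intro θ
    have hθ : Real.cos θ ^ 2 + (-Real.sin θ) ^ 2 = 1 := by
      rw [neg_sq]; exact Real.cos_sq_add_sin_sq θ
    rw [flux_diag_one hc hD hJ h0 _ a b a c, isotropic_axisState hJiso h0 (rot01_mem hθ) _
      (actT_rot01_diag hθ a c), axisFlux, flux_diag_zero hc hD hJ h0 _ 0 a]
    simp [actV, rot01, Fin.sum_univ_three, flux_axis_one hJiso h0]
  simp only [h2]
  simpa using (Real.hasDerivAt_sin 0).mul_const (axisFlux J ρ ε γ a c)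

theorem fderiv_flux_axis_two (hc : FluxConditions D m J) (hD : IsOpen D)
    (hJ : ContDiffOn ℝ ∞ J (State.region D)) (hJiso : IsotropicVector D J) {ρ ε : ℝ}
    (h0 : (ρ, ε) ∈ D) (γ a b c : ℝ) :
    fderiv ℝ J (axisState ρ ε (γ • axis 0) a b c) (0, 0, γ • axis 2, 0, 0, 0) 2
      = axisFlux J ρ ε γ b a := by
  have hg : HasDerivAt (fun θ : ℝ => actV (rot02 (Real.cos θ) (-Real.sin θ)) (γ • axis 0))
      (γ • axis 2) 0 := by
    have h1 : (fun θ : ℝ => actV (rot02 (Real.cos θ) (-Real.sin θ)) (γ • axis 0))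
        = fun θ => Real.cos θ • (γ • axis 0) + Real.sin θ • (γ • axis 2) := by
      funext θ i
      fin_cases i <;> simp [actV, rot02, axis, delta]
    rw [h1]
    simpa using ((Real.hasDerivAt_cos 0).smul_const (γ • axis 0)).fun_add
      ((Real.hasDerivAt_sin 0).smul_const (γ • axis 2))
  have hg0 : actV (rot02 (Real.cos 0) (-Real.sin 0)) (γ • axis 0) = γ • axis 0 := by
    funext i
    fin_cases i <;> simp [actV, rot02, axis, delta]
  have h1 := hasDerivAt_comp_flux hD hJ (hasDerivAt_axisState (r := fun _ => ρ)
    ε a b c (hasDerivAt_const (0 : ℝ) ρ) hg) h0 2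
  rw [hg0] at h1
  refine h1.unique ?_
  have h2 : ∀ θ : ℝ, J (axisState ρ ε (actV (rot02 (Real.cos θ) (-Real.sin θ)) (γ • axis 0)) a b c) 2
      = Real.sin θ * axisFlux J ρ ε γ b a := by
    intro θ
    have hθ : Real.cos θ ^ 2 + (-Real.sin θ) ^ 2 = 1 := by
      rw [neg_sq]; exact Real.cos_sq_add_sin_sq θ
    rw [flux_diag_two hc hD hJ h0 _ a b c a, isotropic_axisState hJiso h0 (rot02_mem hθ) _
      (actT_rot02_diag hθ a b), axisFlux, flux_diag_zero hc hD hJ h0 _ 0 a]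
    simp [actV, rot02, Fin.sum_univ_three, flux_axis_two hJiso h0]
  simp only [h2]
  simpa using (Real.hasDerivAt_sin 0).mul_const (axisFlux J ρ ε γ b a)

theorem hasDerivAt_axisFlux_gamma (hc : FluxConditions D m J) (hD : IsOpen D)
    (hJ : ContDiffOn ℝ ∞ J (State.region D)) {ρ ε : ℝ} (h0 : (ρ, ε) ∈ D) (γ a b c : ℝ) :
    HasDerivAt (fun γ => axisFlux J ρ ε γ b c)
      (fderiv ℝ J (axisState ρ ε (γ • axis 0) a b c) (0, 0, axis 0, 0, 0, 0) 0) γ := by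
  have hg : HasDerivAt (fun γ : ℝ => γ • axis 0) (axis 0) γ := by
    simpa using (hasDerivAt_id γ).smul_const (axis 0)
  have h1 := hasDerivAt_comp_flux hD hJ (hasDerivAt_axisState (r := fun _ => ρ)
    ε a b c (hasDerivAt_const γ ρ) hg) h0 0
  have h2 : (fun γ => axisFlux J ρ ε γ b c)
      = fun γ => J (axisState ρ ε (γ • axis 0) a b c) 0 := by
    funext γ
    exact flux_diag_zero hc hD hJ h0 _ 0 a b c
  rw [h2]; exact h1

theorem hasDerivAt_axisFlux_rho (hc : FluxConditions D m J) (hD : IsOpen D)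
    (hJ : ContDiffOn ℝ ∞ J (State.region D)) {ρ ε : ℝ} (h0 : (ρ, ε) ∈ D) (γ a b c : ℝ) :
    HasDerivAt (fun ρ => axisFlux J ρ ε γ b c)
      (fderiv ℝ J (axisState ρ ε (γ • axis 0) a b c) (1, 0, 0, 0, 0, 0) 0) ρ := by
  have h1 := hasDerivAt_comp_flux hD hJ (hasDerivAt_axisState (r := id)
    ε a b c (hasDerivAt_id ρ) (hasDerivAt_const ρ (γ • axis 0))) h0 0
  have hnear : ∀ᶠ r in nhds ρ, (r, ε) ∈ D :=
    (by fun_prop : Continuous fun r : ℝ => (r, ε)).continuousAt.preimage_mem_nhds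
      (hD.mem_nhds h0)
  refine h1.congr_of_eventuallyEq ?_
  filter_upwards [hnear] with r hr
  exact flux_diag_zero hc hD hJ hr _ 0 a b c

/-- The residual inequality at `L = 0`, `∇ε = 0`. The transverse derivatives of the flux are
replaced by its values divided by `γ`, which leaves an inequality for `axisFlux` alone. -/
theorem axis_inequality (hc : FluxConditions D m J) (hD : IsOpen D)
    (hJ : ContDiffOn ℝ ∞ J (State.region D)) (hJiso : IsotropicVector D J) {ρ ε : ℝ}
    (h0 : (ρ, ε) ∈ D) {γ : ℝ} (hγ : γ ≠ 0) (a b c : ℝ) :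
    0 ≤ -(dEps m.s0 ρ ε + dEps m.s1 ρ ε * γ ^ 2)
          * (m.q2 ρ ε * (a + b + c) + dRho m.q2 ρ ε * γ ^ 2)
      + γ * deriv (fun r => axisFlux J r ε γ b c) ρ
      + a * deriv (fun γ => axisFlux J ρ ε γ b c) γ
      + b * (axisFlux J ρ ε γ a c / γ) + c * (axisFlux J ρ ε γ b a / γ) := by
  have h := hc.nonneg ρ ε h0 (γ • axis 0) 0 0 (diag a b c) (fun _ _ => rfl) (diag_symm a b c)
  have e1 := (hasDerivAt_axisFlux_rho hc hD hJ h0 γ a b c).deriv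
  have e2 := (hasDerivAt_axisFlux_gamma hc hD hJ h0 γ a b c).deriv
  have e3 := fderiv_flux_axis_one hc hD hJ hJiso h0 γ a b c
  have e4 := fderiv_flux_axis_two hc hD hJ hJiso h0 γ a b c
  rw [e1, e2, ← e3, ← e4]
  set F := fderiv ℝ J (axisState ρ ε (γ • axis 0) a b c) with hF
  have f0 : ((γ, 0, a • axis 0, 0, 0, 0) : State)
      = γ • (1, 0, 0, 0, 0, 0) + a • (0, 0, axis 0, 0, 0, 0) := by simp
  have f1 : ∀ x : ℝ, ((0, 0, x • axis 1, 0, 0, 0) : State) = (x / γ) • (0, 0, γ • axis 1, 0, 0, 0) := by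
    intro x
    simp [smul_smul, div_mul_cancel₀ _ hγ]
  have f2 : ∀ x : ℝ, ((0, 0, x • axis 2, 0, 0, 0) : State) = (x / γ) • (0, 0, γ • axis 2, 0, 0, 0) := by
    intro x
    simp [smul_smul, div_mul_cancel₀ _ hγ]
  have k0 : (fun i => diag a b c i 0) = a • axis 0 := by
    funext i; fin_cases i <;> simp [diag, axis, delta]
  have k1 : (fun i => diag a b c i 1) = b • axis 1 := by
    funext i; fin_cases i <;> simp [diag, axis, delta]
  have k2 : (fun i => diag a b c i 2) = c • axis 2 := by
    funext i; fin_cases i <;> simp [diag, axis, delta]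
  have g0 : (γ • axis 0 : V) 0 = γ ∧ (γ • axis 0 : V) 1 = 0 ∧ (γ • axis 0 : V) 2 = 0 := by
    simp [axis, delta]
  have hFz : fderiv ℝ J (ρ, ε, γ • axis 0, 0, 0, diag a b c) = F := rfl
  rw [hFz] at h
  simp only [Fin.sum_univ_three, k0, k1, k2, g0.1, g0.2.1, g0.2.2, Pi.zero_apply] at h
  rw [f0, f1, f2, map_add, map_smul, map_smul, map_smul, map_smul] at h
  refine h.trans_eq ?_
  have hq : divHeatFlux m ρ ε (γ • axis 0) 0 (diag a b c) 0
      = m.q2 ρ ε * (a + b + c) + dRho m.q2 ρ ε * γ ^ 2 := by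
    have q1 : tr (diag a b c) = a + b + c := by simp [tr, diag, Fin.sum_univ_three]
    have q2 : dot (γ • axis 0) (γ • axis 0) = γ ^ 2 := by simp [dot, axis, delta]; ring
    have q3 : ∀ w, dot w 0 = 0 := fun w => by simp [dot]
    have q4 : tr 0 = 0 := by simp [tr]
    rw [divHeatFlux, q1, q2, q3, q3, q4]
    ring
  have hgg : dot (γ • axis 0) (γ • axis 0) = γ ^ 2 := by
    simp [dot, axis, delta]; ring
  have ht : tr 0 = 0 := by simp [tr]
  have hdd : ∀ T : T2, ddot T 0 = 0 := fun T => by simp [ddot]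
  rw [hq, hgg, ht, hdd]
  simp only [Pi.add_apply, Pi.smul_apply, smul_eq_mul]
  field_simp
  ring

end Axis

/-! ### Determination of the entropy flux. -/

section AxisFlux

variable {D : Set (ℝ × ℝ)} {m : MaterialFunctions} {J : State → V}

theorem differentiable_comp_flux (hD : IsOpen D) (hJ : ContDiffOn ℝ ∞ J (State.region D))
    {γ : ℝ → State} (hγ : Differentiable ℝ γ) (h : ∀ s, γ s ∈ State.region D) (i : Fin 3) :
    Differentiable ℝ fun s => J (γ s) i :=
  fun s => (hasDerivAt_comp_flux hD hJ (hγ s).hasDerivAt (h s) i).differentiableAt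

theorem axisFlux_affine_one (hc : FluxConditions D m J) (hD : IsOpen D)
    (hJ : ContDiffOn ℝ ∞ J (State.region D)) {ρ ε : ℝ} (h0 : (ρ, ε) ∈ D) (γ b c : ℝ) :
    axisFlux J ρ ε γ b c
      = axisFlux J ρ ε γ 0 c + b * (axisFlux J ρ ε γ 1 c - axisFlux J ρ ε γ 0 c) := by
  refine affine_of_second_difference (φ := fun b => axisFlux J ρ ε γ b c) ?_ (fun x v => ?_) b
  · refine differentiable_comp_flux hD hJ (γ := fun b => axisState ρ ε (γ • axis 0) 0 b c)
      ?_ (fun _ => h0) 0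
    have h1 : (fun b => axisState ρ ε (γ • axis 0) 0 b c)
        = fun b => (ρ, ε, γ • axis 0, 0, 0, diag 0 0 c + b • outer (axis 1)) := by
      funext b
      rw [diag_add_outer_one, zero_add]; rfl
    rw [h1]
    fun_prop
  · have h := second_difference (f := fun H => J (ρ, ε, γ • axis 0, 0, 0, H))
      (fun H hH ξ t => hc.flux_hess hD hJ h0 _ 0 hH ξ t) (diag_symm 0 x c) (axis 0) (axis 1) v
    simp only [diag_add_outer_one, dot_axis] at h
    exact h

theorem axisFlux_affine_two (hc : FluxConditions D m J) (hD : IsOpen D)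
    (hJ : ContDiffOn ℝ ∞ J (State.region D)) {ρ ε : ℝ} (h0 : (ρ, ε) ∈ D) (γ b c : ℝ) :
    axisFlux J ρ ε γ b c
      = axisFlux J ρ ε γ b 0 + c * (axisFlux J ρ ε γ b 1 - axisFlux J ρ ε γ b 0) := by
  refine affine_of_second_difference (φ := fun c => axisFlux J ρ ε γ b c) ?_ (fun x v => ?_) c
  · refine differentiable_comp_flux hD hJ (γ := fun c => axisState ρ ε (γ • axis 0) 0 b c)
      ?_ (fun _ => h0) 0
    have h1 : (fun c => axisState ρ ε (γ • axis 0) 0 b c)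
        = fun c => (ρ, ε, γ • axis 0, 0, 0, diag 0 b 0 + c • outer (axis 2)) := by
      funext c
      rw [diag_add_outer_two, zero_add]; rfl
    rw [h1]
    fun_prop
  · have h := second_difference (f := fun H => J (ρ, ε, γ • axis 0, 0, 0, H))
      (fun H hH ξ t => hc.flux_hess hD hJ h0 _ 0 hH ξ t) (diag_symm 0 b x) (axis 0) (axis 2) v
    simp only [diag_add_outer_two, dot_axis] at h
    exact h

/-- The axial eigenvalue `a` occurs explicitly and inside the transverse fluxes. The latter are
affine in it, so the whole inequality is affine in `a`, and its coefficient vanishes. -/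
theorem deriv_axisFlux (hc : FluxConditions D m J) (hD : IsOpen D)
    (hJ : ContDiffOn ℝ ∞ J (State.region D)) (hJiso : IsotropicVector D J) {ρ ε : ℝ}
    (h0 : (ρ, ε) ∈ D) {γ : ℝ} (hγ : γ ≠ 0) (b c : ℝ) :
    deriv (fun γ => axisFlux J ρ ε γ b c) γ
      + (b * (axisFlux J ρ ε γ 1 c - axisFlux J ρ ε γ 0 c)
        + c * (axisFlux J ρ ε γ b 1 - axisFlux J ρ ε γ b 0)) / γ
      = (dEps m.s0 ρ ε + dEps m.s1 ρ ε * γ ^ 2) * m.q2 ρ ε := by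
  rw [← sub_eq_zero]
  refine eq_zero_of_forall_affine_nonneg
    (c := -(dEps m.s0 ρ ε + dEps m.s1 ρ ε * γ ^ 2)
          * (m.q2 ρ ε * (b + c) + dRho m.q2 ρ ε * γ ^ 2)
      + γ * deriv (fun r => axisFlux J r ε γ b c) ρ
      + b * (axisFlux J ρ ε γ 0 c / γ) + c * (axisFlux J ρ ε γ b 0 / γ)) fun a => ?_
  refine (axis_inequality hc hD hJ hJiso h0 hγ a b c).trans_eq ?_
  rw [axisFlux_affine_one hc hD hJ h0 γ a c, axisFlux_affine_two hc hD hJ h0 γ b a]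
  ring

theorem differentiable_axisFlux (hc : FluxConditions D m J) (hD : IsOpen D)
    (hJ : ContDiffOn ℝ ∞ J (State.region D)) {ρ ε : ℝ} (h0 : (ρ, ε) ∈ D) (b c : ℝ) :
    Differentiable ℝ fun γ => axisFlux J ρ ε γ b c :=
  fun γ => (hasDerivAt_axisFlux_gamma hc hD hJ h0 γ 0 b c).differentiableAt

theorem axisFlux_const (hc : FluxConditions D m J) (hD : IsOpen D)
    (hJ : ContDiffOn ℝ ∞ J (State.region D)) (hJiso : IsotropicVector D J) {ρ ε : ℝ}
    (h0 : (ρ, ε) ∈ D) {γ : ℝ} (hγ : γ ≠ 0) (b c : ℝ) :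
    axisFlux J ρ ε γ b c = axisFlux J ρ ε γ 0 0 := by
  have hd : ∀ b c, Differentiable ℝ fun γ => axisFlux J ρ ε γ b c :=
    fun b c => differentiable_axisFlux hc hD hJ h0 b c
  have hz : ∀ b c, axisFlux J ρ ε 0 b c = 0 := fun b c => axisFlux_zero hJiso h0 b c
  have h1 : axisFlux J ρ ε γ 1 0 - axisFlux J ρ ε γ 0 0 = 0 := by
    refine eq_zero_of_euler_ode (φ := fun γ => axisFlux J ρ ε γ 1 0 - axisFlux J ρ ε γ 0 0)
      ((hd 1 0).fun_sub (hd 0 0)) 0 (by simp [hz]) (fun x hx => ?_) hγ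
    have e1 := deriv_axisFlux hc hD hJ hJiso h0 hx 1 0
    have e2 := deriv_axisFlux hc hD hJ hJiso h0 hx 0 0
    rw [deriv_fun_sub (hd 1 0 x) (hd 0 0 x)]
    push_cast
    linear_combination e1 - e2
  have h2 : axisFlux J ρ ε γ 0 1 - axisFlux J ρ ε γ 0 0 = 0 := by
    refine eq_zero_of_euler_ode (φ := fun γ => axisFlux J ρ ε γ 0 1 - axisFlux J ρ ε γ 0 0)
      ((hd 0 1).fun_sub (hd 0 0)) 0 (by simp [hz]) (fun x hx => ?_) hγ
    have e1 := deriv_axisFlux hc hD hJ hJiso h0 hx 0 1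
    have e2 := deriv_axisFlux hc hD hJ hJiso h0 hx 0 0
    rw [deriv_fun_sub (hd 0 1 x) (hd 0 0 x)]
    push_cast
    linear_combination e1 - e2
  -- The flux is affine in `b` and in `c`, hence given by its four values at 0 and 1. The mixed
  -- difference satisfies the Euler equation with exponent two, receiving one contribution from each
  -- eigenvalue.
  have h3 : axisFlux J ρ ε γ 1 1 - axisFlux J ρ ε γ 1 0
      - (axisFlux J ρ ε γ 0 1 - axisFlux J ρ ε γ 0 0) = 0 := by
    refine eq_zero_of_euler_ode (φ := fun γ => axisFlux J ρ ε γ 1 1 - axisFlux J ρ ε γ 1 0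
      - (axisFlux J ρ ε γ 0 1 - axisFlux J ρ ε γ 0 0))
      (((hd 1 1).fun_sub (hd 1 0)).fun_sub ((hd 0 1).fun_sub (hd 0 0))) 1 (by simp [hz])
      (fun x hx => ?_) hγ
    have e1 := deriv_axisFlux hc hD hJ hJiso h0 hx 1 1
    have e2 := deriv_axisFlux hc hD hJ hJiso h0 hx 1 0
    have e3 := deriv_axisFlux hc hD hJ hJiso h0 hx 0 1
    have e4 := deriv_axisFlux hc hD hJ hJiso h0 hx 0 0
    rw [deriv_fun_sub ((hd 1 1).fun_sub (hd 1 0) x) ((hd 0 1).fun_sub (hd 0 0) x),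
      deriv_fun_sub (hd 1 1 x) (hd 1 0 x), deriv_fun_sub (hd 0 1 x) (hd 0 0 x)]
    push_cast
    linear_combination e1 - e2 - e3 + e4
  rw [axisFlux_affine_one hc hD hJ h0 γ b c, axisFlux_affine_two hc hD hJ h0 γ 0 c,
    axisFlux_affine_two hc hD hJ h0 γ 1 c]
  linear_combination c * (1 - b) * h2 + b * h1 + b * c * (h3 + h2)

theorem axisFlux_eq (hc : FluxConditions D m J) (hD : IsOpen D)
    (hJ : ContDiffOn ℝ ∞ J (State.region D)) (hJiso : IsotropicVector D J) {ρ ε : ℝ}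
    (h0 : (ρ, ε) ∈ D) (γ b c : ℝ) :
    axisFlux J ρ ε γ b c
      = (dEps m.s0 ρ ε + dEps m.s1 ρ ε * γ ^ 2) * (m.q2 ρ ε * γ) := by
  by_cases hγ : γ = 0
  · rw [hγ, axisFlux_zero hJiso h0]; ring
  rw [axisFlux_const hc hD hJ hJiso h0 hγ]
  have hnear : ∀ᶠ r in nhds ρ, (r, ε) ∈ D :=
    (by fun_prop : Continuous fun r : ℝ => (r, ε)).continuousAt.preimage_mem_nhds
      (hD.mem_nhds h0)
  -- Now that the flux does not depend on the eigenvalues, the inequality is affine in the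
  -- transverse eigenvalue `b`; its coefficient gives the value of the flux with no further
  -- integration.
  have h1 : -(dEps m.s0 ρ ε + dEps m.s1 ρ ε * γ ^ 2) * m.q2 ρ ε
      + axisFlux J ρ ε γ 0 0 / γ = 0 := by
    refine eq_zero_of_forall_affine_nonneg
      (c := -(dEps m.s0 ρ ε + dEps m.s1 ρ ε * γ ^ 2) * (dRho m.q2 ρ ε * γ ^ 2)
        + γ * deriv (fun r => axisFlux J r ε γ 0 0) ρ) fun b => ?_
    have h2 : deriv (fun r => axisFlux J r ε γ b 0) ρ
        = deriv (fun r => axisFlux J r ε γ 0 0) ρ := by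
      refine Filter.EventuallyEq.deriv_eq ?_
      filter_upwards [hnear] with r hr
      exact axisFlux_const hc hD hJ hJiso hr hγ b 0
    refine (axis_inequality hc hD hJ hJiso h0 hγ 0 b 0).trans_eq ?_
    rw [h2]
    ring
  field_simp at h1
  linear_combination h1

theorem dot_actV {Q : Matrix (Fin 3) (Fin 3) ℝ} (hQ : Q ∈ Matrix.orthogonalGroup (Fin 3) ℝ)
    (a : V) : dot (actV Q a) (actV Q a) = dot a a := by
  have h1 : Q.transpose * Q = 1 := (Matrix.mem_orthogonalGroup_iff' (Fin 3) ℝ).1 hQ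
  have h2 : actV Q a = Q.mulVec a := rfl
  have h3 : ∀ x y, dot x y = dotProduct x y := fun _ _ => rfl
  rw [h3, h3, h2, Matrix.dotProduct_mulVec, Matrix.vecMul_mulVec, h1, Matrix.vecMul_one]

/-- Subtraction of the expected flux makes the prescribed increments along `∇ε` zero and, by
`axisFlux_eq`, cancels the axial values. -/
theorem isotropicNull_flux (hc : FluxConditions D m J) (hD : IsOpen D)
    (hJ : ContDiffOn ℝ ∞ J (State.region D)) (hJiso : IsotropicVector D J) {ρ ε : ℝ}
    (h0 : (ρ, ε) ∈ D) : IsotropicNull fun g e H i => J (ρ, ε, g, 0, e, H) i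
      - (dEps m.s0 ρ ε + dEps m.s1 ρ ε * dot g g) * (m.q1 ρ ε * e i + m.q2 ρ ε * g i) where
  iso Q hQ g e H hH := by
    have h := hJiso Q hQ (ρ, ε, g, 0, e, H) ⟨h0, fun _ _ => rfl, hH⟩
    simp only [actState, State.rho, State.eps, State.gradRho, State.L, State.gradEps,
      State.hessRho, actT_zero] at h
    funext i
    rw [h, dot_actV hQ]
    simp only [actV, Fin.sum_univ_three]
    ring
  hess g e H hH ξ t := by
    have h := hc.flux_hess hD hJ h0 g e hH ξ t
    simp only [dot, Fin.sum_univ_three] at h ⊢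
    linear_combination h
  grad g e H hH ξ := by
    have h := hc.flux_gradEps hD hJ h0 g e hH ξ
    simp only [dot, Fin.sum_univ_three, Pi.add_apply] at h ⊢
    linear_combination h
  eigen γ a b c := by
    have h1 := flux_diag_zero hc hD hJ h0 (γ • axis 0) a 0 b c
    have h2 := axisFlux_eq hc hD hJ hJiso h0 γ b c
    have h3 : dot (γ • axis 0) (γ • axis 0) = γ ^ 2 := by simp [dot, axis, delta]; ring
    have h4 : (γ • axis 0 : V) 0 = γ := by simp [axis, delta]
    have h5 : J (ρ, ε, γ • axis 0, 0, 0, diag a b c) 0 = axisFlux J ρ ε γ b c := h1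
    rw [h5, h2, h3, h4, Pi.zero_apply]
    ring

/-- The flux is determined by the other material functions. -/
theorem flux_eq (hc : FluxConditions D m J) (hD : IsOpen D)
    (hJ : ContDiffOn ℝ ∞ J (State.region D)) (hJiso : IsotropicVector D J) {ρ ε : ℝ}
    (h0 : (ρ, ε) ∈ D) (g e : V) {L H : T2} (hL : ∀ i j, L i j = L j i)
    (hH : ∀ i j, H i j = H j i) (i : Fin 3) :
    J (ρ, ε, g, L, e, H) i
      = (dEps m.s0 ρ ε + dEps m.s1 ρ ε * dot g g) * (m.q1 ρ ε * e i + m.q2 ρ ε * g i)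
        + 2 * ρ ^ 2 * m.s1 ρ ε * tr L * g i := by
  have h1 := hc.flux_L hD hJ h0 g e hL hH i
  have h2 := congrFun ((isotropicNull_flux hc hD hJ hJiso h0).eq_zero g e hH) i
  simp only [Pi.zero_apply] at h2
  linear_combination h1 + h2

end AxisFlux

/-! ### Relations for the pressure and the stress coefficients. -/

section Residual

variable {D : Set (ℝ × ℝ)} {m : MaterialFunctions} {J : State → V}

theorem hasDerivAt_add_mul (x y : ℝ) : HasDerivAt (fun s : ℝ => x + s * y) y 0 := by
  simpa using ((hasDerivAt_id (0 : ℝ)).mul_const y).const_add x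

theorem hasDerivAt_dot_add_smul (g w : V) :
    HasDerivAt (fun s : ℝ => dot (g + s • w) (g + s • w)) (2 * dot g w) 0 := by
  have h := HasDerivAt.fun_sum fun i (_ : i ∈ Finset.univ) =>
    (hasDerivAt_add_mul (g i) (w i)).fun_mul (hasDerivAt_add_mul (g i) (w i))
  refine h.congr_deriv ?_
  simp only [dot, Fin.sum_univ_three]
  ring

/-- The derivative of the flux along `(ρ, ε, ∇ρ)`. -/
theorem fderiv_flux (hc : FluxConditions D m J) (hD : IsOpen D) (hm : m.SmoothOn D)
    (hJ : ContDiffOn ℝ ∞ J (State.region D)) (hJiso : IsotropicVector D J) {ρ ε : ℝ}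
    (h0 : (ρ, ε) ∈ D) (g e : V) {L H : T2} (hL : ∀ i j, L i j = L j i)
    (hH : ∀ i j, H i j = H j i) (a b : ℝ) (w : V) (i : Fin 3) :
    fderiv ℝ J (ρ, ε, g, L, e, H) (a, b, w, 0, 0, 0) i
      = (dRho (dEps m.s0) ρ ε * a + dEps (dEps m.s0) ρ ε * b
          + (dRho (dEps m.s1) ρ ε * a + dEps (dEps m.s1) ρ ε * b) * dot g g
          + dEps m.s1 ρ ε * (2 * dot g w)) * (m.q1 ρ ε * e i + m.q2 ρ ε * g i)
        + (dEps m.s0 ρ ε + dEps m.s1 ρ ε * dot g g)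
          * ((dRho m.q1 ρ ε * a + dEps m.q1 ρ ε * b) * e i
            + (dRho m.q2 ρ ε * a + dEps m.q2 ρ ε * b) * g i + m.q2 ρ ε * w i)
        + tr L * ((4 * ρ * a * m.s1 ρ ε
            + 2 * ρ ^ 2 * (dRho m.s1 ρ ε * a + dEps m.s1 ρ ε * b)) * g i
          + 2 * ρ ^ 2 * m.s1 ρ ε * w i) := by
  have hr := hasDerivAt_add_mul ρ a
  have he := hasDerivAt_add_mul ε b
  have hg : HasDerivAt (fun s : ℝ => g + s • w) w 0 := by
    simpa using ((hasDerivAt_id (0 : ℝ)).smul_const w).const_add g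
  have hz : (ρ + 0 * a, ε + 0 * b) ∈ D := by simpa using h0
  have hs : ∀ {f : ℝ → ℝ → ℝ}, Smooth2 D f → HasDerivAt (fun s => f (ρ + s * a) (ε + s * b))
      (dRho f ρ ε * a + dEps f ρ ε * b) 0 := fun hf => by
    simpa using hf.hasDerivAt hD hr he hz
  have hγ : HasDerivAt (fun s : ℝ => ((ρ + s * a, ε + s * b, g + s • w, L, e, H) : State))
      (a, b, w, 0, 0, 0) 0 :=
    hr.prodMk (he.prodMk (hg.prodMk ((hasDerivAt_const 0 L).prodMk
      ((hasDerivAt_const 0 e).prodMk (hasDerivAt_const 0 H)))))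
  have h1 := hasDerivAt_comp_flux hD hJ hγ hz i
  simp only [zero_mul, add_zero, zero_smul] at h1
  have hA := (hs (hm.s0.dEps hD)).fun_add
    ((hs (hm.s1.dEps hD)).fun_mul (hasDerivAt_dot_add_smul g w))
  have hq := ((hs hm.q1).mul_const (e i)).fun_add
    ((hs hm.q2).fun_mul (hasDerivAt_add_mul (g i) (w i)))
  have hl := (((hr.fun_pow 2).const_mul 2).fun_mul (hs hm.s1)).mul_const (tr L)
    |>.fun_mul (hasDerivAt_add_mul (g i) (w i))
  have hnear : ∀ᶠ s : ℝ in nhds 0, (ρ + s * a, ε + s * b) ∈ D :=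
    (by fun_prop : Continuous fun s : ℝ => (ρ + s * a, ε + s * b)).continuousAt.preimage_mem_nhds
      (hD.mem_nhds hz)
  -- The explicit flux holds along the whole curve near `s = 0`, since `D` is open and `L`, `H` stay
  -- fixed and symmetric.
  have h2 := ((hA.fun_mul hq).fun_add hl).congr_of_eventuallyEq
    (f₁ := fun s : ℝ => J (ρ + s * a, ε + s * b, g + s • w, L, e, H) i) (by
      filter_upwards [hnear] with s hs
      exact flux_eq hc hD hJ hJiso hs (g + s • w) e hL hH i)
  rw [h1.unique h2]
  simp only [zero_mul, add_zero, zero_smul]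
  push_cast
  ring

/-- The entropy inequality when `∇ε = 0` and the axes are principal directions. -/
theorem residual_inequality (hc : FluxConditions D m J) (hD : IsOpen D) (hm : m.SmoothOn D)
    (hJ : ContDiffOn ℝ ∞ J (State.region D)) (hJiso : IsotropicVector D J) {ρ ε : ℝ}
    (h0 : (ρ, ε) ∈ D) (γ l₀ l₁ l₂ h₀ h₁ h₂ : ℝ) :
    0 ≤ -ρ ^ 2 * (dRho m.s0 ρ ε + dRho m.s1 ρ ε * γ ^ 2) * (l₀ + l₁ + l₂)
      + (dEps m.s0 ρ ε + dEps m.s1 ρ ε * γ ^ 2)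
        * ((-m.p ρ ε + m.α1 ρ ε * (h₀ + h₁ + h₂) + m.α2 ρ ε * γ ^ 2) * (l₀ + l₁ + l₂)
          + m.α3 ρ ε * γ ^ 2 * l₀ + m.α4 ρ ε * (h₀ * l₀ + h₁ * l₁ + h₂ * l₂)
          + m.α5 ρ ε * (l₀ + l₁ + l₂) ^ 2 + m.α6 ρ ε * (l₀ ^ 2 + l₁ ^ 2 + l₂ ^ 2))
      - 2 * ρ * m.s1 ρ ε * γ ^ 2 * l₀
      + (l₀ + l₁ + l₂) * (2 * ρ * m.s1 ρ ε * γ ^ 2 + 2 * ρ ^ 2 * dRho m.s1 ρ ε * γ ^ 2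
        + 2 * ρ ^ 2 * m.s1 ρ ε * (h₀ + h₁ + h₂))
      + m.q2 ρ ε * γ ^ 2 * (dRho (dEps m.s0) ρ ε + dRho (dEps m.s1) ρ ε * γ ^ 2
        + 2 * dEps m.s1 ρ ε * h₀) := by
  have h := hc.nonneg ρ ε h0 (γ • axis 0) 0 (diag l₀ l₁ l₂) (diag h₀ h₁ h₂) (diag_symm _ _ _)
    (diag_symm _ _ _)
  simp only [fderiv_flux hc hD hm hJ hJiso h0 (γ • axis 0) 0 (diag_symm l₀ l₁ l₂)
    (diag_symm h₀ h₁ h₂)] at h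
  refine h.trans_eq ?_
  simp only [divHeatFlux, MaterialFunctions.stress, State.rho, State.eps, State.gradRho, State.L,
    State.hessRho, tr, dot, ddot, diag, axis, delta, Fin.sum_univ_three, Pi.smul_apply,
    Pi.zero_apply, smul_eq_mul]
  simp only [Fin.isValue, reduceIte, Matrix.cons_val_zero, Matrix.cons_val_one, Matrix.cons_val,
    zero_ne_one, one_ne_zero, Fin.reduceEq]
  ring

/-- Near `t = 0` the linear term dominates. The choice `t = -d / (|c| + 1)` makes the expression
negative whatever the sign of `c`, unless `d = 0`. -/
theorem eq_zero_of_forall_quadratic_nonneg {c d : ℝ} (h : ∀ t : ℝ, 0 ≤ t * d + t ^ 2 * c) :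
    d = 0 := by
  have hk : 0 < |c| + 1 := by positivity
  have h1 := h (-d / (|c| + 1))
  have h2 : -d / (|c| + 1) * d + (-d / (|c| + 1)) ^ 2 * c
      = -(d ^ 2 * (|c| + 1 - c)) / (|c| + 1) ^ 2 := by
    field_simp
    ring
  rw [h2] at h1
  replace h1 : 0 ≤ -(d ^ 2 * (|c| + 1 - c)) := by
    by_contra! hneg
    linarith [div_neg_of_neg_of_pos hneg (pow_pos hk 2)]
  have h3 : 0 < |c| + 1 - c := by linarith [le_abs_self c]
  have h4 : d ^ 2 ≤ 0 := by
    by_contra hd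
    nlinarith [mul_pos (not_le.1 hd) h3]
  exact pow_eq_zero_iff (two_ne_zero) |>.1 (le_antisymm h4 (sq_nonneg d))

theorem nonneg_of_forall_sq_nonneg {c d : ℝ} (h : ∀ t : ℝ, 0 ≤ c + t ^ 2 * d) : 0 ≤ d := by
  by_contra! hd
  have h1 := h (Real.sqrt ((|c| + 1) / -d))
  rw [Real.sq_sqrt (div_nonneg (by positivity) (by linarith))] at h1
  have h2 : (|c| + 1) / -d * d = -(|c| + 1) := by
    rw [div_neg, neg_mul, div_mul_cancel₀ _ hd.ne]
  rw [h2] at h1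
  linarith [le_abs_self c]

/-- Scaling `∇∇ρ` by `t` makes the residual inequality affine in `t`; this is the coefficient. -/
theorem hess_coefficient_eq_zero (hc : FluxConditions D m J) (hD : IsOpen D) (hm : m.SmoothOn D)
    (hJ : ContDiffOn ℝ ∞ J (State.region D)) (hJiso : IsotropicVector D J) {ρ ε : ℝ}
    (h0 : (ρ, ε) ∈ D) (γ l₀ l₁ l₂ h₀ h₁ h₂ : ℝ) :
    (dEps m.s0 ρ ε + dEps m.s1 ρ ε * γ ^ 2)
        * (m.α1 ρ ε * (h₀ + h₁ + h₂) * (l₀ + l₁ + l₂)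
          + m.α4 ρ ε * (h₀ * l₀ + h₁ * l₁ + h₂ * l₂))
      + 2 * ρ ^ 2 * m.s1 ρ ε * (h₀ + h₁ + h₂) * (l₀ + l₁ + l₂)
      + 2 * m.q2 ρ ε * γ ^ 2 * dEps m.s1 ρ ε * h₀ = 0 := by
  refine eq_zero_of_forall_affine_nonneg
    (c := -ρ ^ 2 * (dRho m.s0 ρ ε + dRho m.s1 ρ ε * γ ^ 2) * (l₀ + l₁ + l₂)
      + (dEps m.s0 ρ ε + dEps m.s1 ρ ε * γ ^ 2)
        * ((-m.p ρ ε + m.α2 ρ ε * γ ^ 2) * (l₀ + l₁ + l₂)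
          + m.α3 ρ ε * γ ^ 2 * l₀
          + m.α5 ρ ε * (l₀ + l₁ + l₂) ^ 2 + m.α6 ρ ε * (l₀ ^ 2 + l₁ ^ 2 + l₂ ^ 2))
      - 2 * ρ * m.s1 ρ ε * γ ^ 2 * l₀
      + (l₀ + l₁ + l₂) * (2 * ρ * m.s1 ρ ε * γ ^ 2 + 2 * ρ ^ 2 * dRho m.s1 ρ ε * γ ^ 2)
      + m.q2 ρ ε * γ ^ 2 * (dRho (dEps m.s0) ρ ε + dRho (dEps m.s1) ρ ε * γ ^ 2)) fun t =>
    (residual_inequality hc hD hm hJ hJiso h0 γ l₀ l₁ l₂ (t * h₀) (t * h₁) (t * h₂)).trans_eq ?_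
  ring

theorem α4_eq_zero (hc : FluxConditions D m J) (hD : IsOpen D) (hm : m.SmoothOn D)
    (hJ : ContDiffOn ℝ ∞ J (State.region D)) (hJiso : IsotropicVector D J)
    (hs0 : ∀ ρ ε : ℝ, (ρ, ε) ∈ D → dEps m.s0 ρ ε ≠ 0) {ρ ε : ℝ} (h0 : (ρ, ε) ∈ D) :
    m.α4 ρ ε = 0 := by
  -- Trace-free `L` and `∇∇ρ` at `γ = 0` remove every term except the one with `α₄`.
  have h := hess_coefficient_eq_zero hc hD hm hJ hJiso h0 0 1 (-1) 0 1 (-1) 0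
  exact (mul_eq_zero.1 (by linarith : dEps m.s0 ρ ε * m.α4 ρ ε = 0)).resolve_left (hs0 ρ ε h0)

theorem α1_relation (hc : FluxConditions D m J) (hD : IsOpen D) (hm : m.SmoothOn D)
    (hJ : ContDiffOn ℝ ∞ J (State.region D)) (hJiso : IsotropicVector D J)
    (hs0 : ∀ ρ ε : ℝ, (ρ, ε) ∈ D → dEps m.s0 ρ ε ≠ 0) {ρ ε : ℝ} (h0 : (ρ, ε) ∈ D) :
    dEps m.s0 ρ ε * m.α1 ρ ε = -2 * ρ ^ 2 * m.s1 ρ ε := by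
  have h := hess_coefficient_eq_zero hc hD hm hJ hJiso h0 0 1 0 0 1 0 0
  rw [α4_eq_zero hc hD hm hJ hJiso hs0 h0] at h
  linear_combination h

theorem dEps_s1_eq_zero (hc : FluxConditions D m J) (hD : IsOpen D) (hm : m.SmoothOn D)
    (hJ : ContDiffOn ℝ ∞ J (State.region D)) (hJiso : IsotropicVector D J)
    (hs0 : ∀ ρ ε : ℝ, (ρ, ε) ∈ D → dEps m.s0 ρ ε ≠ 0)
    (hcap : D ⊆ closure {z : ℝ × ℝ | z ∈ D ∧ m.α1 z.1 z.2 + m.α4 z.1 z.2 ≠ 0})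
    {ρ ε : ℝ} (h0 : (ρ, ε) ∈ D) : dEps m.s1 ρ ε = 0 := by
  refine (hm.s1.dEps hD).eq_zero_of_mul_eq_zero (A := fun z => m.α1 z.1 z.2 + m.α4 z.1 z.2)
    hD hcap (fun ρ ε h => ?_) h0
  -- With `h₀ = 0` the term with `q₂` is absent; comparison with the relation at `γ = 0` leaves `α₁
  -- ∂s₁/∂ε = 0`.
  have h1 := hess_coefficient_eq_zero hc hD hm hJ hJiso h 1 0 1 0 0 1 0
  have h2 := α1_relation hc hD hm hJ hJiso hs0 h
  have h3 := α4_eq_zero hc hD hm hJ hJiso hs0 h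
  simp only [h3] at h1 ⊢
  linear_combination h1 - h2

/-- At `∇ρ = 0` and `∇∇ρ = 0` the residual is quadratic in `L` without constant term, so its linear
part vanishes; the viscosities `α₅`, `α₆` enter only the quadratic part. -/
theorem p_relation (hc : FluxConditions D m J) (hD : IsOpen D) (hm : m.SmoothOn D)
    (hJ : ContDiffOn ℝ ∞ J (State.region D)) (hJiso : IsotropicVector D J) {ρ ε : ℝ}
    (h0 : (ρ, ε) ∈ D) : dEps m.s0 ρ ε * m.p ρ ε = -ρ ^ 2 * dRho m.s0 ρ ε := by
  have h : -ρ ^ 2 * dRho m.s0 ρ ε - dEps m.s0 ρ ε * m.p ρ ε = 0 :=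
    eq_zero_of_forall_quadratic_nonneg (c := dEps m.s0 ρ ε * (m.α5 ρ ε + m.α6 ρ ε)) fun t =>
      (residual_inequality hc hD hm hJ hJiso h0 0 t 0 0 0 0 0).trans_eq (by ring)
  linarith

/-- For `L = diag(x, y - x, 0)` and `∂s₁/∂ε = 0` the residual is affine in `γ²`; letting `γ` grow
leaves the sign of its slope, which no longer contains the viscosities and is affine in `x` and `y`.
-/
theorem capillary_inequality (hc : FluxConditions D m J) (hD : IsOpen D) (hm : m.SmoothOn D)
    (hJ : ContDiffOn ℝ ∞ J (State.region D)) (hJiso : IsotropicVector D J)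
    (hs1 : ∀ ρ ε : ℝ, (ρ, ε) ∈ D → dEps m.s1 ρ ε = 0) {ρ ε : ℝ} (h0 : (ρ, ε) ∈ D) (x y : ℝ) :
    0 ≤ (ρ ^ 2 * dRho m.s1 ρ ε + 2 * ρ * m.s1 ρ ε + dEps m.s0 ρ ε * m.α2 ρ ε) * y
      + (dEps m.s0 ρ ε * m.α3 ρ ε - 2 * ρ * m.s1 ρ ε) * x
      + m.q2 ρ ε * dRho (dEps m.s0) ρ ε := by
  refine nonneg_of_forall_sq_nonneg (c := -ρ ^ 2 * dRho m.s0 ρ ε * y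
      + dEps m.s0 ρ ε * (-m.p ρ ε * y + m.α5 ρ ε * y ^ 2 + m.α6 ρ ε * (x ^ 2 + (y - x) ^ 2)))
    fun γ => ?_
  refine (residual_inequality hc hD hm hJ hJiso h0 γ x (y - x) 0 0 0 0).trans_eq ?_
  rw [hs1 ρ ε h0, dRho_eq_zero hD hs1 h0]
  ring

theorem capillary_relations (hc : FluxConditions D m J) (hD : IsOpen D) (hm : m.SmoothOn D)
    (hJ : ContDiffOn ℝ ∞ J (State.region D)) (hJiso : IsotropicVector D J)
    (hs1 : ∀ ρ ε : ℝ, (ρ, ε) ∈ D → dEps m.s1 ρ ε = 0) {ρ ε : ℝ} (h0 : (ρ, ε) ∈ D) :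
    ρ ^ 2 * dRho m.s1 ρ ε + 2 * ρ * m.s1 ρ ε + dEps m.s0 ρ ε * m.α2 ρ ε = 0
      ∧ dEps m.s0 ρ ε * m.α3 ρ ε - 2 * ρ * m.s1 ρ ε = 0 :=
  ⟨eq_zero_of_forall_affine_nonneg (c := m.q2 ρ ε * dRho (dEps m.s0) ρ ε) fun t =>
      (capillary_inequality hc hD hm hJ hJiso hs1 h0 0 t).trans_eq (by ring),
    eq_zero_of_forall_affine_nonneg (c := m.q2 ρ ε * dRho (dEps m.s0) ρ ε) fun t =>
      (capillary_inequality hc hD hm hJ hJiso hs1 h0 t 0).trans_eq (by ring)⟩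

end Residual

/-! ### Functions of the density alone. -/

section Slices

variable {D : Set (ℝ × ℝ)} {f : ℝ → ℝ → ℝ}

/-- A function with `∂f/∂ε = 0` is constant along the connected slices of its domain. -/
theorem eq_of_dEps_eq_zero (hD : IsOpen D) (hDslice : ∀ ρ : ℝ, IsPreconnected {ε : ℝ | (ρ, ε) ∈ D})
    (hf : Smooth2 D f) (h : ∀ ρ ε, (ρ, ε) ∈ D → dEps f ρ ε = 0) {ρ ε ε' : ℝ}
    (h1 : (ρ, ε) ∈ D) (h2 : (ρ, ε') ∈ D) : f ρ ε = f ρ ε' := by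
  have ho : IsOpen {ε : ℝ | (ρ, ε) ∈ D} :=
    hD.preimage (by fun_prop : Continuous fun ε : ℝ => (ρ, ε))
  have hd : ∀ ε, (ρ, ε) ∈ D → HasDerivAt (fun ε => f ρ ε) 0 ε := fun ε hε => by
    simpa [h ρ ε hε] using hf.hasDerivAt hD (hasDerivAt_const ε ρ) (hasDerivAt_id ε) hε
  exact ho.is_const_of_deriv_eq_zero (hDslice ρ)
    (fun ε hε => (hd ε hε).differentiableAt.differentiableWithinAt)
    (fun ε hε => (hd ε hε).deriv) h1 h2

/-- A smooth function with `∂f/∂ε = 0` is a smooth function of `ρ` alone. -/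
theorem exists_eq_of_dEps_eq_zero (hD : IsOpen D)
    (hDslice : ∀ ρ : ℝ, IsPreconnected {ε : ℝ | (ρ, ε) ∈ D})
    (hf : Smooth2 D f) (h : ∀ ρ ε, (ρ, ε) ∈ D → dEps f ρ ε = 0) :
    ∃ S : ℝ → ℝ, ContDiffOn ℝ ∞ S (Prod.fst '' D) ∧
      ∀ ρ ε, (ρ, ε) ∈ D → f ρ ε = S ρ ∧ dRho f ρ ε = deriv S ρ := by
  classical
  let S : ℝ → ℝ := fun ρ => if hρ : ∃ ε, (ρ, ε) ∈ D then f ρ hρ.choose else 0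
  have hS : ∀ ρ ε, (ρ, ε) ∈ D → f ρ ε = S ρ := fun ρ ε hz => by
    have hρ : ∃ ε, (ρ, ε) ∈ D := ⟨ε, hz⟩
    simp only [S, dif_pos hρ]
    exact eq_of_dEps_eq_zero hD hDslice hf h hz hρ.choose_spec
  -- `S` picks a point of each slice by choice, possibly discontinuously in `ρ`; since `f` is
  -- constant on slices, near `ρ` it agrees with `f` at fixed `ε`, which gives smoothness and the
  -- derivative.
  have hnear : ∀ ρ ε, (ρ, ε) ∈ D → S =ᶠ[nhds ρ] fun r => f r ε := fun ρ ε hz => by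
    have : ∀ᶠ r in nhds ρ, (r, ε) ∈ D :=
      (by fun_prop : Continuous fun r : ℝ => (r, ε)).continuousAt.preimage_mem_nhds
        (hD.mem_nhds hz)
    filter_upwards [this] with r hr using (hS r ε hr).symm
  refine ⟨S, ?_, fun ρ ε hz => ⟨hS ρ ε hz, (hnear ρ ε hz).deriv_eq.symm⟩⟩
  rintro _ ⟨⟨ρ, ε⟩, hz, rfl⟩
  have h1 : ContDiffAt ℝ ∞ (fun r => f r ε) ρ :=
    ContDiffAt.comp (g := fun z : ℝ × ℝ => f z.1 z.2) (f := fun r : ℝ => (r, ε)) ρ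
      (hf.contDiffAt hD hz) (contDiffAt_id.prodMk contDiffAt_const)
  exact (h1.congr_of_eventuallyEq (hnear ρ ε hz)).contDiffWithinAt

end Slices

end Korteweg

theorem mainTheorem1
    (D : Set (ℝ × ℝ)) (hD : IsOpen D) (hDpos : ∀ z ∈ D, 0 < z.1)
    (hDslice : ∀ ρ : ℝ, IsPreconnected {ε : ℝ | (ρ, ε) ∈ D})
    (m : Korteweg.MaterialFunctions) (hm : m.SmoothOn D)
    (J : Korteweg.State → Korteweg.V)
    (hJ : ContDiffOn ℝ ∞ J (Korteweg.State.region D))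
    (hJiso : Korteweg.IsotropicVector D J)
    (hs0 : ∀ ρ ε : ℝ, (ρ, ε) ∈ D → Korteweg.dEps m.s0 ρ ε ≠ 0)
    (hcap : D ⊆ closure {z : ℝ × ℝ | z ∈ D ∧ m.α1 z.1 z.2 + m.α4 z.1 z.2 ≠ 0})
    (hent : Korteweg.ExtendedEntropyPrinciple D m J) :
    ∃ S1 : ℝ → ℝ, ContDiffOn ℝ ∞ S1 (Prod.fst '' D) ∧
      (∀ z : Korteweg.State, z.Admissible D →
        m.entropy z
            = m.s0 z.rho z.eps + S1 z.rho * Korteweg.dot z.gradRho z.gradRho ∧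
        (∀ i, J z i = m.heatFlux z i * Korteweg.dEps m.s0 z.rho z.eps
            + 2 * z.rho ^ 2 * S1 z.rho * Korteweg.tr z.L * z.gradRho i)) ∧
      (∀ ρ ε : ℝ, (ρ, ε) ∈ D →
        (m.s1 ρ ε = S1 ρ ∧ m.s2 ρ ε = 0 ∧ m.s3 ρ ε = 0 ∧ m.s4 ρ ε = 0 ∧ m.s5 ρ ε = 0) ∧
        m.p ρ ε = -ρ ^ 2 * Korteweg.dRho m.s0 ρ ε / Korteweg.dEps m.s0 ρ ε ∧
        m.α1 ρ ε = -2 * ρ ^ 2 * S1 ρ / Korteweg.dEps m.s0 ρ ε ∧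
        m.α2 ρ ε = -ρ * (ρ * deriv S1 ρ + 2 * S1 ρ) / Korteweg.dEps m.s0 ρ ε ∧
        m.α3 ρ ε = 2 * ρ * S1 ρ / Korteweg.dEps m.s0 ρ ε ∧
        m.α4 ρ ε = 0) := by
  have hs := fun ρ ε h =>
    Korteweg.entropy_coefficients_eq_zero hD hDpos hm hJ hcap hent (ρ := ρ) (ε := ε) h
  have hc := Korteweg.fluxConditions hD hDpos hm hJ hent hs
  have hs1 : ∀ ρ ε, (ρ, ε) ∈ D → Korteweg.dEps m.s1 ρ ε = 0 := fun ρ ε h =>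
    Korteweg.dEps_s1_eq_zero hc hD hm hJ hJiso hs0 hcap h
  obtain ⟨S, hS, hS1⟩ := Korteweg.exists_eq_of_dEps_eq_zero hD hDslice hm.s1 hs1
  refine ⟨S, hS, fun z hz => ⟨?_, fun i => ?_⟩, fun ρ ε h => ⟨⟨(hS1 ρ ε h).1, hs ρ ε h⟩, ?_⟩⟩
  · rw [Korteweg.entropy_eq hs hz.1, (hS1 _ _ hz.1).1]
  · have h1 : J z i = _ := Korteweg.flux_eq hc hD hJ hJiso hz.1 z.gradRho z.gradEps hz.2.1 hz.2.2 i
    rw [h1, hs1 _ _ hz.1, (hS1 _ _ hz.1).1, Korteweg.MaterialFunctions.heatFlux]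
    ring
  · obtain ⟨h2, h3⟩ := Korteweg.capillary_relations hc hD hm hJ hJiso hs1 h
    have hp := Korteweg.p_relation hc hD hm hJ hJiso h
    have h1 := Korteweg.α1_relation hc hD hm hJ hJiso hs0 h
    have hne := hs0 ρ ε h
    rw [(hS1 ρ ε h).1] at h1 h2 h3
    rw [(hS1 ρ ε h).2] at h2
    refine ⟨?_, ?_, ?_, ?_, Korteweg.α4_eq_zero hc hD hm hJ hJiso hs0 h⟩ <;> rw [eq_div_iff hne]
    · linear_combination hp
    · linear_combination h1
    · linear_combination h2
    · linear_combination h3
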